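/- Let $S^2\subset\mathbb R^3$ be the unit sphere with surface measure and Laplacian $\Delta$, let $P_k$ be the orthogonal projection of $L^2(S^2)$ onto the space $\mathcal H_k$ of (complex) spherical harmonics of degree $k\ge 0$, on which $\Delta=-\mu_k^2$ with $\mu_k=\sqrt{k(k+1)}$, and write $\langle a\rangle=(1+a^2)^{1/2}$. For $s\ge 0$ let $H^s$ be the space of $u\in L^2(S^2)$ with $$\|u\|_{H^s}=\Big(\sum_{k\ge 0}\langle\mu_k\rangle^{2s}\|P_ku\|_{L^2}^2\Big)^{1/2}<\infty ,$$ and let $H^s_{hom}$ be the space of $u\in H^s$ that lie in the closed linear span in $L^2(S^2)$ of the functions $(x_1+ix_2)^k$, $k\ge 0$, with the norm of $H^s$. For $b\ge 0$ let $X^{s,b}$ be the space of $f\in L^2(\mathbb R;L^2(S^2))$ with $$\|f\|_{X^{s,b}}=\Big(\sum_{k\ge 0}\big\|\langle\tau+\mu_k^2\rangle^{b}\langle\mu_k\rangle^{s}\,\widehat{P_kf}(\tau)\big\|_{L^2(\mathbb R\times S^2)}^2\Big)^{1/2}<\infty ,$$ where $\widehat{\ }$ is the (unitary) Fourier transform in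 time with kernel proportional to $e^{-it\tau}$. For $T>0$ let $X^{s,b}_T$ be the space of restrictions to $\{|t|\le T\}$ of elements of $X^{s,b}$, where $\|u\|_{X^{s,b}_T}$ is the infimum of $\|f\|_{X^{s,b}}$ over all $f\in X^{s,b}$ with $f=u$ for a.e. $t\in[-T,T]$. A solution on a time interval $J\ni 0$ of $$i\partial_tu+\Delta u=u^3,\qquad u(0)=u_0,$$ is a function $u$ on $J$ with values in $L^2(S^2)$, with $u(0)=u_0$ and $u(t)^3\in L^1(S^2)$ for a.e. $t\in J$, that satisfies the integral equation $$u(t)=e^{it\Delta}u_0-i\int_0^te^{i(t-t')\Delta}u^3(t')\,dt',\qquad t\in J,$$ understood by testing with spherical harmonics: for every $k\ge 0$ and $Y\in\mathcal H_k$ the function $t\mapsto\int_{S^2}\overline Y\,u(t)^3$ is integrable on $J$ and, for every $t\in J$, $$\int_{S^2}\overline Y\,u(t)=e^{-it\mu_k^2}\int_{S^2}\overline Y\,u_0-i\int_0^te^{-i(t-t')\mu_k^2}\int_{S^2}\overline Y\,u(t')^3\,dt'.$$ **Theorem 1.2.** This initial value problem is locally well-posed in $H^{1/4}_{hom}$.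 Namely, for every $r>0$ there exist $b>1/2$ and $T>0$ such that the following holds, where $B_r=\{\phi\in H^{1/4}_{hom}:\|\phi\|_{H^{1/4}}<r\}$. 1. (Existence.) For every $u_0\in B_r$ there is a solution $u\in C([-T,T];H^{1/4}_{hom})\cap X^{1/4,b}_T$ on $[-T,T]$. 2. (Uniqueness.) For every $u_0\in B_r$ and $0\le a\le T$, if $v$ is in $X^{1/4,b}_T$, its restriction to $[-a,T]$ is in $C([-a,T];H^{1/4}_{hom})$, and $v$ is a solution on $[-a,T]$ with data $u_0$, then $v=u$ on $[-a,T]$. In particular (for $a=0$) the solution in $C([0,T];H^{1/4}_{hom})\cap X^{1/4,b}_T$ is unique on $[0,T]$. 3. (Lipschitz dependence.) There is a constant $L\ge 0$ such that for all $u_0,v_0\in B_r$ with solutions $u,v$ from part 1, $$\sup_{|t|\le T}\|u(t)-v(t)\|_{H^{1/4}}\le L\|u_0-v_0\|_{H^{1/4}},\qquad \|u-v\|_{X^{1/4,b}_T}\le L\|u_0-v_0\|_{H^{1/4}} .$$ -/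

import Mathlib

open MeasureTheory Filter Set
open scoped ENNReal NNReal Topology FourierTransform

noncomputable section

namespace SphereNLS

/-- The unit sphere `S²` of `ℝ³`. -/
abbrev S2 : Type := Metric.sphere (0 : EuclideanSpace ℝ (Fin 3)) 1

/-- The surface measure of `S²`. -/
abbrev surf : Measure S2 := (volume : Measure (EuclideanSpace ℝ (Fin 3))).toSphere

/-- The complex Hilbert space `L²(S²)`. -/
abbrev L2S : Type := Lp ℂ 2 surf

/-- The coordinate function `x ↦ xᵢ` on `S²`, complex valued. -/
def coord (i : Fin 3) : C(S2, ℂ) where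
  toFun x := (((x : EuclideanSpace ℝ (Fin 3)) i : ℝ) : ℂ)
  continuous_toFun := by fun_prop

/-- The restriction of a complex polynomial in `x₁, x₂, x₃` to `S²`, as an element of `L²(S²)`. -/
def restrictPoly : MvPolynomial (Fin 3) ℂ →ₗ[ℂ] L2S :=
  (ContinuousMap.toLp (E := ℂ) 2 surf ℂ).toLinearMap ∘ₗ
    (MvPolynomial.aeval (R := ℂ) coord).toLinearMap

/-- The Laplacian `∂₁² + ∂₂² + ∂₃²` of `ℝ³` on polynomials. -/
def polyLaplacian : MvPolynomial (Fin 3) ℂ →ₗ[ℂ] MvPolynomial (Fin 3) ℂ :=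
  ∑ i : Fin 3, (MvPolynomial.pderiv i).toLinearMap ∘ₗ (MvPolynomial.pderiv i).toLinearMap

/-- The harmonic polynomials on `ℝ³` that are homogeneous of degree `k`. -/
def harmonicPoly (k : ℕ) : Submodule ℂ (MvPolynomial (Fin 3) ℂ) :=
  MvPolynomial.homogeneousSubmodule (Fin 3) ℂ k ⊓ LinearMap.ker polyLaplacian

/-- The space `𝓗ₖ` of spherical harmonics of degree `k`. It is the eigenspace of the Laplacian `Δ`
of `S²` for the eigenvalue `-k(k+1)`. -/
def harm (k : ℕ) : Submodule ℂ L2S := (harmonicPoly k).map restrictPoly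

instance finiteDimensional_harm (k : ℕ) : FiniteDimensional ℂ (harm k) := by
  have h1 : Module.Finite ℂ (MvPolynomial.homogeneousSubmodule (Fin 3) ℂ k) :=
    Module.Finite.iff_fg.mpr (MvPolynomial.homogeneousSubmodule_fg _ _ k)
  have h2 : Module.Finite ℂ (harmonicPoly k) :=
    Submodule.finiteDimensional_of_le (inf_le_left : harmonicPoly k ≤ _)
  exact Module.Finite.map (harmonicPoly k) restrictPoly

/-- The orthogonal projection `Pₖ` of `L²(S²)` onto `𝓗ₖ`. -/
def proj (k : ℕ) : L2S →L[ℂ] L2S := (harm k).starProjection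

/-- `⟨a⟩ = (1 + |a|²)^{1/2}`. -/
def bracket (a : ℝ) : ℝ := Real.sqrt (1 + a ^ 2)

/-- `μₖ = √(k(k+1))`. -/
def freq (k : ℕ) : ℝ := Real.sqrt ((k : ℝ) * (k + 1))

/-- The Sobolev norm `‖u‖_{H^s} = (∑ₖ ⟨μₖ⟩^{2s} ‖Pₖ u‖²)^{1/2}`, with value `∞` outside `H^s(S²)`. -/
def sobNorm (s : ℝ) (u : L2S) : ℝ≥0∞ :=
  (∑' k : ℕ, ENNReal.ofReal (bracket (freq k) ^ (2 * s)) * ‖proj k u‖ₑ ^ 2) ^ (1 / 2 : ℝ)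

/-- The homogeneous spherical harmonic `(x₁ + i x₂)^k` on `S²`. -/
def psi (k : ℕ) : L2S :=
  restrictPoly ((MvPolynomial.X 0 + MvPolynomial.C Complex.I * MvPolynomial.X 1) ^ k)

/-- `H^s_hom`: the functions of `H^s(S²)` in the closed linear span of the `(x₁ + i x₂)^k`. -/
def Hhom (s : ℝ) : Set L2S :=
  {u | u ∈ (Submodule.span ℂ (Set.range psi)).topologicalClosure ∧ sobNorm s u < ∞}

/-- `u ∈ C(J; H^s_hom)`. -/
def ContHhom (s : ℝ) (J : Set ℝ) (u : ℝ → L2S) : Prop :=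
  (∀ t ∈ J, u t ∈ Hhom s) ∧
    ∀ t ∈ J, Tendsto (fun t' => sobNorm s (u t' - u t)) (𝓝[J] t) (𝓝 0)

/-- The norm of `X^{s,b}`, for `b ≥ 0`,
`(∑ₖ ‖⟨τ + μₖ²⟩^b ⟨μₖ⟩^s (Pₖ f)^(τ)‖²_{L²(ℝ × S²)})^{1/2}`,
with value `∞` for the `f ∈ L²(ℝ; L²(S²))` outside `X^{s,b}`. The transform `𝓕` has kernel
`exp (-2πitξ)`, so that `τ = 2πξ`; this is the norm for the unitary transform in `τ`. -/
def xNorm (s b : ℝ) (f : Lp L2S 2 (volume : Measure ℝ)) : ℝ≥0∞ :=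
  (∑' k : ℕ, ∫⁻ ξ : ℝ,
    ENNReal.ofReal ((bracket (2 * Real.pi * ξ + freq k ^ 2) ^ b * bracket (freq k) ^ s) ^ 2) *
      ‖(𝓕 ((proj k).compLp f) : Lp L2S 2 (volume : Measure ℝ)) ξ‖ₑ ^ 2) ^ (1 / 2 : ℝ)

/-- The norm of the restriction space `X^{s,b}_T = {f|_{|t| ≤ T} : f ∈ X^{s,b}}`: the infimum of
`‖f‖_{X^{s,b}}` over all extensions `f` of `u|_{[-T,T]}`. It is finite if and only if
`u|_{[-T,T]}` belongs to `X^{s,b}_T`. -/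
def xNormT (s b T : ℝ) (u : ℝ → L2S) : ℝ≥0∞ :=
  ⨅ (f : Lp L2S 2 (volume : Measure ℝ))
    (_ : (f : ℝ → L2S) =ᵐ[volume.restrict (Icc (-T) T)] u), xNorm s b f

/-- `u` solves `i∂ₜu + Δu = u³`, `u(0) = u₀`, on the time interval `J ∋ 0`, in the sense of the
integral equation `u(t) = e^{itΔ} u₀ - i ∫₀ᵗ e^{i(t-t')Δ} u³(t') dt'`. Here `u(t)³ ∈ L¹(S²)` for
almost every `t`, and the integral equation, an identity of distributions on `S²`, is tested
against all spherical harmonics `Y`; on those of degree `k`, `e^{itΔ}` is `e^{-itμₖ²}`. -/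
structure IsSolution (J : Set ℝ) (u₀ : L2S) (u : ℝ → L2S) : Prop where
  initial : u 0 = u₀
  integrable_cube : ∀ᵐ t ∂(volume.restrict J), Integrable (fun x : S2 => (u t x) ^ 3) surf
  integrable_coeff : ∀ k : ℕ, ∀ Y ∈ harm k,
    IntegrableOn (fun t : ℝ => ∫ x : S2, starRingEnd ℂ (Y x) * (u t x) ^ 3 ∂surf) J
  duhamel : ∀ k : ℕ, ∀ Y ∈ harm k, ∀ t ∈ J,
    inner ℂ Y (u t) =
      Complex.exp (-Complex.I * ((t * freq k ^ 2 : ℝ) : ℂ)) * inner ℂ Y u₀ -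
        Complex.I * ∫ t' in (0 : ℝ)..t,
          Complex.exp (-Complex.I * (((t - t') * freq k ^ 2 : ℝ) : ℂ)) *
            ∫ x : S2, starRingEnd ℂ (Y x) * (u t' x) ^ 3 ∂surf

end SphereNLS

end

open SphereNLS

namespace SphereNLS

open Finset.HasAntidiagonal renaming antidiagonal → antidiag, mem_antidiagonal → mem_antidiag

/-! ### The Cauchy–Schwarz inequality and convolutions -/

/-! The functions ψₖ = (x₁ + i x₂)^k are orthogonal harmonics with ψⱼψₖ = ψⱼ₊ₖ, and ‖ψₖ‖² decays
like k^(-1/2). For u = ∑ aₖψₖ the weight ⟨μₖ⟩^(1/2) in the square of the H^{1/4} norm cancels this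
decay, so that norm is comparable to the ℓ² norm of (aₖ) (`sobWeight_bounds`). Multiplication
becomes the Cauchy product, and the equation becomes aₙ' = -i n(n+1) aₙ - i (a∗a∗a)ₙ with data in
ℓ². This is in essence the L² theory of the cubic Schrödinger equation on the circle, by Bourgain's
method.

A space-time function is handled as a family g n ξ of time-Fourier transforms of its coefficients.
`xn s` is the square of its norm with weight (1 + |τ + n(n+1)|)^s, so it corresponds to b = s/2;
solutions live at s = 9/8, that is b = 9/16. The analytic core is that the weight to the power -7/8,
convolved with itself on ℤ × ℝ, is bounded (`exists_lconvolution_wtPow_le`). This rests on the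
curvature of n ↦ n(n+1). Cauchy–Schwarz then gives the bilinear L⁴ Strichartz estimate
(`xn_bconv_le`), and duality gives the trilinear estimate from b = 7/16 to b = -7/16 (`xn_tri_le`).

To invert the linear part, a is added to both sides: a' + (1 + i n(n+1)) a = -i a∗a∗a + a. The
symbol 1 + i(τ + n(n+1)) never vanishes, and division by it raises b from -7/16 to 9/16
(`xn_undamp_le`); a multiple of an extended free solution then adjusts the initial value. The right
side is cut off in time at scale l, and passing from b = 9/16 to b = 7/16 under this cutoff gains a
power of l (`xn_loc_le`). For small l the resulting map is a contraction on a ball of a weighted L²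
space (`exists_fixed_point`). Its fixed point solves the equation on [-l, l], where the cutoff is 1;
comparison of two fixed points gives the Lipschitz bounds.

For uniqueness (`coef_eq_of_close`), the difference of two solutions is represented on a short
interval by families of smaller and smaller norm, so it vanishes there; steps of fixed length then
cover the whole interval.

The return to the sphere rests on three facts. Almost everywhere |x₁ + i x₂| < 1, so elements of the
span are absolutely convergent power series (`coeFn_synth`). By the bilinear estimate u(t)² is in L²
for almost every t, so u(t)³ is integrable and its pairings with harmonics are Cauchy products
(`integral_conj_mul_cube_synth`). Finite X norm and finite weighted family norm correspond to each
other (`exists_family_of_xNorm_lt_top`, `exists_extension_of_xn`). -/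

theorem sq_lintegral_le {α : Type*} [MeasurableSpace α] {μ : Measure α} {F a c : α → ℝ≥0∞}
    (ha : AEMeasurable a μ) (hc : AEMeasurable c μ) (h : ∀ x, F x ^ 2 ≤ a x * c x) :
    (∫⁻ x, F x ∂μ) ^ 2 ≤ (∫⁻ x, a x ∂μ) * ∫⁻ x, c x ∂μ := by
  have key : ∀ x, F x ≤ a x ^ (1 / 2 : ℝ) * c x ^ (1 / 2 : ℝ) := by
    intro x
    rw [← ENNReal.mul_rpow_of_nonneg _ _ (by norm_num)]
    calc F x = (F x ^ (2 : ℝ)) ^ (1 / 2 : ℝ) := by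
          rw [← ENNReal.rpow_mul]; norm_num
      _ ≤ _ := by
          gcongr
          simpa using h x
  have h2 : ∫⁻ x, F x ∂μ ≤ (∫⁻ x, a x ∂μ) ^ (1 / 2 : ℝ) * (∫⁻ x, c x ∂μ) ^ (1 / 2 : ℝ) := by
    refine (lintegral_mono key).trans ?_
    have := ENNReal.lintegral_mul_le_Lp_mul_Lq μ Real.HolderConjugate.two_two
      (ha.pow_const (1 / 2 : ℝ)) (hc.pow_const (1 / 2 : ℝ))
    have e : ∀ u : ℝ≥0∞, (u ^ (1 / 2 : ℝ)) ^ (2 : ℝ) = u := fun u => by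
      rw [← ENNReal.rpow_mul]; norm_num
    simpa only [e, Pi.mul_apply] using this
  calc (∫⁻ x, F x ∂μ) ^ 2
      ≤ ((∫⁻ x, a x ∂μ) ^ (1 / 2 : ℝ) * (∫⁻ x, c x ∂μ) ^ (1 / 2 : ℝ)) ^ 2 := by gcongr
    _ = _ := by
      rw [mul_pow, ← ENNReal.rpow_natCast, ← ENNReal.rpow_natCast, ← ENNReal.rpow_mul,
        ← ENNReal.rpow_mul]
      norm_num

section Group

variable {G : Type*} [MeasurableSpace G] [AddCommGroup G] [MeasurableAdd₂ G] [MeasurableNeg G]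
  {μ : Measure G} [SFinite μ] [μ.IsAddLeftInvariant]

theorem lintegral_lconvolution_eq {f g : G → ℝ≥0∞} (hf : Measurable f) (hg : Measurable g) :
    ∫⁻ z, (f ⋆ₗ[μ] g) z ∂μ = (∫⁻ y, f y ∂μ) * ∫⁻ y, g y ∂μ := by
  simp only [lconvolution_def]
  rw [lintegral_lintegral_swap (by fun_prop)]
  rw [← lintegral_mul_const _ hf]
  refine lintegral_congr fun y => ?_
  rw [lintegral_const_mul _ (by fun_prop), lintegral_add_left_eq_self]

/-- Inserting A B = 1 at both points and applying Cauchy–Schwarz separates a factor A ⋆ A, bounded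
by K, from a convolution of two nonnegative functions, whose integral is the product of the
integrals. With A a power of the dispersive weight this is the bilinear Strichartz estimate. -/
theorem lintegral_lconvolution_sq_le {A B f g : G → ℝ≥0∞} {K : ℝ≥0∞} (hA : Measurable A)
    (hB : Measurable B) (hAB : ∀ x, A x * B x = 1) (hf : Measurable f) (hg : Measurable g)
    (hK : ∀ z, (A ⋆ₗ[μ] A) z ≤ K) :
    ∫⁻ z, (f ⋆ₗ[μ] g) z ^ 2 ∂μ ≤ K * ((∫⁻ y, B y * f y ^ 2 ∂μ) * ∫⁻ y, B y * g y ^ 2 ∂μ) := by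
  have h1 : ∀ z, (f ⋆ₗ[μ] g) z ^ 2 ≤
      K * ((fun y => B y * f y ^ 2) ⋆ₗ[μ] (fun y => B y * g y ^ 2)) z := by
    intro z
    refine le_trans ?_ (mul_le_mul_left (hK z) _)
    simp only [lconvolution_def]
    refine sq_lintegral_le (by fun_prop) (by fun_prop) fun y => le_of_eq ?_
    calc (f y * g (-y + z)) ^ 2 = (A y * B y) * (A (-y + z) * B (-y + z)) *
          (f y * g (-y + z)) ^ 2 := by rw [hAB, hAB]; simp
      _ = _ := by ring
  refine (lintegral_mono h1).trans ?_
  rw [lintegral_const_mul _ (by fun_prop), lintegral_lconvolution_eq (by fun_prop) (by fun_prop)]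

/-- Both squares expand into integrals over x, x' of f x * f x' times an integral of a product of
two translates of h, and the substitution z ↦ z - x - x' matches them. Duality turns one convolution
of the trilinear form into a correlation, and this turns it back. -/
theorem lintegral_correlation_sq {f h : G → ℝ≥0∞} (hf : Measurable f) (hh : Measurable h) :
    ∫⁻ y, (∫⁻ x, f x * h (y + x) ∂μ) ^ 2 ∂μ = ∫⁻ z, (f ⋆ₗ[μ] h) z ^ 2 ∂μ := by
  have e1 : ∀ y, (∫⁻ x, f x * h (y + x) ∂μ) ^ 2 =
      ∫⁻ x, ∫⁻ x', f x * h (y + x) * (f x' * h (y + x')) ∂μ ∂μ := by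
    intro y
    rw [sq, ← lintegral_mul_const _ (by fun_prop)]
    refine lintegral_congr fun x => ?_
    rw [lintegral_const_mul _ (by fun_prop)]
  have e2 : ∀ z, (f ⋆ₗ[μ] h) z ^ 2 =
      ∫⁻ x, ∫⁻ x', f x * h (-x + z) * (f x' * h (-x' + z)) ∂μ ∂μ := by
    intro z
    rw [lconvolution_def, sq, ← lintegral_mul_const _ (by fun_prop)]
    refine lintegral_congr fun x => ?_
    rw [lintegral_const_mul _ (by fun_prop)]
  have swap : ∀ F : G → G → G → ℝ≥0∞, Measurable (fun p : G × G × G => F p.1 p.2.1 p.2.2) →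
      ∫⁻ y, ∫⁻ x, ∫⁻ x', F y x x' ∂μ ∂μ ∂μ = ∫⁻ x, ∫⁻ x', ∫⁻ y, F y x x' ∂μ ∂μ ∂μ := by
    intro F hF
    have hF' : Measurable (Function.uncurry fun y x => ∫⁻ x', F y x x' ∂μ) := by
      have : Measurable fun q : (G × G) × G => F q.1.1 q.1.2 q.2 :=
        hF.comp (by fun_prop : Measurable fun q : (G × G) × G => (q.1.1, q.1.2, q.2))
      exact this.lintegral_prod_right'
    rw [lintegral_lintegral_swap hF'.aemeasurable]
    refine lintegral_congr fun x => lintegral_lintegral_swap ?_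
    exact (hF.comp (by fun_prop : Measurable fun q : G × G => (q.1, x, q.2))).aemeasurable
  simp_rw [e1, e2]
  rw [swap (fun y x x' => f x * h (y + x) * (f x' * h (y + x'))) (by fun_prop),
    swap (fun z x x' => f x * h (-x + z) * (f x' * h (-x' + z))) (by fun_prop)]
  refine lintegral_congr fun x => lintegral_congr fun x' => ?_
  rw [← lintegral_add_left_eq_self _ (-x + -x')]
  refine lintegral_congr fun z => ?_
  have a1 : -x + -x' + z + x = -x' + z := by abel
  have a2 : -x + -x' + z + x' = -x + z := by abel
  rw [a1, a2]
  ring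

/-- By duality: the pairing of the triple convolution with h is the pairing of f₁ ⋆ f₂ with the
correlation of f₃ and h, and the bilinear estimate bounds both in L². The weight B on h becomes the
weight A on the output. -/
theorem lintegral_lconvolution_three_le [SigmaFinite μ] {A B f₁ f₂ f₃ : G → ℝ≥0∞} {K : ℝ≥0∞}
    (hA : Measurable A)
    (hB : Measurable B) (hAB : ∀ x, A x * B x = 1) (hA1 : ∀ x, A x ≤ 1) (h₁ : Measurable f₁)
    (h₂ : Measurable f₂) (h₃ : Measurable f₃) (hK : ∀ z, (A ⋆ₗ[μ] A) z ≤ K) :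
    ∫⁻ z, A z * ((f₁ ⋆ₗ[μ] f₂) ⋆ₗ[μ] f₃) z ^ 2 ∂μ ≤ K ^ 2 * ((∫⁻ y, B y * f₁ y ^ 2 ∂μ) *
      (∫⁻ y, B y * f₂ y ^ 2 ∂μ) * ∫⁻ y, B y * f₃ y ^ 2 ∂μ) := by
  set Q := K ^ 2 * ((∫⁻ y, B y * f₁ y ^ 2 ∂μ) *
      (∫⁻ y, B y * f₂ y ^ 2 ∂μ) * ∫⁻ y, B y * f₃ y ^ 2 ∂μ) with hQ
  set F := (f₁ ⋆ₗ[μ] f₂) ⋆ₗ[μ] f₃ with hF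
  have hFm : Measurable F := by fun_prop
  have dual : ∀ h : G → ℝ≥0∞, Measurable h → (∫⁻ z, F z * h z ∂μ) ^ 2 ≤
      Q * ∫⁻ z, B z * h z ^ 2 ∂μ := by
    intro h hh
    have e : ∫⁻ z, F z * h z ∂μ =
        ∫⁻ y, (f₁ ⋆ₗ[μ] f₂) y * ∫⁻ x, f₃ x * h (y + x) ∂μ ∂μ := by
      have : ∀ z, F z * h z = ∫⁻ y, (f₁ ⋆ₗ[μ] f₂) y * f₃ (-y + z) * h z ∂μ := by
        intro z
        rw [hF, lconvolution_def (f := f₁ ⋆ₗ[μ] f₂), lintegral_mul_const _ (by fun_prop)]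
      simp_rw [this]
      rw [lintegral_lintegral_swap (by fun_prop)]
      refine lintegral_congr fun y => ?_
      rw [← lintegral_const_mul _ (by fun_prop), ← lintegral_add_left_eq_self _ y]
      refine lintegral_congr fun x => ?_
      rw [neg_add_cancel_left, mul_assoc]
    rw [e]
    refine (sq_lintegral_le (a := fun y => (f₁ ⋆ₗ[μ] f₂) y ^ 2)
      (c := fun y => (∫⁻ x, f₃ x * h (y + x) ∂μ) ^ 2) (by fun_prop) (by fun_prop)
      fun y => le_of_eq (mul_pow _ _ _)).trans ?_
    rw [lintegral_correlation_sq h₃ hh]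
    refine (mul_le_mul' (lintegral_lconvolution_sq_le hA hB hAB h₁ h₂ hK)
      (lintegral_lconvolution_sq_le hA hB hAB h₃ hh hK)).trans (le_of_eq ?_)
    rw [hQ]; ring
  -- The natural test function is A F, but its pairing with F may be infinite. Truncating F in
  -- height and to sets of finite measure makes I finite, so I ^ 2 ≤ Q * I can be divided by I;
  -- Fatou's lemma removes the truncation.
  set S := spanningSets μ
  set m : ℕ → G → ℝ≥0∞ := fun N => (S N).indicator fun z => min (F z) N
  have hm : ∀ N, Measurable (m N) := fun N =>
    (hFm.min measurable_const).indicator (measurableSet_spanningSets μ N)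
  have hmF : ∀ N z, m N z ≤ F z := fun N z =>
    (indicator_le_self' (fun _ _ => zero_le) z).trans (min_le_left _ _)
  have bound : ∀ N, ∫⁻ z, A z * m N z ^ 2 ∂μ ≤ Q := by
    intro N
    set I := ∫⁻ z, A z * m N z ^ 2 ∂μ with hI
    have hfin : I ≠ ∞ := by
      have : I ≤ ∫⁻ z, (S N).indicator (fun _ => (N : ℝ≥0∞) ^ 2) z ∂μ := by
        refine lintegral_mono fun z => ?_
        by_cases hz : z ∈ S N
        · simp only [m, indicator_of_mem hz]
          calc _ ≤ 1 * (N : ℝ≥0∞) ^ 2 := by gcongr; exacts [hA1 z, min_le_right _ _]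
            _ = _ := one_mul _
        · simp [m, indicator_of_notMem hz]
      refine ne_top_of_le_ne_top ?_ this
      rw [lintegral_indicator (measurableSet_spanningSets μ N)]
      simp only [lintegral_const, MeasurableSet.univ, Measure.restrict_apply, univ_inter]
      exact ENNReal.mul_ne_top (by simp) (measure_spanningSets_lt_top μ N).ne
    have h1 : I ^ 2 ≤ Q * I := by
      have := dual (fun z => A z * m N z) (by fun_prop)
      have e : ∀ z, B z * (A z * m N z) ^ 2 = A z * m N z ^ 2 := fun z => by
        calc B z * (A z * m N z) ^ 2 = (A z * B z) * (A z * m N z ^ 2) := by ring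
          _ = _ := by rw [hAB, one_mul]
      simp_rw [e] at this
      refine le_trans ?_ this
      gcongr
      refine lintegral_mono fun z => ?_
      calc A z * m N z ^ 2 = m N z * (A z * m N z) := by ring
        _ ≤ _ := by gcongr; exact hmF N z
    rcases eq_or_ne I 0 with h0 | h0
    · rw [h0]; exact zero_le
    · rw [sq] at h1
      exact (ENNReal.mul_le_mul_iff_left h0 hfin).1 h1
  have lim : ∀ z, Tendsto (fun N => A z * m N z ^ 2) atTop (𝓝 (A z * F z ^ 2)) := by
    intro z
    have hm' : Tendsto (fun N => m N z) atTop (𝓝 (F z)) := by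
      have hev : ∀ᶠ N in atTop, m N z = min (F z) N := by
        filter_upwards [eventually_ge_atTop (spanningSetsIndex μ z)] with N hN
        exact indicator_of_mem (monotone_spanningSets μ hN (mem_spanningSetsIndex μ z)) _
      refine Tendsto.congr' (hev.mono fun _ h => h.symm) ?_
      have := (tendsto_const_nhds (x := F z)).min ENNReal.tendsto_nat_nhds_top
      simpa using this
    exact ENNReal.Tendsto.const_mul (((ENNReal.continuous_pow 2).tendsto _).comp hm')
      (Or.inr (ne_top_of_le_ne_top ENNReal.one_ne_top (hA1 z)))
  calc ∫⁻ z, A z * F z ^ 2 ∂μ = ∫⁻ z, liminf (fun N => A z * m N z ^ 2) atTop ∂μ :=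
        lintegral_congr fun z => (lim z).liminf_eq.symm
    _ ≤ liminf (fun N => ∫⁻ z, A z * m N z ^ 2 ∂μ) atTop :=
        lintegral_liminf_le fun N => by fun_prop
    _ ≤ Q := liminf_le_of_le (by isBoundedDefault) fun b hb => by
        obtain ⟨N, hN⟩ := hb.exists
        exact hN.trans (bound N)

end Group

/-! ### The dispersive weight on ℤ × ℝ and its convolution square. -/

/-- The larger variable Y is at least Z / 2, so 5/8 of its exponent pays for Z and the remaining 1/4
goes to X. The split is chosen so that 9/8 > 1 is integrable in the frequency and 5/8 > 1/2 is
summable along a quadratic phase. -/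
theorem rpow_mul_rpow_le {X Y Z : ℝ} (hX : 1 ≤ X) (hXY : X ≤ Y) (hZ : 1 ≤ Z) (h : Z ≤ X + Y) :
    X ^ (-(7 / 8) : ℝ) * Y ^ (-(7 / 8) : ℝ) ≤ 2 * X ^ (-(9 / 8) : ℝ) * Z ^ (-(5 / 8) : ℝ) := by
  have hX0 : 0 < X := by linarith
  have hY0 : 0 < Y := by linarith
  have hZ0 : 0 < Z := by linarith
  have h1 : Z ^ (5 / 8 : ℝ) ≤ 2 * Y ^ (5 / 8 : ℝ) := by
    calc Z ^ (5 / 8 : ℝ) ≤ (2 * Y) ^ (5 / 8 : ℝ) := by gcongr; linarith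
      _ = 2 ^ (5 / 8 : ℝ) * Y ^ (5 / 8 : ℝ) := Real.mul_rpow (by norm_num) hY0.le
      _ ≤ 2 ^ (1 : ℝ) * Y ^ (5 / 8 : ℝ) := by gcongr <;> norm_num
      _ = _ := by simp
  have h2 : Y ^ (-(1 / 4) : ℝ) ≤ X ^ (-(1 / 4) : ℝ) :=
    Real.rpow_le_rpow_of_nonpos hX0 hXY (by norm_num)
  have h3 : Z ^ (-(5 / 8) : ℝ) * Z ^ (5 / 8 : ℝ) = 1 := by
    rw [← Real.rpow_add hZ0]; norm_num
  calc X ^ (-(7 / 8) : ℝ) * Y ^ (-(7 / 8) : ℝ)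
      = X ^ (-(7 / 8) : ℝ) * Y ^ (-(7 / 8) : ℝ) * (Z ^ (-(5 / 8) : ℝ) * Z ^ (5 / 8 : ℝ)) := by
        rw [h3, mul_one]
    _ ≤ X ^ (-(7 / 8) : ℝ) * Y ^ (-(7 / 8) : ℝ) * (Z ^ (-(5 / 8) : ℝ) * (2 * Y ^ (5 / 8 : ℝ))) := by
        gcongr
    _ = 2 * (X ^ (-(7 / 8) : ℝ) * (Y ^ (-(7 / 8) : ℝ) * Y ^ (5 / 8 : ℝ))) * Z ^ (-(5 / 8) : ℝ) := by
        ring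
    _ = 2 * (X ^ (-(7 / 8) : ℝ) * Y ^ (-(1 / 4) : ℝ)) * Z ^ (-(5 / 8) : ℝ) := by
        rw [← Real.rpow_add hY0]; norm_num
    _ ≤ 2 * (X ^ (-(7 / 8) : ℝ) * X ^ (-(1 / 4) : ℝ)) * Z ^ (-(5 / 8) : ℝ) := by gcongr
    _ = _ := by rw [← Real.rpow_add hX0]; norm_num

theorem rpow_mul_rpow_le_add {X Y Z : ℝ} (hX : 1 ≤ X) (hY : 1 ≤ Y) (hZ : 1 ≤ Z)
    (h : Z ≤ X + Y) :
    X ^ (-(7 / 8) : ℝ) * Y ^ (-(7 / 8) : ℝ) ≤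
      (2 * X ^ (-(9 / 8) : ℝ) + 2 * Y ^ (-(9 / 8) : ℝ)) * Z ^ (-(5 / 8) : ℝ) := by
  have hX' : 0 ≤ 2 * X ^ (-(9 / 8) : ℝ) := by positivity
  have hY' : 0 ≤ 2 * Y ^ (-(9 / 8) : ℝ) := by positivity
  have hZ' : 0 ≤ Z ^ (-(5 / 8) : ℝ) := by positivity
  rcases le_total X Y with hle | hle
  · refine (rpow_mul_rpow_le hX hle hZ h).trans ?_
    gcongr
    linarith
  · rw [mul_comm]
    refine (rpow_mul_rpow_le hY hle hZ (by linarith)).trans ?_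
    gcongr
    linarith

theorem lintegral_one_add_abs_lt_top :
    ∫⁻ x : ℝ, ENNReal.ofReal ((1 + |2 * Real.pi * x|) ^ (-(9 / 8) : ℝ)) < ∞ := by
  have h : Integrable fun x : ℝ => (1 + ‖x‖) ^ (-(9 / 8) : ℝ) :=
    integrable_one_add_norm (by simp; norm_num)
  have := h.comp_mul_left' (R := 2 * Real.pi) (by positivity)
  simpa using this.lintegral_lt_top

theorem lintegral_one_add_abs_add (p : ℝ) :
    ∫⁻ x : ℝ, ENNReal.ofReal ((1 + |2 * Real.pi * x + p|) ^ (-(9 / 8) : ℝ)) =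
      ∫⁻ x : ℝ, ENNReal.ofReal ((1 + |2 * Real.pi * x|) ^ (-(9 / 8) : ℝ)) := by
  rw [← lintegral_add_right_eq_self
    (fun x : ℝ => ENNReal.ofReal ((1 + |2 * Real.pi * x|) ^ (-(9 / 8) : ℝ))) (p / (2 * Real.pi))]
  refine lintegral_congr fun x => ?_
  congr 4
  field_simp

theorem lintegral_one_add_abs_sub (ξ q : ℝ) :
    ∫⁻ x : ℝ, ENNReal.ofReal ((1 + |2 * Real.pi * (-x + ξ) + q|) ^ (-(9 / 8) : ℝ)) =
      ∫⁻ x : ℝ, ENNReal.ofReal ((1 + |2 * Real.pi * x|) ^ (-(9 / 8) : ℝ)) := by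
  rw [← lintegral_one_add_abs_add q,
    ← lintegral_sub_left_eq_self
      (fun x : ℝ => ENNReal.ofReal ((1 + |2 * Real.pi * x + q|) ^ (-(9 / 8) : ℝ))) ξ]
  refine lintegral_congr fun x => ?_
  rw [neg_add_eq_sub]

theorem lintegral_one_add_abs_mul_le (p q ξ : ℝ) :
    ∫⁻ η : ℝ, ENNReal.ofReal ((1 + |2 * Real.pi * η + p|) ^ (-(7 / 8) : ℝ)) *
        ENNReal.ofReal ((1 + |2 * Real.pi * (-η + ξ) + q|) ^ (-(7 / 8) : ℝ)) ≤
      (4 * ∫⁻ x : ℝ, ENNReal.ofReal ((1 + |2 * Real.pi * x|) ^ (-(9 / 8) : ℝ))) *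
        ENNReal.ofReal ((1 + |2 * Real.pi * ξ + p + q|) ^ (-(5 / 8) : ℝ)) := by
  have key : ∀ η : ℝ, ENNReal.ofReal ((1 + |2 * Real.pi * η + p|) ^ (-(7 / 8) : ℝ)) *
      ENNReal.ofReal ((1 + |2 * Real.pi * (-η + ξ) + q|) ^ (-(7 / 8) : ℝ)) ≤
      (2 * ENNReal.ofReal ((1 + |2 * Real.pi * η + p|) ^ (-(9 / 8) : ℝ)) +
        2 * ENNReal.ofReal ((1 + |2 * Real.pi * (-η + ξ) + q|) ^ (-(9 / 8) : ℝ))) *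
        ENNReal.ofReal ((1 + |2 * Real.pi * ξ + p + q|) ^ (-(5 / 8) : ℝ)) := by
    intro η
    have := rpow_mul_rpow_le_add (X := 1 + |2 * Real.pi * η + p|)
      (Y := 1 + |2 * Real.pi * (-η + ξ) + q|) (Z := 1 + |2 * Real.pi * ξ + p + q|)
      (by simp) (by simp) (by simp) (by
        have h1 : 2 * Real.pi * ξ + p + q =
          (2 * Real.pi * η + p) + (2 * Real.pi * (-η + ξ) + q) := by ring
        have := abs_add_le (2 * Real.pi * η + p) (2 * Real.pi * (-η + ξ) + q)
        rw [h1]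
        linarith)
    rw [← ENNReal.ofReal_mul (by positivity), ← ENNReal.ofReal_ofNat,
      ← ENNReal.ofReal_mul (by positivity), ← ENNReal.ofReal_mul (by positivity),
      ← ENNReal.ofReal_add (by positivity) (by positivity), ← ENNReal.ofReal_mul (by positivity)]
    exact ENNReal.ofReal_le_ofReal this
  refine (lintegral_mono key).trans (le_of_eq ?_)
  have m1 : Measurable fun η : ℝ =>
      ENNReal.ofReal ((1 + |2 * Real.pi * η + p|) ^ (-(9 / 8) : ℝ)) := by fun_prop
  have m2 : Measurable fun η : ℝ =>
      ENNReal.ofReal ((1 + |2 * Real.pi * (-η + ξ) + q|) ^ (-(9 / 8) : ℝ)) := by fun_prop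
  rw [lintegral_mul_const _ (by fun_prop), lintegral_add_left (by fun_prop),
    lintegral_const_mul _ m1, lintegral_const_mul _ m2, lintegral_one_add_abs_add,
    lintegral_one_add_abs_sub]
  ring

theorem summable_one_add_sq : Summable fun j : ℤ => (1 + (j : ℝ) ^ 2 / 2) ^ (-(5 / 8) : ℝ) := by
  have h : Summable fun j : ℤ => 2 * |(j : ℝ)| ^ (-(5 / 4) : ℝ) := by
    refine Summable.mul_left _ ?_
    exact Real.summable_abs_int_rpow (b := 5 / 4) (by norm_num)
  refine Summable.of_norm_bounded_eventually h ?_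
  have : ∀ᶠ j : ℤ in cofinite, j ≠ 0 := eventually_cofinite_ne 0
  filter_upwards [this] with j hj
  have hj0 : 0 < |(j : ℝ)| := by simpa using hj
  rw [Real.norm_of_nonneg (by positivity)]
  calc (1 + (j : ℝ) ^ 2 / 2) ^ (-(5 / 8) : ℝ) ≤ (|(j : ℝ)| ^ 2 / 2) ^ (-(5 / 8) : ℝ) := by
        refine Real.rpow_le_rpow_of_nonpos (by positivity) ?_ (by norm_num)
        rw [sq_abs]; linarith
    _ = 2 ^ (5 / 8 : ℝ) * |(j : ℝ)| ^ (-(5 / 4) : ℝ) := by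
        rw [div_eq_mul_inv, Real.mul_rpow (by positivity) (by positivity), Real.inv_rpow (by simp),
          Real.rpow_neg (by norm_num : (0 : ℝ) ≤ 2), inv_inv, ← Real.rpow_natCast,
          ← Real.rpow_mul (by positivity), mul_comm]
        norm_num
    _ ≤ 2 ^ (1 : ℝ) * |(j : ℝ)| ^ (-(5 / 4) : ℝ) := by gcongr <;> norm_num
    _ = _ := by simp

/-- After shifting the index by the integer k nearest to y / 2, the offset |2k - y| is at most 1, so
|2(j + k) - y| ≥ |j| for every integer j. The point is uniformity in y. -/
theorem tsum_one_add_sq_shift_le (y : ℝ) :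
    ∑' j : ℤ, ENNReal.ofReal ((1 + (2 * j - y) ^ 2 / 2) ^ (-(5 / 8) : ℝ)) ≤
      ∑' j : ℤ, ENNReal.ofReal ((1 + (j : ℝ) ^ 2 / 2) ^ (-(5 / 8) : ℝ)) := by
  set k := round (y / 2) with hk
  rw [← (Equiv.addRight k).tsum_eq]
  refine ENNReal.tsum_le_tsum fun j => ENNReal.ofReal_le_ofReal ?_
  refine Real.rpow_le_rpow_of_nonpos (by positivity) ?_ (by norm_num)
  have hr := abs_le.1 (abs_sub_round (y / 2))
  rw [← hk] at hr
  have hz : ((j : ℝ)) ^ 2 ≤ (2 * ((j + k : ℤ) : ℝ) - y) ^ 2 := by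
    rw [sq_le_sq]
    push_cast
    rcases lt_trichotomy j 0 with h | h | h
    · have : (j : ℝ) ≤ -1 := by exact_mod_cast Int.le_sub_one_of_lt h
      rw [abs_of_nonpos (by linarith), abs_of_nonpos (by linarith)]
      linarith
    · simp [h]
    · have : (1 : ℝ) ≤ j := by exact_mod_cast h
      rw [abs_of_nonneg (by linarith), abs_of_nonneg (by linarith)]
      linarith
  simp only [Equiv.coe_addRight]
  linarith

/-- When a < 0 the quadratic in m = 2j - n factors as (m - B)(m + B) / 2, and its modulus dominates
half the square of the distance from m to the nearer root. One shifted sum per root then suffices,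
uniformly in a and n. -/
theorem tsum_one_add_abs_quadratic_le (a : ℝ) (n : ℤ) :
    ∑' j : ℤ, ENNReal.ofReal ((1 + |a + (2 * j - n) ^ 2 / 2|) ^ (-(5 / 8) : ℝ)) ≤
      2 * ∑' j : ℤ, ENNReal.ofReal ((1 + (j : ℝ) ^ 2 / 2) ^ (-(5 / 8) : ℝ)) := by
  set B := Real.sqrt (-2 * a) with hB
  have hB0 : 0 ≤ B := Real.sqrt_nonneg _
  have key : ∀ j : ℤ, ENNReal.ofReal ((1 + |a + (2 * j - n) ^ 2 / 2|) ^ (-(5 / 8) : ℝ)) ≤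
      ENNReal.ofReal ((1 + (2 * j - (n + B)) ^ 2 / 2) ^ (-(5 / 8) : ℝ)) +
      ENNReal.ofReal ((1 + (2 * j - (n - B)) ^ 2 / 2) ^ (-(5 / 8) : ℝ)) := by
    intro j
    set m : ℝ := 2 * j - n with hm
    have e1 : (2 * j - (n + B) : ℝ) = m - B := by rw [hm]; ring
    have e2 : (2 * j - (n - B) : ℝ) = m + B := by rw [hm]; ring
    rw [e1, e2]
    have h1 : (m - B) ^ 2 / 2 ≤ |a + m ^ 2 / 2| ∨ (m + B) ^ 2 / 2 ≤ |a + m ^ 2 / 2| := by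
      rcases le_total 0 a with ha | ha
      -- `Real.sqrt` is zero at nonpositive arguments, so for a ≥ 0 both centres collapse to n.
      · have : B = 0 := Real.sqrt_eq_zero_of_nonpos (by linarith)
        left
        rw [this, sub_zero]
        exact le_trans (by linarith) (le_abs_self _)
      · have hBa : B ^ 2 = -2 * a := Real.sq_sqrt (by linarith)
        have ha' : a + m ^ 2 / 2 = (m - B) * (m + B) / 2 := by nlinarith
        rw [ha', abs_div, abs_mul, abs_two]
        rcases le_total 0 m with h0 | h0
        · left
          rw [← sq_abs, sq]
          have : |m - B| ≤ |m + B| := by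
            rw [abs_of_nonneg (by linarith : 0 ≤ m + B)]
            exact abs_le.2 ⟨by linarith, by linarith⟩
          nlinarith [abs_nonneg (m - B), abs_nonneg (m + B)]
        · right
          rw [← sq_abs, sq]
          have : |m + B| ≤ |m - B| := by
            rw [abs_of_nonpos (by linarith : m - B ≤ 0)]
            exact abs_le.2 ⟨by linarith, by linarith⟩
          nlinarith [abs_nonneg (m - B), abs_nonneg (m + B)]
    rcases h1 with h1 | h1
    · refine le_trans (ENNReal.ofReal_le_ofReal ?_) le_self_add
      exact Real.rpow_le_rpow_of_nonpos (by positivity) (by linarith) (by norm_num)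
    · refine le_trans (ENNReal.ofReal_le_ofReal ?_) le_add_self
      exact Real.rpow_le_rpow_of_nonpos (by positivity) (by linarith) (by norm_num)
  refine (ENNReal.tsum_le_tsum key).trans ?_
  rw [ENNReal.tsum_add, two_mul]
  exact add_le_add (tsum_one_add_sq_shift_le _) (tsum_one_add_sq_shift_le _)

/-- The weight `1 + |τ + n (n + 1)|`, where `τ = 2πξ`. -/
noncomputable def wt (n : ℤ) (ξ : ℝ) : ℝ := 1 + |2 * Real.pi * ξ + n * (n + 1)|

theorem one_le_wt (n : ℤ) (ξ : ℝ) : 1 ≤ wt n ξ := by simp [wt]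

theorem wt_pos (n : ℤ) (ξ : ℝ) : 0 < wt n ξ := zero_lt_one.trans_le (one_le_wt n ξ)

@[fun_prop]
theorem measurable_wt (n : ℤ) : Measurable (wt n) := by unfold wt; fun_prop

/-- A power of the weight, as a function on `ℤ × ℝ`. -/
noncomputable def wtPow (s : ℝ) (z : ℤ × ℝ) : ℝ≥0∞ := ENNReal.ofReal (wt z.1 z.2 ^ s)

@[fun_prop]
theorem measurable_wtPow (s : ℝ) : Measurable (wtPow s) := by
  unfold wtPow wt
  have : Measurable fun z : ℤ × ℝ => (z.1 : ℝ) := by fun_prop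
  fun_prop

theorem wtPow_add (s t : ℝ) (z : ℤ × ℝ) : wtPow s z * wtPow t z = wtPow (s + t) z := by
  rw [wtPow, wtPow, wtPow, ← ENNReal.ofReal_mul (by have := wt_pos z.1 z.2; positivity),
    Real.rpow_add (wt_pos _ _)]

theorem wtPow_zero (z : ℤ × ℝ) : wtPow 0 z = 1 := by simp [wtPow]

theorem wtPow_mono {s t : ℝ} (h : s ≤ t) (z : ℤ × ℝ) : wtPow s z ≤ wtPow t z :=
  ENNReal.ofReal_le_ofReal (Real.rpow_le_rpow_of_exponent_le (one_le_wt _ _) h)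

/-- The Haar measure of `ℤ × ℝ`. -/
noncomputable abbrev haarZR : Measure (ℤ × ℝ) := Measure.count.prod volume

theorem lintegral_haarZR {f : ℤ × ℝ → ℝ≥0∞} (hf : Measurable f) :
    ∫⁻ z, f z ∂haarZR = ∑' n : ℤ, ∫⁻ ξ, f (n, ξ) := by
  rw [lintegral_prod _ hf.aemeasurable, lintegral_count]

/-- The frequency integral leaves the sum of the two phases, and j(j+1) + (n-j)(n-j+1) = (2j-n)²/2 +
n²/2 + n. So the remaining sum over j runs along a nondegenerate quadratic, with bounds independent
of n and ξ. -/
theorem exists_lconvolution_wtPow_le :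
    ∃ K : ℝ≥0∞, K ≠ ∞ ∧
      ∀ z, (wtPow (-(7 / 8)) ⋆ₗ[haarZR] wtPow (-(7 / 8))) z ≤ K := by
  refine ⟨(4 * ∫⁻ x : ℝ, ENNReal.ofReal ((1 + |2 * Real.pi * x|) ^ (-(9 / 8) : ℝ))) *
    (2 * ∑' j : ℤ, ENNReal.ofReal ((1 + (j : ℝ) ^ 2 / 2) ^ (-(5 / 8) : ℝ))), ?_, ?_⟩
  · have := summable_one_add_sq.tsum_ofReal_ne_top
    have h2 := lintegral_one_add_abs_lt_top.ne
    finiteness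
  · rintro ⟨n, ξ⟩
    rw [lconvolution_def, lintegral_haarZR (by fun_prop)]
    refine le_trans (ENNReal.tsum_le_tsum fun j => ?_)
      (le_trans (ENNReal.tsum_mul_left.le)
        (mul_le_mul_right (tsum_one_add_abs_quadratic_le (2 * Real.pi * ξ + n ^ 2 / 2 + n) n) _))
    refine (lintegral_one_add_abs_mul_le ((j : ℝ) * (j + 1))
      (((-j + n : ℤ) : ℝ) * (((-j + n : ℤ) : ℝ) + 1)) ξ).trans (le_of_eq ?_)
    congr 5
    push_cast
    ring

/-! ### The inverse Fourier transform of integrable functions on the line -/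

theorem fourierInv_eq_integral (f : ℝ → ℂ) (t : ℝ) :
    𝓕⁻ f t = ∫ ξ : ℝ, Complex.exp (2 * Real.pi * Complex.I * ξ * t) * f ξ := by
  rw [Real.fourierInv_eq']
  refine integral_congr_ae (Eventually.of_forall fun ξ => ?_)
  simp only [RCLike.inner_apply, conj_trivial, smul_eq_mul]
  congr 2
  push_cast
  ring

theorem norm_exp_two_pi_I_mul (ξ t : ℝ) :
    ‖Complex.exp (2 * Real.pi * Complex.I * ξ * t)‖ = 1 := by
  have : 2 * (Real.pi : ℂ) * Complex.I * ξ * t = ((2 * Real.pi * ξ * t : ℝ) : ℂ) * Complex.I := by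
    push_cast; ring
  rw [this, Complex.norm_exp_ofReal_mul_I]

theorem integrable_exp_mul {f : ℝ → ℂ} (hf : Integrable f) (t : ℝ) :
    Integrable fun ξ : ℝ => Complex.exp (2 * Real.pi * Complex.I * ξ * t) * f ξ := by
  refine hf.bdd_mul (c := 1) (by fun_prop) (Eventually.of_forall fun ξ => ?_)
  rw [norm_exp_two_pi_I_mul]

theorem fourierInv_add_apply {f g : ℝ → ℂ} (hf : Integrable f) (hg : Integrable g) (t : ℝ) :
    𝓕⁻ (f + g) t = 𝓕⁻ f t + 𝓕⁻ g t := by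
  simp only [fourierInv_eq_integral, Pi.add_apply, mul_add]
  exact integral_add (integrable_exp_mul hf t) (integrable_exp_mul hg t)

theorem fourierInv_sub_apply {f g : ℝ → ℂ} (hf : Integrable f) (hg : Integrable g) (t : ℝ) :
    𝓕⁻ (f - g) t = 𝓕⁻ f t - 𝓕⁻ g t := by
  simp only [fourierInv_eq_integral, Pi.sub_apply, mul_sub]
  exact integral_sub (integrable_exp_mul hf t) (integrable_exp_mul hg t)

theorem fourierInv_const_mul_apply (c : ℂ) (f : ℝ → ℂ) (t : ℝ) :
    𝓕⁻ (fun ξ => c * f ξ) t = c * 𝓕⁻ f t := by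
  simp only [fourierInv_eq_integral, mul_left_comm _ c]
  exact integral_const_mul c _

theorem fourierInv_finset_sum_apply {ι : Type*} (s : Finset ι) {f : ι → ℝ → ℂ}
    (hf : ∀ i ∈ s, Integrable (f i)) (t : ℝ) :
    𝓕⁻ (fun ξ => ∑ i ∈ s, f i ξ) t = ∑ i ∈ s, 𝓕⁻ (f i) t := by
  simp only [fourierInv_eq_integral, Finset.mul_sum]
  exact integral_finsetSum s fun i hi => integrable_exp_mul (hf i hi) t

theorem norm_fourierInv_le (f : ℝ → ℂ) (t : ℝ) : ‖𝓕⁻ f t‖ₑ ≤ ∫⁻ ξ, ‖f ξ‖ₑ := by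
  rw [fourierInv_eq_integral]
  refine (enorm_integral_le_lintegral_enorm _).trans (le_of_eq (lintegral_congr fun ξ => ?_))
  rw [enorm_mul, ← ofReal_norm, norm_exp_two_pi_I_mul]
  simp

theorem continuous_fourierInv {f : ℝ → ℂ} (hf : Integrable f) : Continuous (𝓕⁻ f) := by
  have : 𝓕⁻ f = fun t : ℝ => ∫ ξ : ℝ, Complex.exp (2 * Real.pi * Complex.I * ξ * t) * f ξ :=
    funext (fourierInv_eq_integral f)
  rw [this]
  refine continuous_of_dominated (bound := fun ξ => ‖f ξ‖)
    (fun t => (integrable_exp_mul hf t).aestronglyMeasurable) (fun t => ?_) hf.norm ?_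
  · refine Eventually.of_forall fun ξ => ?_
    rw [norm_mul, norm_exp_two_pi_I_mul, one_mul]
  · exact Eventually.of_forall fun ξ => by fun_prop

theorem hasDerivAt_fourierInv {f : ℝ → ℂ} (hf : Integrable f)
    (hf' : Integrable fun ξ : ℝ => 2 * Real.pi * Complex.I * ξ * f ξ) (t : ℝ) :
    HasDerivAt (𝓕⁻ f) (𝓕⁻ (fun ξ : ℝ => 2 * Real.pi * Complex.I * ξ * f ξ) t) t := by
  have e : 𝓕⁻ f = fun t : ℝ => ∫ ξ : ℝ, Complex.exp (2 * Real.pi * Complex.I * ξ * t) * f ξ :=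
    funext (fourierInv_eq_integral f)
  rw [e, fourierInv_eq_integral]
  refine (hasDerivAt_integral_of_dominated_loc_of_deriv_le
    (F := fun (t : ℝ) ξ => Complex.exp (2 * Real.pi * Complex.I * ξ * t) * f ξ)
    (F' := fun (t : ℝ) ξ => Complex.exp (2 * Real.pi * Complex.I * ξ * t) *
      (2 * Real.pi * Complex.I * ξ * f ξ))
    (bound := fun ξ => ‖2 * Real.pi * Complex.I * ξ * f ξ‖) univ_mem
    (Eventually.of_forall fun s => (integrable_exp_mul hf s).aestronglyMeasurable)
    (integrable_exp_mul hf t) (integrable_exp_mul hf' t).aestronglyMeasurable ?_ hf'.norm ?_).2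
  · refine Eventually.of_forall fun ξ s _ => ?_
    rw [norm_mul, norm_exp_two_pi_I_mul, one_mul]
  · refine Eventually.of_forall fun ξ s _ => ?_
    have h1 : HasDerivAt (fun s : ℝ => 2 * Real.pi * Complex.I * ξ * (s : ℂ))
        (2 * Real.pi * Complex.I * ξ) s := by
      simpa using (Complex.ofRealCLM.hasDerivAt (x := s)).const_mul (2 * Real.pi * Complex.I * ξ)
    refine (h1.cexp.mul_const (f ξ)).congr_deriv ?_
    ring

theorem fourierInv_convolution {f g : ℝ → ℂ} (hf : Integrable f) (hg : Integrable g) (t : ℝ) :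
    𝓕⁻ (convolution f g (ContinuousLinearMap.mul ℂ ℂ) volume) t = 𝓕⁻ f t * 𝓕⁻ g t := by
  simp only [Real.fourierInv_eq_fourier_neg]
  exact Real.fourier_mul_convolution_eq hf hg _

/-! ### Families of functions of the time frequency, indexed by the degree -/

/-- The square of the norm with weight `wt ^ s`. -/
noncomputable def xn (s : ℝ) (g : ℕ → ℝ → ℂ) : ℝ≥0∞ :=
  ∑' n : ℕ, ∫⁻ ξ, ENNReal.ofReal (wt n ξ ^ s) * ‖g n ξ‖ₑ ^ 2

/-- The modulus of a family, extended by zero to `ℤ × ℝ`. -/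
noncomputable def absLift (g : ℕ → ℝ → ℂ) (z : ℤ × ℝ) : ℝ≥0∞ :=
  if 0 ≤ z.1 then ‖g z.1.toNat z.2‖ₑ else 0

theorem measurable_absLift {g : ℕ → ℝ → ℂ} (hg : ∀ n, Measurable (g n)) :
    Measurable (absLift g) := by
  refine measurable_from_prod_countable_right fun n => ?_
  by_cases hn : 0 ≤ n
  · simpa [absLift, hn] using (hg _).enorm
  · simp [absLift, hn]

theorem xn_eq_lintegral {g : ℕ → ℝ → ℂ} (hg : ∀ n, Measurable (g n)) (s : ℝ) :
    xn s g = ∫⁻ z, wtPow s z * absLift g z ^ 2 ∂haarZR := by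
  have := measurable_absLift hg
  rw [lintegral_haarZR (by fun_prop), xn]
  rw [← Function.Injective.tsum_eq (g := fun n : ℕ => (n : ℤ)) Nat.cast_injective]
  · simp [wtPow, absLift]
  · intro n hn
    by_contra hc
    refine hn ?_
    have : ¬ 0 ≤ n := fun h => hc ⟨n.toNat, by simpa using h⟩
    simp [absLift, this]

theorem xn_mono {s t : ℝ} (h : s ≤ t) (g : ℕ → ℝ → ℂ) : xn s g ≤ xn t g := by
  refine ENNReal.tsum_le_tsum fun n => lintegral_mono fun ξ => ?_
  gcongr
  exact one_le_wt _ _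

theorem xn_congr {g h : ℕ → ℝ → ℂ} (e : ∀ n, g n =ᵐ[volume] h n) (s : ℝ) : xn s g = xn s h := by
  refine tsum_congr fun n => lintegral_congr_ae ?_
  filter_upwards [e n] with ξ hξ
  rw [hξ]

theorem enorm_add_sq_le (a b : ℂ) : ‖a + b‖ₑ ^ 2 ≤ 2 * ‖a‖ₑ ^ 2 + 2 * ‖b‖ₑ ^ 2 := by
  have h : ‖a + b‖ ^ 2 ≤ 2 * ‖a‖ ^ 2 + 2 * ‖b‖ ^ 2 := by
    have := norm_add_le a b
    have h0 := norm_nonneg (a + b)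
    nlinarith [sq_nonneg (‖a‖ - ‖b‖)]
  simp only [← ofReal_norm]
  rw [← ENNReal.ofReal_pow (norm_nonneg _), ← ENNReal.ofReal_pow (norm_nonneg _),
    ← ENNReal.ofReal_pow (norm_nonneg _), ← ENNReal.ofReal_ofNat,
    ← ENNReal.ofReal_mul (by norm_num), ← ENNReal.ofReal_mul (by norm_num),
    ← ENNReal.ofReal_add (by positivity) (by positivity)]
  exact ENNReal.ofReal_le_ofReal h

theorem xn_add_le (s : ℝ) {g h : ℕ → ℝ → ℂ} (hg : ∀ n, Measurable (g n)) :
    xn s (g + h) ≤ 2 * xn s g + 2 * xn s h := by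
  rw [xn, xn, xn, ← ENNReal.tsum_mul_left, ← ENNReal.tsum_mul_left, ← ENNReal.tsum_add]
  refine ENNReal.tsum_le_tsum fun n => ?_
  have := hg n
  rw [← lintegral_const_mul' _ _ (by simp), ← lintegral_const_mul' _ _ (by simp),
    ← lintegral_add_left (by fun_prop)]
  refine lintegral_mono fun ξ => ?_
  refine (mul_le_mul_right (enorm_add_sq_le (g n ξ) (h n ξ)) _).trans (le_of_eq ?_)
  ring

theorem xn_const_mul (s : ℝ) (c : ℂ) (g : ℕ → ℝ → ℂ) :
    xn s (fun n ξ => c * g n ξ) = ‖c‖ₑ ^ 2 * xn s g := by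
  rw [xn, xn, ← ENNReal.tsum_mul_left]
  refine tsum_congr fun n => ?_
  rw [← lintegral_const_mul' _ _ (by simp)]
  refine lintegral_congr fun ξ => ?_
  rw [enorm_mul]
  ring

/-- The constant `∫ (1 + |2πξ|)^(-9/8) dξ` of the embedding of the solution space in `L¹`. -/
noncomputable def l1Const : ℝ≥0∞ :=
  ∫⁻ x : ℝ, ENNReal.ofReal ((1 + |2 * Real.pi * x|) ^ (-(9 / 8) : ℝ))

theorem l1Const_ne_top : l1Const ≠ ∞ := lintegral_one_add_abs_lt_top.ne

/-- Cauchy–Schwarz against the weight to the power -9/8, whose integral is finite and, by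
translation, independent of n. This is where b > 1/2 enters: the coefficients are continuous in time
and bounded in ℓ² by the norm. -/
theorem lintegral_enorm_sq_le {f : ℝ → ℂ} (hf : Measurable f) (n : ℤ) :
    (∫⁻ ξ, ‖f ξ‖ₑ) ^ 2 ≤
      l1Const * ∫⁻ ξ, ENNReal.ofReal (wt n ξ ^ (9 / 8 : ℝ)) * ‖f ξ‖ₑ ^ 2 := by
  rw [l1Const, ← lintegral_one_add_abs_add ((n : ℝ) * (n + 1))]
  refine sq_lintegral_le (by fun_prop) (by fun_prop) fun ξ => le_of_eq ?_
  rw [← mul_assoc, ← ENNReal.ofReal_mul (by positivity)]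
  have h := wt_pos n ξ
  have : (1 + |2 * Real.pi * ξ + (n : ℝ) * (n + 1)|) ^ (-(9 / 8) : ℝ) * wt n ξ ^ (9 / 8 : ℝ)
      = 1 := by
    rw [wt] at h ⊢
    rw [← Real.rpow_add h]; norm_num
  rw [this]
  simp

theorem lintegral_le_xn (s : ℝ) (g : ℕ → ℝ → ℂ) (n : ℕ) :
    ∫⁻ ξ, ENNReal.ofReal (wt n ξ ^ s) * ‖g n ξ‖ₑ ^ 2 ≤ xn s g :=
  ENNReal.le_tsum n

theorem tsum_lintegral_enorm_sq_le {g : ℕ → ℝ → ℂ} (hg : ∀ n, Measurable (g n)) :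
    ∑' n, (∫⁻ ξ, ‖g n ξ‖ₑ) ^ 2 ≤ l1Const * xn (9 / 8) g := by
  rw [xn, ← ENNReal.tsum_mul_left]
  exact ENNReal.tsum_le_tsum fun n => lintegral_enorm_sq_le (hg n) n

theorem integrable_of_xn {g : ℕ → ℝ → ℂ} (hg : ∀ n, Measurable (g n))
    (h : xn (9 / 8) g ≠ ∞) (n : ℕ) : Integrable (g n) := by
  refine ⟨(hg n).aestronglyMeasurable, ?_⟩
  have h1 := lintegral_enorm_sq_le (hg n) n
  have h2 : (∫⁻ ξ, ‖g n ξ‖ₑ) ^ 2 ≠ ∞ :=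
    ne_top_of_le_ne_top (ENNReal.mul_ne_top l1Const_ne_top
      (ne_top_of_le_ne_top h (lintegral_le_xn _ g n))) h1
  rw [hasFiniteIntegral_iff_enorm, lt_top_iff_ne_top]
  intro hc
  rw [hc] at h2
  simp at h2

/-- The product of two families: convolution in the degree and in the frequency. -/
noncomputable def bconv (g h : ℕ → ℝ → ℂ) (n : ℕ) (ξ : ℝ) : ℂ :=
  ∑ p ∈ antidiag n,
    convolution (g p.1) (h p.2) (ContinuousLinearMap.mul ℂ ℂ) volume ξ

/-- The product of three families. -/
noncomputable def tri (g₁ g₂ g₃ : ℕ → ℝ → ℂ) : ℕ → ℝ → ℂ := bconv (bconv g₁ g₂) g₃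

theorem measurable_convolution_mul {f g : ℝ → ℂ} (hf : Measurable f) (hg : Measurable g) :
    Measurable (convolution f g (ContinuousLinearMap.mul ℂ ℂ) volume) := by
  have : StronglyMeasurable fun p : ℝ × ℝ => f p.2 * g (p.1 - p.2) := by
    have : Measurable fun p : ℝ × ℝ => f p.2 * g (p.1 - p.2) := by fun_prop
    exact this.stronglyMeasurable
  exact (this.integral_prod_right (ν := volume)).measurable

theorem measurable_bconv {g h : ℕ → ℝ → ℂ} (hg : ∀ n, Measurable (g n))
    (hh : ∀ n, Measurable (h n)) (n : ℕ) : Measurable (bconv g h n) :=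
  Finset.measurable_fun_sum _ fun p _ => measurable_convolution_mul (hg p.1) (hh p.2)

theorem integrable_bconv {g h : ℕ → ℝ → ℂ} (hg : ∀ n, Integrable (g n))
    (hh : ∀ n, Integrable (h n)) (n : ℕ) : Integrable (bconv g h n) :=
  integrable_finsetSum _ fun p _ => (hg p.1).integrable_convolution _ (hh p.2)

theorem fourierInv_bconv {g h : ℕ → ℝ → ℂ} (hg : ∀ n, Integrable (g n))
    (hh : ∀ n, Integrable (h n)) (n : ℕ) (t : ℝ) :
    𝓕⁻ (bconv g h n) t = ∑ p ∈ antidiag n, 𝓕⁻ (g p.1) t * 𝓕⁻ (h p.2) t := by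
  have := fourierInv_finset_sum_apply (antidiag n)
    (f := fun p => convolution (g p.1) (h p.2) (ContinuousLinearMap.mul ℂ ℂ) volume)
    (fun p _ => (hg p.1).integrable_convolution _ (hh p.2)) t
  refine this.trans (Finset.sum_congr rfl fun p _ => fourierInv_convolution (hg p.1) (hh p.2) t)

theorem bconv_congr {g g' h h' : ℕ → ℝ → ℂ} (hg : ∀ n, g n =ᵐ[volume] g' n)
    (hh : ∀ n, h n =ᵐ[volume] h' n) : bconv g h = bconv g' h' := by
  funext n ξ
  refine Finset.sum_congr rfl fun p _ => ?_
  rw [convolution_congr _ (hg p.1) (hh p.2)]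

/-- Additivity holds only almost everywhere, because the convolution of integrable functions need
not converge at every frequency. -/
theorem bconv_add_left {g g' h : ℕ → ℝ → ℂ} (hg : ∀ n, Integrable (g n))
    (hg' : ∀ n, Integrable (g' n)) (hh : ∀ n, Integrable (h n)) (n : ℕ) :
    bconv (g + g') h n =ᵐ[volume] bconv g h n + bconv g' h n := by
  have h1 : ∀ᵐ ξ, ∀ p ∈ antidiag n,
      ConvolutionExistsAt (g p.1) (h p.2) ξ (ContinuousLinearMap.mul ℂ ℂ) volume ∧
      ConvolutionExistsAt (g' p.1) (h p.2) ξ (ContinuousLinearMap.mul ℂ ℂ) volume := by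
    rw [Finset.eventually_all]
    exact fun p _ => ((hg p.1).ae_convolution_exists _ (hh p.2)).and
      ((hg' p.1).ae_convolution_exists _ (hh p.2))
  filter_upwards [h1] with ξ hξ
  simp only [bconv, Pi.add_apply]
  rw [← Finset.sum_add_distrib]
  exact Finset.sum_congr rfl fun p hp => (hξ p hp).1.add_distrib (hξ p hp).2

theorem bconv_add_right {g h h' : ℕ → ℝ → ℂ} (hg : ∀ n, Integrable (g n))
    (hh : ∀ n, Integrable (h n)) (hh' : ∀ n, Integrable (h' n)) (n : ℕ) :
    bconv g (h + h') n =ᵐ[volume] bconv g h n + bconv g h' n := by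
  have h1 : ∀ᵐ ξ, ∀ p ∈ antidiag n,
      ConvolutionExistsAt (g p.1) (h p.2) ξ (ContinuousLinearMap.mul ℂ ℂ) volume ∧
      ConvolutionExistsAt (g p.1) (h' p.2) ξ (ContinuousLinearMap.mul ℂ ℂ) volume := by
    rw [Finset.eventually_all]
    exact fun p _ => ((hg p.1).ae_convolution_exists _ (hh p.2)).and
      ((hg p.1).ae_convolution_exists _ (hh' p.2))
  filter_upwards [h1] with ξ hξ
  simp only [bconv, Pi.add_apply]
  rw [← Finset.sum_add_distrib]
  exact Finset.sum_congr rfl fun p hp => (hξ p hp).1.distrib_add (hξ p hp).2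

theorem tri_sub_tri {g h : ℕ → ℝ → ℂ} (hg : ∀ n, Integrable (g n))
    (hh : ∀ n, Integrable (h n)) (n : ℕ) :
    tri g g g n - tri h h h n =ᵐ[volume]
      tri (g - h) g g n + tri h (g - h) g n + tri h h (g - h) n := by
  have hd : ∀ n, Integrable ((g - h) n) := fun n => (hg n).sub (hh n)
  have e : g - h + h = g := sub_add_cancel g h
  have e' : h + (g - h) = g := add_sub_cancel h g
  have h1 : ∀ n, bconv g g n =ᵐ[volume]
      (bconv (g - h) g + bconv h (g - h) + bconv h h) n := by
    intro n
    have a1 := bconv_add_left hd hh hg n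
    have a2 := bconv_add_right hh hh hd n
    rw [e] at a1
    rw [e'] at a2
    filter_upwards [a1, a2] with ξ b1 b2
    rw [b1]
    simp only [Pi.add_apply, b2]
    ring
  have i1 := integrable_bconv hd hg
  have i2 := integrable_bconv hh hd
  have i3 := integrable_bconv hh hh
  have c1 : tri g g g n = bconv (bconv (g - h) g + bconv h (g - h) + bconv h h) g n :=
    congrFun (bconv_congr h1 fun n => Filter.EventuallyEq.rfl) n
  have c2 := bconv_add_left (g := bconv (g - h) g + bconv h (g - h)) (g' := bconv h h)
    (fun n => (i1 n).add (i2 n)) i3 hg n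
  have c3 := bconv_add_left i1 i2 hg n
  have c4 := bconv_add_right i3 hh hd n
  rw [e'] at c4
  filter_upwards [c2, c3, c4] with ξ d2 d3 d4
  simp only [Pi.sub_apply, Pi.add_apply] at *
  rw [c1, d2, d3, d4]
  simp only [tri]
  ring

theorem enorm_bconv_le (g h : ℕ → ℝ → ℂ) (n : ℕ) (ξ : ℝ) :
    ‖bconv g h n ξ‖ₑ ≤
      ∑ p ∈ antidiag n, ∫⁻ η, ‖g p.1 η‖ₑ * ‖h p.2 (-η + ξ)‖ₑ := by
  refine (enorm_sum_le _ _).trans (Finset.sum_le_sum fun p _ => ?_)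
  refine (enorm_integral_le_lintegral_enorm _).trans (le_of_eq (lintegral_congr fun η => ?_))
  simp [neg_add_eq_sub]

/-- Extension by zero to negative degrees replaces the sum over the antidiagonal by a convolution on
the group ℤ × ℝ, to which the weighted inequalities apply. -/
theorem absLift_bconv_le {g h : ℕ → ℝ → ℂ} (hg : ∀ n, Measurable (g n))
    (hh : ∀ n, Measurable (h n)) (z : ℤ × ℝ) :
    absLift (bconv g h) z ≤ (absLift g ⋆ₗ[haarZR] absLift h) z := by
  obtain ⟨n, ξ⟩ := z
  by_cases hn : 0 ≤ n
  swap
  · simp [absLift, hn]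
  obtain ⟨n, rfl⟩ := Int.eq_ofNat_of_zero_le hn
  have m1 := measurable_absLift hg
  have m2 := measurable_absLift hh
  rw [lconvolution_def, lintegral_haarZR (by fun_prop)]
  have e : absLift (bconv g h) ((n : ℤ), ξ) = ‖bconv g h n ξ‖ₑ := by simp [absLift]
  refine e.le.trans ((enorm_bconv_le g h n ξ).trans ?_)
  have inj : Set.InjOn (fun p : ℕ × ℕ => (p.1 : ℤ)) (antidiag n : Set (ℕ × ℕ)) := by
    intro p hp q hq hpq
    simp only [Finset.mem_coe, mem_antidiag] at hp hq hpq
    ext <;> omega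
  refine le_trans (le_of_eq ?_) (ENNReal.sum_le_tsum
    ((antidiag n).image fun p : ℕ × ℕ => (p.1 : ℤ)))
  rw [Finset.sum_image inj]
  refine Finset.sum_congr rfl fun p hp => lintegral_congr fun η => ?_
  have hp' : -(p.1 : ℤ) + n = p.2 := by
    have := mem_antidiag.1 hp
    omega
  simp [absLift, hp']

/-- A constant for the convolution of the weight `wt ^ (-7/8)` with itself. -/
noncomputable def convConst : ℝ≥0∞ := exists_lconvolution_wtPow_le.choose

theorem convConst_ne_top : convConst ≠ ∞ := exists_lconvolution_wtPow_le.choose_spec.1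

theorem lconvolution_wtPow_le (z : ℤ × ℝ) :
    (wtPow (-(7 / 8)) ⋆ₗ[haarZR] wtPow (-(7 / 8))) z ≤ convConst :=
  exists_lconvolution_wtPow_le.choose_spec.2 z

theorem wtPow_mul_wtPow_neg (z : ℤ × ℝ) : wtPow (-(7 / 8)) z * wtPow (7 / 8) z = 1 := by
  rw [wtPow_add, ← wtPow_zero z]
  norm_num

/-- The L⁴ Strichartz estimate: two factors with b = 7/16 have their product in space-time L². -/
theorem xn_bconv_le {g h : ℕ → ℝ → ℂ} (hg : ∀ n, Measurable (g n))
    (hh : ∀ n, Measurable (h n)) :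
    xn 0 (bconv g h) ≤ convConst * (xn (7 / 8) g * xn (7 / 8) h) := by
  rw [xn_eq_lintegral (measurable_bconv hg hh), xn_eq_lintegral hg, xn_eq_lintegral hh]
  refine le_trans (lintegral_mono fun z => ?_)
    (lintegral_lconvolution_sq_le (by fun_prop) (by fun_prop) wtPow_mul_wtPow_neg
      (measurable_absLift hg) (measurable_absLift hh) lconvolution_wtPow_le)
  rw [wtPow_zero, one_mul]
  gcongr
  exact absLift_bconv_le hg hh z

/-- Only the exponent 7/8 is asked of each factor, while solutions have 9/8. This gap is what the
time localization turns into a small constant. -/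
theorem xn_tri_le {g₁ g₂ g₃ : ℕ → ℝ → ℂ} (h₁ : ∀ n, Measurable (g₁ n))
    (h₂ : ∀ n, Measurable (g₂ n)) (h₃ : ∀ n, Measurable (g₃ n)) :
    xn (-(7 / 8)) (tri g₁ g₂ g₃) ≤
      convConst ^ 2 * (xn (7 / 8) g₁ * xn (7 / 8) g₂ * xn (7 / 8) g₃) := by
  have m12 := measurable_bconv h₁ h₂
  rw [tri, xn_eq_lintegral (measurable_bconv m12 h₃), xn_eq_lintegral h₁, xn_eq_lintegral h₂,
    xn_eq_lintegral h₃]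
  refine le_trans (lintegral_mono fun z => ?_)
    (lintegral_lconvolution_three_le (by fun_prop) (by fun_prop) wtPow_mul_wtPow_neg
      (fun z => ?_) (measurable_absLift h₁) (measurable_absLift h₂) (measurable_absLift h₃)
      lconvolution_wtPow_le)
  · gcongr
    refine (absLift_bconv_le m12 h₃ z).trans ?_
    refine lintegral_mono fun y => ?_
    gcongr
    exact absLift_bconv_le h₁ h₂ y
  · rw [← wtPow_zero z]
    exact wtPow_mono (by norm_num) z

/-! ### Localization in time -/

theorem exists_schwartz_fourierInv_eq {f : ℝ → ℂ} (hf : ContDiff ℝ (⊤ : ℕ∞) f) :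
    ∃ θ : SchwartzMap ℝ ℂ, ∀ t ∈ Icc (-2 : ℝ) 2, 𝓕⁻ (θ : ℝ → ℂ) t = f t := by
  let φ : ContDiffBump (0 : ℝ) := ⟨2, 3, by norm_num, by norm_num⟩
  have hc : HasCompactSupport fun t => (φ t : ℂ) * f t :=
    (φ.hasCompactSupport.comp_left (g := fun x : ℝ => (x : ℂ)) (by simp)).mul_right
  have hs : ContDiff ℝ (⊤ : ℕ∞) fun t => (φ t : ℂ) * f t :=
    (Complex.ofRealCLM.contDiff.comp φ.contDiff).mul hf
  refine ⟨𝓕 (hc.toSchwartzMap hs), fun t ht => ?_⟩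
  have h1 := congrFun (SchwartzMap.fourierInv_coe (𝓕 (hc.toSchwartzMap hs))) t
  rw [FourierPair.fourierInv_fourier_eq] at h1
  rw [← h1]
  have : φ t = 1 := φ.one_of_mem_closedBall (by
    rw [mem_closedBall_zero_iff, Real.norm_eq_abs]
    exact abs_le.2 ht)
  simp [this]

/-- A Schwartz function whose inverse Fourier transform is `1` on `[-2, 2]`. -/
noncomputable def bumpHat : SchwartzMap ℝ ℂ :=
  (exists_schwartz_fourierInv_eq (f := fun _ => 1) contDiff_const).choose

theorem fourierInv_bumpHat {t : ℝ} (ht : t ∈ Icc (-2 : ℝ) 2) : 𝓕⁻ (bumpHat : ℝ → ℂ) t = 1 :=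
  (exists_schwartz_fourierInv_eq (f := fun _ => 1) contDiff_const).choose_spec t ht

/-- A Schwartz function whose inverse Fourier transform is `exp (-t)` on `[-2, 2]`. -/
noncomputable def expHat : SchwartzMap ℝ ℂ :=
  (exists_schwartz_fourierInv_eq (f := fun t => Complex.exp (-t))
    (Complex.contDiff_exp.comp Complex.ofRealCLM.contDiff.neg)).choose

theorem fourierInv_expHat {t : ℝ} (ht : t ∈ Icc (-2 : ℝ) 2) :
    𝓕⁻ (expHat : ℝ → ℂ) t = Complex.exp (-t) :=
  (exists_schwartz_fourierInv_eq (f := fun t => Complex.exp (-t))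
    (Complex.contDiff_exp.comp Complex.ofRealCLM.contDiff.neg)).choose_spec t ht

/-- The Fourier transform of a cutoff that is `1` at distance at most `l` from `m`. -/
noncomputable def locKernel (m l : ℝ) (ξ : ℝ) : ℂ :=
  l * Complex.exp (2 * Real.pi * Complex.I * ξ * ((-m : ℝ) : ℂ)) * bumpHat (l * ξ)

theorem continuous_locKernel (m l : ℝ) : Continuous (locKernel m l) := by
  have := bumpHat.continuous
  unfold locKernel
  fun_prop

theorem enorm_locKernel (m : ℝ) {l : ℝ} (hl : 0 < l) (ξ : ℝ) :
    ‖locKernel m l ξ‖ₑ = ENNReal.ofReal l * ‖bumpHat (l * ξ)‖ₑ := by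
  rw [locKernel, enorm_mul, enorm_mul, ← ofReal_norm (Complex.exp _), norm_exp_two_pi_I_mul]
  rw [← ofReal_norm (l : ℂ), Complex.norm_real, Real.norm_of_nonneg hl.le]
  simp

theorem lintegral_comp_mul_left_pos (f : ℝ → ℝ≥0∞) {l : ℝ} (hl : 0 < l) :
    ENNReal.ofReal l * ∫⁻ x, f (l * x) = ∫⁻ x, f x := by
  conv_rhs => rw [← Real.smul_map_volume_mul_left hl.ne']
  rw [abs_of_pos hl, lintegral_smul_measure, smul_eq_mul]
  congr 1
  exact (lintegral_map_equiv f (Homeomorph.mulLeft₀ l hl.ne').toMeasurableEquiv).symm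

theorem ENNReal_add_sq_le (a b : ℝ≥0∞) : (a + b) ^ 2 ≤ 2 * a ^ 2 + 2 * b ^ 2 := by
  have := ENNReal.rpow_add_le_mul_rpow_add_rpow a b (p := 2) (by norm_num)
  norm_num at this
  rwa [mul_add] at this

theorem integrable_locKernel (m : ℝ) {l : ℝ} (hl : 0 < l) : Integrable (locKernel m l) := by
  refine ⟨(continuous_locKernel m l).aestronglyMeasurable, ?_⟩
  rw [hasFiniteIntegral_iff_enorm]
  simp_rw [enorm_locKernel m hl]
  rw [lintegral_const_mul' _ _ (by simp), lintegral_comp_mul_left_pos (fun x => ‖bumpHat x‖ₑ) hl]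
  exact bumpHat.integrable.2

theorem fourierInv_locKernel {m l t : ℝ} (hl : 0 < l) (ht : |t - m| ≤ 2 * l) :
    𝓕⁻ (locKernel m l) t = 1 := by
  have hmem : (t - m) / l ∈ Icc (-2 : ℝ) 2 := by
    rw [abs_le] at ht
    constructor
    · rw [le_div_iff₀ hl]; linarith
    · rw [div_le_iff₀ hl]; linarith
  rw [← fourierInv_bumpHat hmem, fourierInv_eq_integral, fourierInv_eq_integral]
  have e := Measure.integral_comp_mul_left (fun ξ : ℝ =>
    Complex.exp (2 * Real.pi * Complex.I * ξ * ((t - m) / l : ℝ)) * bumpHat ξ) l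
  rw [abs_of_pos (by positivity)] at e
  have e2 : (l : ℂ) * ∫ ξ : ℝ, Complex.exp (2 * Real.pi * Complex.I * (l * ξ : ℝ) *
      ((t - m) / l : ℝ)) * bumpHat (l * ξ) =
      ∫ ξ : ℝ, Complex.exp (2 * Real.pi * Complex.I * ξ * ((t - m) / l : ℝ)) * bumpHat ξ := by
    rw [e, Complex.real_smul]
    push_cast
    rw [← mul_assoc, mul_inv_cancel₀ (by exact_mod_cast hl.ne'), one_mul]
  rw [← e2, ← integral_const_mul]
  refine integral_congr_ae (Eventually.of_forall fun ξ => ?_)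
  have hl' : (l : ℂ) ≠ 0 := by exact_mod_cast hl.ne'
  simp only [locKernel]
  rw [show ∀ a b c d : ℂ, a * (b * c * d) = b * (a * c) * d from fun a b c d => by ring,
    ← Complex.exp_add, mul_assoc]
  congr 3
  push_cast
  field_simp
  ring

/-- Localization of a family in time to distance `O(l)` from `m`. -/
noncomputable def loc (m l : ℝ) (g : ℕ → ℝ → ℂ) (n : ℕ) : ℝ → ℂ :=
  convolution (locKernel m l) (g n) (ContinuousLinearMap.mul ℂ ℂ) volume

theorem measurable_loc (m l : ℝ) {g : ℕ → ℝ → ℂ} (hg : ∀ n, Measurable (g n)) (n : ℕ) :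
    Measurable (loc m l g n) :=
  measurable_convolution_mul (continuous_locKernel m l).measurable (hg n)

theorem integrable_loc (m : ℝ) {l : ℝ} (hl : 0 < l) {g : ℕ → ℝ → ℂ}
    (hg : ∀ n, Integrable (g n)) (n : ℕ) : Integrable (loc m l g n) :=
  (integrable_locKernel m hl).integrable_convolution _ (hg n)

theorem fourierInv_loc {m l t : ℝ} (hl : 0 < l) (ht : |t - m| ≤ 2 * l) {g : ℕ → ℝ → ℂ}
    (hg : ∀ n, Integrable (g n)) (n : ℕ) : 𝓕⁻ (loc m l g n) t = 𝓕⁻ (g n) t := by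
  rw [loc, fourierInv_convolution (integrable_locKernel m hl) (hg n), fourierInv_locKernel hl ht,
    one_mul]

theorem loc_sub (m : ℝ) {l : ℝ} (hl : 0 < l) {g h : ℕ → ℝ → ℂ}
    (hg : ∀ n, Integrable (g n)) (hh : ∀ n, Integrable (h n)) (n : ℕ) :
    loc m l (g - h) n =ᵐ[volume] (loc m l g - loc m l h) n := by
  have hk := integrable_locKernel m hl
  have hd : ∀ n, Integrable ((g - h) n) := fun n => (hg n).sub (hh n)
  filter_upwards [hk.ae_convolution_exists (ContinuousLinearMap.mul ℂ ℂ) (hd n),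
    hk.ae_convolution_exists (ContinuousLinearMap.mul ℂ ℂ) (hh n)] with ξ h1 h2
  have h3 := h1.distrib_add h2
  simp only [Pi.sub_apply] at h3 ⊢
  rw [sub_add_cancel] at h3
  rw [loc, loc, loc, h3]
  simp

theorem lintegral_lconvolution_sq_le_young {f g : ℝ → ℝ≥0∞} (hf : Measurable f)
    (hg : Measurable g) :
    ∫⁻ z, (f ⋆ₗ g) z ^ 2 ≤ (∫⁻ y, f y) ^ 2 * ∫⁻ y, g y ^ 2 := by
  have h1 : ∀ z, (f ⋆ₗ g) z ^ 2 ≤ (∫⁻ y, f y) * (f ⋆ₗ (fun y => g y ^ 2)) z := by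
    intro z
    simp only [lconvolution_def]
    refine sq_lintegral_le (by fun_prop) (by fun_prop) fun y => le_of_eq ?_
    ring
  refine (lintegral_mono h1).trans ?_
  rw [lintegral_const_mul _ (by fun_prop), lintegral_lconvolution_eq hf (by fun_prop)]
  exact le_of_eq (by ring)

/-- Subadditivity of the power 7/16 moves the weight from ξ to the kernel variable ξ - η and to η.
At η, values below 1/l cost at most l^(-7/16), and above 1/l the surplus 9/16 - 7/16 = 1/8 of the
exponent pays for a factor l^(1/8). -/
theorem wt_rpow_le (n : ℤ) {l : ℝ} (hl : 0 < l) (ξ η : ℝ) :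
    wt n ξ ^ (7 / 16 : ℝ) ≤ ((2 * Real.pi * |-η + ξ|) ^ (7 / 16 : ℝ) + l ^ (-(7 / 16) : ℝ)) +
      l ^ (1 / 8 : ℝ) * wt n η ^ (9 / 16 : ℝ) := by
  have h1 : wt n ξ ≤ 2 * Real.pi * |-η + ξ| + wt n η := by
    have : 2 * Real.pi * ξ + n * (n + 1) =
        2 * Real.pi * (-η + ξ) + (2 * Real.pi * η + n * (n + 1)) := by ring
    rw [wt, wt, this]
    have := abs_add_le (2 * Real.pi * (-η + ξ)) (2 * Real.pi * η + n * (n + 1))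
    rw [abs_mul, abs_of_pos (by positivity : (0 : ℝ) < 2 * Real.pi)] at this
    linarith
  have hp := wt_pos n η
  have h2 : wt n η ^ (7 / 16 : ℝ) ≤
      l ^ (-(7 / 16) : ℝ) + l ^ (1 / 8 : ℝ) * wt n η ^ (9 / 16 : ℝ) := by
    rcases le_total (wt n η) l⁻¹ with h | h
    · have : wt n η ^ (7 / 16 : ℝ) ≤ l ^ (-(7 / 16) : ℝ) := by
        rw [Real.rpow_neg hl.le, ← Real.inv_rpow hl.le]
        exact Real.rpow_le_rpow hp.le h (by norm_num)
      have h0 : 0 ≤ l ^ (1 / 8 : ℝ) * wt n η ^ (9 / 16 : ℝ) := by positivity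
      linarith
    · have : 1 ≤ l ^ (1 / 8 : ℝ) * wt n η ^ (1 / 8 : ℝ) := by
        rw [← Real.mul_rpow hl.le hp.le]
        refine Real.one_le_rpow ?_ (by norm_num)
        calc 1 = l * l⁻¹ := (mul_inv_cancel₀ hl.ne').symm
          _ ≤ _ := by gcongr
      have h0 : 0 ≤ l ^ (-(7 / 16) : ℝ) := by positivity
      have h3 : wt n η ^ (9 / 16 : ℝ) = wt n η ^ (1 / 8 : ℝ) * wt n η ^ (7 / 16 : ℝ) := by
        rw [← Real.rpow_add hp]; norm_num
      have h4 : 0 ≤ wt n η ^ (7 / 16 : ℝ) := by positivity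
      rw [h3, ← mul_assoc]
      nlinarith
  calc wt n ξ ^ (7 / 16 : ℝ) ≤ (2 * Real.pi * |-η + ξ| + wt n η) ^ (7 / 16 : ℝ) :=
        Real.rpow_le_rpow (wt_pos _ _).le h1 (by norm_num)
    _ ≤ (2 * Real.pi * |-η + ξ|) ^ (7 / 16 : ℝ) + wt n η ^ (7 / 16 : ℝ) :=
        Real.rpow_add_le_add_rpow (by positivity) hp.le (by norm_num) (by norm_num)
    _ ≤ _ := by linarith

/-- The kernel of the localization with the weight of `wt_rpow_le`. -/
noncomputable def locWeight (l x : ℝ) : ℝ≥0∞ :=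
  ENNReal.ofReal ((2 * Real.pi * |x|) ^ (7 / 16 : ℝ) + l ^ (-(7 / 16) : ℝ)) *
    (ENNReal.ofReal l * ‖bumpHat (l * x)‖ₑ)

theorem measurable_locWeight (l : ℝ) : Measurable (locWeight l) := by
  have := bumpHat.continuous.measurable
  unfold locWeight
  fun_prop

/-- Pure scaling: the exponent is 1 - 2 · 7/16 = 1/8, positive because 7/16 < 1/2. -/
theorem lintegral_locWeight_sq {l : ℝ} (hl : 0 < l) :
    ∫⁻ x, locWeight l x ^ 2 = ENNReal.ofReal (l ^ (1 / 8 : ℝ)) * ∫⁻ x, locWeight 1 x ^ 2 := by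
  have e : ∀ x, locWeight l x ^ 2 = ENNReal.ofReal (l ^ (1 / 8 : ℝ)) *
      (ENNReal.ofReal l * locWeight 1 (l * x) ^ 2) := by
    intro x
    have h1 : (2 * Real.pi * |x|) ^ (7 / 16 : ℝ) + l ^ (-(7 / 16) : ℝ) =
        l ^ (-(7 / 16) : ℝ) * ((2 * Real.pi * |l * x|) ^ (7 / 16 : ℝ) + 1 ^ (-(7 / 16) : ℝ)) := by
      rw [mul_add, Real.one_rpow, mul_one, abs_mul, abs_of_pos hl,
        show 2 * Real.pi * (l * |x|) = l * (2 * Real.pi * |x|) by ring,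
        Real.mul_rpow hl.le (by positivity), ← mul_assoc, ← Real.rpow_add hl]
      norm_num
    rw [locWeight, locWeight, h1, ENNReal.ofReal_mul (by positivity)]
    have h2 : ENNReal.ofReal (l ^ (1 / 8 : ℝ)) * ENNReal.ofReal l =
        ENNReal.ofReal (l ^ (-(7 / 16) : ℝ)) ^ 2 * ENNReal.ofReal l ^ 2 := by
      rw [← mul_pow, ← ENNReal.ofReal_mul (by positivity), ← ENNReal.ofReal_mul (by positivity),
        ← ENNReal.ofReal_pow (by positivity), ← Real.rpow_add_one hl.ne',
        ← Real.rpow_add_one hl.ne', ← Real.rpow_mul_natCast hl.le]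
      norm_num
    simp only [one_mul, ENNReal.ofReal_one]
    set b₁ := ENNReal.ofReal (l ^ (-(7 / 16) : ℝ))
    set b₂ := ENNReal.ofReal l
    calc _ = (b₁ ^ 2 * b₂ ^ 2) * (ENNReal.ofReal ((2 * Real.pi * |l * x|) ^ (7 / 16 : ℝ) +
          1 ^ (-(7 / 16) : ℝ)) * ‖bumpHat (l * x)‖ₑ) ^ 2 := by ring
      _ = _ := by rw [← h2]; ring
  simp_rw [e]
  have hm := measurable_locWeight 1
  rw [lintegral_const_mul _ (by fun_prop), lintegral_const_mul _ (by fun_prop),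
    lintegral_comp_mul_left_pos (fun x => locWeight 1 x ^ 2) hl]

theorem lintegral_schwartz_weight_ne_top (θ : SchwartzMap ℝ ℂ) {w : ℝ → ℝ} {C : ℝ}
    (hw : ∀ x, 0 ≤ w x) (hC : ∀ x, w x ^ 2 ≤ C * (1 + |x|) ^ 4) :
    ∫⁻ x, (ENNReal.ofReal (w x) * ‖θ x‖ₑ) ^ 2 ≠ ∞ := by
  obtain ⟨D, hD0, hD⟩ := θ.decay 0 0
  have hI : Integrable fun x : ℝ => (1 + ‖x‖) ^ (-(2 : ℝ)) :=
    integrable_one_add_norm (by simp)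
  simp only [norm_iteratedFDeriv_zero, pow_zero, one_mul] at hD
  -- Six powers of decay cover four from the weight and two for integrability; the second factor of
  -- θ only needs to be bounded.
  obtain ⟨F, hF0, hF⟩ := θ.decay 6 0
  simp only [norm_iteratedFDeriv_zero] at hF
  have hC0 : 0 ≤ C := by
    have := hC 0
    simp at this
    nlinarith [sq_nonneg (w 0)]
  have bound : ∀ x, (ENNReal.ofReal (w x) * ‖θ x‖ₑ) ^ 2 ≤
      ENNReal.ofReal (C * (64 * (D + F) * D) * (1 + ‖x‖) ^ (-(2 : ℝ))) := by
    intro x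
    rw [← ofReal_norm, ← ENNReal.ofReal_mul (hw x),
      ← ENNReal.ofReal_pow (mul_nonneg (hw x) (norm_nonneg _))]
    refine ENNReal.ofReal_le_ofReal ?_
    have hx : 0 ≤ ‖x‖ := norm_nonneg x
    have h6 : (1 + ‖x‖) ^ 6 * ‖θ x‖ ≤ 64 * (D + F) := by
      have h1 : (1 + ‖x‖) ^ 6 ≤ 64 * (1 + ‖x‖ ^ 6) := by
        have := add_pow_le (zero_le_one (α := ℝ)) hx 6
        norm_num at this ⊢
        linarith [pow_nonneg (abs_nonneg x) 6]
      nlinarith [hD x, hF x, norm_nonneg (θ x)]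
    have hp : 0 < 1 + ‖x‖ := by linarith
    rw [mul_pow, Real.rpow_neg hp.le, Real.rpow_ofNat, ← div_eq_mul_inv,
      le_div_iff₀ (by positivity)]
    calc w x ^ 2 * ‖θ x‖ ^ 2 * (1 + ‖x‖) ^ 2 ≤
        (C * (1 + ‖x‖) ^ 4) * ‖θ x‖ ^ 2 * (1 + ‖x‖) ^ 2 := by
          gcongr; exact hC x
      _ = C * (((1 + ‖x‖) ^ 6 * ‖θ x‖) * ‖θ x‖) := by ring
      _ ≤ C * ((64 * (D + F)) * D) := by
          gcongr
          exact hD x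
      _ = _ := by ring
  refine ne_top_of_le_ne_top ?_ (lintegral_mono bound)
  exact (hI.const_mul _).lintegral_lt_top.ne

theorem lintegral_locWeight_one_ne_top : ∫⁻ x, locWeight 1 x ^ 2 ≠ ∞ := by
  have := lintegral_schwartz_weight_ne_top bumpHat
    (w := fun x => (2 * Real.pi * |x|) ^ (7 / 16 : ℝ) + 1) (C := 256)
    (fun x => by positivity) fun x => ?_
  · simpa [locWeight] using this
  · have h1 : (2 * Real.pi * |x|) ^ (7 / 16 : ℝ) ≤ 1 + 2 * Real.pi * |x| := by
      calc (2 * Real.pi * |x|) ^ (7 / 16 : ℝ) ≤ (1 + 2 * Real.pi * |x|) ^ (7 / 16 : ℝ) := by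
            gcongr; linarith
        _ ≤ (1 + 2 * Real.pi * |x|) ^ (1 : ℝ) := by
            refine Real.rpow_le_rpow_of_exponent_le ?_ (by norm_num)
            have : 0 ≤ 2 * Real.pi * |x| := by positivity
            linarith
        _ = _ := by simp
    have hx := abs_nonneg x
    have hpi := Real.pi_lt_four
    have h2 : (2 * Real.pi * |x|) ^ (7 / 16 : ℝ) + 1 ≤ 16 * (1 + |x|) := by
      nlinarith [Real.pi_pos]
    calc ((2 * Real.pi * |x|) ^ (7 / 16 : ℝ) + 1) ^ 2 ≤ (16 * (1 + |x|)) ^ 2 := by gcongr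
      _ = 256 * (1 + |x|) ^ 2 := by ring
      _ ≤ 256 * (1 + |x|) ^ 4 := by
          gcongr
          · linarith
          · norm_num

/-- The constant of the localization estimate. -/
noncomputable def locConst : ℝ≥0∞ :=
  2 * (l1Const * ∫⁻ x, locWeight 1 x ^ 2) + 2 * (∫⁻ x, ‖bumpHat x‖ₑ) ^ 2

theorem locConst_ne_top : locConst ≠ ∞ := by
  have h1 := lintegral_locWeight_one_ne_top
  have h2 : ∫⁻ x, ‖bumpHat x‖ₑ ≠ ∞ := (hasFiniteIntegral_iff_enorm.1 bumpHat.integrable.2).ne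
  have h3 := l1Const_ne_top
  unfold locConst
  finiteness

/-- Young's inequality L¹ ∗ L² → L² for each part of `wt_rpow_le`. Where the weight falls on the
kernel, g is taken in L¹ (possible since 9/8 > 1) and the weighted kernel in L²; where it falls on
g, the kernel is taken in L¹. Both parts carry l^(1/8) in the squared norm. -/
theorem xn_loc_le (m : ℝ) {l : ℝ} (hl : 0 < l) (hl1 : l ≤ 1) {g : ℕ → ℝ → ℂ}
    (hg : ∀ n, Measurable (g n)) :
    xn (7 / 8) (loc m l g) ≤ locConst * ENNReal.ofReal (l ^ (1 / 8 : ℝ)) * xn (9 / 8) g := by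
  rw [xn, xn, ← ENNReal.tsum_mul_left]
  refine ENNReal.tsum_le_tsum fun n => ?_
  have hgn := hg n
  set γ : ℝ → ℝ≥0∞ := fun ξ => ‖g n ξ‖ₑ with hγ
  set κ : ℝ → ℝ≥0∞ := fun x => ENNReal.ofReal l * ‖bumpHat (l * x)‖ₑ with hκ
  set G : ℝ → ℝ≥0∞ := fun ξ => ENNReal.ofReal (wt n ξ ^ (9 / 16 : ℝ)) * γ ξ with hG
  have mγ : Measurable γ := hgn.enorm
  have mκ : Measurable κ := by
    have := bumpHat.continuous.measurable
    fun_prop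
  have mG : Measurable G := by fun_prop
  have mw := measurable_locWeight l
  have hloc : ∀ ξ, ‖loc m l g n ξ‖ₑ ≤ (γ ⋆ₗ κ) ξ := by
    intro ξ
    rw [lconvolution_comm, lconvolution_def]
    refine (enorm_integral_le_lintegral_enorm _).trans (le_of_eq (lintegral_congr fun η => ?_))
    simp only [ContinuousLinearMap.mul_apply', enorm_mul, enorm_locKernel m hl]
    rw [neg_add_eq_sub]
  have hpt : ∀ ξ, ENNReal.ofReal (wt n ξ ^ (7 / 16 : ℝ)) * (γ ⋆ₗ κ) ξ ≤
      (γ ⋆ₗ locWeight l) ξ + ENNReal.ofReal (l ^ (1 / 8 : ℝ)) * (κ ⋆ₗ G) ξ := by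
    intro ξ
    rw [lconvolution_comm (f := κ), lconvolution_def, lconvolution_def, lconvolution_def,
      ← lintegral_const_mul _ (by fun_prop), ← lintegral_const_mul _ (by fun_prop),
      ← lintegral_add_left (by fun_prop)]
    refine lintegral_mono fun η => ?_
    have h1 := ENNReal.ofReal_le_ofReal (wt_rpow_le n hl ξ η)
    rw [ENNReal.ofReal_add (by positivity) (by have := wt_pos n η; positivity),
      ENNReal.ofReal_mul (by positivity)] at h1
    calc ENNReal.ofReal (wt n ξ ^ (7 / 16 : ℝ)) * (γ η * κ (-η + ξ)) ≤ _ :=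
          mul_le_mul_left h1 _
      _ = _ := by
          simp only [hG, hκ, locWeight]
          ring
  have hl8 : ENNReal.ofReal (l ^ (1 / 8 : ℝ)) ^ 2 ≤ ENNReal.ofReal (l ^ (1 / 8 : ℝ)) := by
    rw [sq]
    refine mul_le_of_le_one_left' ?_
    rw [← ENNReal.ofReal_one]
    exact ENNReal.ofReal_le_ofReal (Real.rpow_le_one hl.le hl1 (by norm_num))
  have hsq : ∀ ξ, ENNReal.ofReal (wt n ξ ^ (7 / 8 : ℝ)) * ‖loc m l g n ξ‖ₑ ^ 2 ≤
      2 * (γ ⋆ₗ locWeight l) ξ ^ 2 +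
        2 * (ENNReal.ofReal (l ^ (1 / 8 : ℝ)) * (κ ⋆ₗ G) ξ ^ 2) := by
    intro ξ
    have e : ENNReal.ofReal (wt n ξ ^ (7 / 8 : ℝ)) =
        ENNReal.ofReal (wt n ξ ^ (7 / 16 : ℝ)) ^ 2 := by
      have := wt_pos n ξ
      rw [← ENNReal.ofReal_pow (by positivity), ← Real.rpow_mul_natCast this.le]
      norm_num
    rw [e, ← mul_pow]
    calc (ENNReal.ofReal (wt n ξ ^ (7 / 16 : ℝ)) * ‖loc m l g n ξ‖ₑ) ^ 2
        ≤ ((γ ⋆ₗ locWeight l) ξ + ENNReal.ofReal (l ^ (1 / 8 : ℝ)) * (κ ⋆ₗ G) ξ) ^ 2 := by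
          gcongr
          exact (mul_le_mul_right (hloc ξ) _).trans (hpt ξ)
      _ ≤ 2 * (γ ⋆ₗ locWeight l) ξ ^ 2 +
          2 * (ENNReal.ofReal (l ^ (1 / 8 : ℝ)) * (κ ⋆ₗ G) ξ) ^ 2 := by
          exact ENNReal_add_sq_le _ _
      _ ≤ _ := by
          rw [mul_pow]
          gcongr
  have hwt : ∫⁻ ξ, G ξ ^ 2 = ∫⁻ ξ, ENNReal.ofReal (wt n ξ ^ (9 / 8 : ℝ)) * ‖g n ξ‖ₑ ^ 2 := by
    refine lintegral_congr fun ξ => ?_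
    have := wt_pos n ξ
    rw [hG, mul_pow, ← ENNReal.ofReal_pow (by positivity), ← Real.rpow_mul_natCast this.le]
    norm_num [hγ]
  have hκ1 : ∫⁻ x, κ x = ∫⁻ x, ‖bumpHat x‖ₑ := by
    rw [hκ, lintegral_const_mul' _ _ (by simp),
      lintegral_comp_mul_left_pos (fun x => ‖bumpHat x‖ₑ) hl]
  refine (lintegral_mono hsq).trans ?_
  rw [lintegral_add_left (by fun_prop), lintegral_const_mul _ (by fun_prop),
    lintegral_const_mul _ (by fun_prop), lintegral_const_mul _ (by fun_prop)]
  have y1 := lintegral_lconvolution_sq_le_young mγ mw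
  have y2 := lintegral_lconvolution_sq_le_young mκ mG
  rw [lintegral_locWeight_sq hl] at y1
  rw [hwt, hκ1] at y2
  have y3 := lintegral_enorm_sq_le hgn n
  set Q := ∫⁻ ξ, ENNReal.ofReal (wt n ξ ^ (9 / 8 : ℝ)) * ‖g n ξ‖ₑ ^ 2
  set L := ENNReal.ofReal (l ^ (1 / 8 : ℝ))
  calc _ ≤ 2 * ((l1Const * Q) * (L * ∫⁻ x, locWeight 1 x ^ 2)) +
        2 * (L * ((∫⁻ x, ‖bumpHat x‖ₑ) ^ 2 * Q)) := by
        gcongr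
        exact y1.trans (mul_le_mul_left y3 _)
    _ = _ := by rw [locConst]; ring

/-! ### The damped Duhamel operator -/

/-- The symbol `1 + i (τ + n (n + 1))`. -/
noncomputable def damp (n : ℕ) (ξ : ℝ) : ℂ :=
  1 + Complex.I * ((2 * Real.pi * ξ + n * (n + 1) : ℝ) : ℂ)

theorem sq_wt_le_normSq_damp (n : ℕ) (ξ : ℝ) : wt n ξ ^ 2 ≤ 2 * ‖damp n ξ‖ ^ 2 := by
  have h : ‖damp n ξ‖ ^ 2 = 1 + (2 * Real.pi * ξ + n * (n + 1)) ^ 2 := by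
    rw [← Complex.normSq_eq_norm_sq, Complex.normSq_apply, damp]
    simp [Complex.add_re, Complex.add_im]
    ring
  rw [h, wt]
  push_cast
  rw [← sq_abs (2 * Real.pi * ξ + n * (n + 1))]
  nlinarith [sq_nonneg (1 - |2 * Real.pi * ξ + (n : ℝ) * (n + 1)|)]

/-- The added 1 keeps the symbol away from zero on the characteristic set τ = -n(n+1), so the linear
operator is inverted by plain division. -/
theorem norm_damp_pos (n : ℕ) (ξ : ℝ) : 0 < ‖damp n ξ‖ := by
  have h1 := sq_wt_le_normSq_damp n ξ
  have h2 := one_le_wt n ξ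
  by_contra h
  have : ‖damp n ξ‖ = 0 := le_antisymm (not_lt.1 h) (norm_nonneg _)
  rw [this] at h1
  nlinarith

theorem damp_ne_zero (n : ℕ) (ξ : ℝ) : damp n ξ ≠ 0 := norm_pos_iff.1 (norm_damp_pos n ξ)

theorem wt_le_two_mul_norm_damp (n : ℕ) (ξ : ℝ) : wt n ξ ≤ 2 * ‖damp n ξ‖ := by
  have h1 := sq_wt_le_normSq_damp n ξ
  have h2 := wt_pos n ξ
  have h3 := norm_damp_pos n ξ
  nlinarith

theorem one_le_two_mul_norm_damp (n : ℕ) (ξ : ℝ) : 1 ≤ 2 * ‖damp n ξ‖ :=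
  (one_le_wt n ξ).trans (wt_le_two_mul_norm_damp n ξ)

@[fun_prop]
theorem continuous_damp (n : ℕ) : Continuous (damp n) := by
  unfold damp
  fun_prop

/-- The solution of `y' + (1 + i n (n + 1)) y = h` on the Fourier side. -/
noncomputable def undamp (H : ℕ → ℝ → ℂ) (n : ℕ) (ξ : ℝ) : ℂ := H n ξ / damp n ξ

theorem measurable_undamp {H : ℕ → ℝ → ℂ} (hH : ∀ n, Measurable (H n)) (n : ℕ) :
    Measurable (undamp H n) := (hH n).div (continuous_damp n).measurable

theorem enorm_undamp_sq_le (H : ℕ → ℝ → ℂ) (n : ℕ) (ξ : ℝ) :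
    ENNReal.ofReal (wt n ξ ^ (9 / 8 : ℝ)) * ‖undamp H n ξ‖ₑ ^ 2 ≤
      2 * (ENNReal.ofReal (wt n ξ ^ (-(7 / 8) : ℝ)) * ‖H n ξ‖ₑ ^ 2) := by
  have hw := wt_pos n ξ
  have hd := norm_damp_pos n ξ
  rw [← ofReal_norm, ← ofReal_norm, ← ENNReal.ofReal_pow (norm_nonneg _),
    ← ENNReal.ofReal_pow (norm_nonneg _), ← ENNReal.ofReal_mul (by positivity),
    ← ENNReal.ofReal_mul (by positivity), ← ENNReal.ofReal_ofNat,
    ← ENNReal.ofReal_mul (by positivity)]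
  refine ENNReal.ofReal_le_ofReal ?_
  rw [undamp, norm_div, div_pow, ← mul_div_assoc, div_le_iff₀ (by positivity)]
  have e : wt n ξ ^ (9 / 8 : ℝ) = wt n ξ ^ (-(7 / 8) : ℝ) * wt n ξ ^ 2 := by
    rw [← Real.rpow_natCast, ← Real.rpow_add hw]; norm_num
  rw [e]
  have h := sq_wt_le_normSq_damp n ξ
  have h0 : 0 ≤ wt n ξ ^ (-(7 / 8) : ℝ) * ‖H n ξ‖ ^ 2 := by positivity
  nlinarith

/-- The division gains a full power of the weight, two in the square: -7/8 + 2 = 9/8. This brings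
the output of the trilinear estimate back to the solution space. -/
theorem xn_undamp_le (H : ℕ → ℝ → ℂ) : xn (9 / 8) (undamp H) ≤ 2 * xn (-(7 / 8)) H := by
  rw [xn, xn, ← ENNReal.tsum_mul_left]
  refine ENNReal.tsum_le_tsum fun n => ?_
  rw [← lintegral_const_mul' _ _ (by simp)]
  exact lintegral_mono fun ξ => enorm_undamp_sq_le H n ξ

theorem integrable_undamp {H : ℕ → ℝ → ℂ} (hH : ∀ n, Integrable (H n)) (n : ℕ) :
    Integrable (undamp H n) := by
  have h : Integrable fun ξ => (damp n ξ)⁻¹ * H n ξ := by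
    refine (hH n).bdd_mul (c := 2) ?_ (Eventually.of_forall fun ξ => ?_)
    · exact ((continuous_damp n).inv₀ (damp_ne_zero n)).aestronglyMeasurable
    · rw [norm_inv, inv_le_comm₀ (norm_damp_pos n ξ) (by norm_num)]
      linarith [one_le_two_mul_norm_damp n ξ]
  refine h.congr (Eventually.of_forall fun ξ => ?_)
  simp only [undamp]
  rw [div_eq_inv_mul]

theorem hasDerivAt_fourierInv_undamp {H : ℕ → ℝ → ℂ} (hH : ∀ n, Integrable (H n)) (n : ℕ)
    (t : ℝ) : HasDerivAt (𝓕⁻ (undamp H n))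
      (𝓕⁻ (H n) t - (1 + Complex.I * (n * (n + 1))) * 𝓕⁻ (undamp H n) t) t := by
  have hi := integrable_undamp hH n
  have e : (fun ξ : ℝ => 2 * Real.pi * Complex.I * ξ * undamp H n ξ) =
      H n - fun ξ => (1 + Complex.I * (n * (n + 1))) * undamp H n ξ := by
    funext ξ
    have h : H n ξ = damp n ξ * undamp H n ξ := by
      rw [undamp, mul_div_cancel₀ _ (damp_ne_zero n ξ)]
    simp only [Pi.sub_apply]
    rw [h, damp]
    push_cast
    ring
  have hi' : Integrable fun ξ => (1 + Complex.I * (n * (n + 1))) * undamp H n ξ := hi.const_mul _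
  have hd := hasDerivAt_fourierInv hi (by rw [e]; exact (hH n).sub hi') t
  rwa [e, fourierInv_sub_apply (hH n) hi', fourierInv_const_mul_apply] at hd

/-- The Fourier transform of a decaying extension of `exp (-(1 + i n (n + 1)) t)`. -/
noncomputable def freeHat (n : ℕ) (ξ : ℝ) : ℂ := expHat (ξ + n * (n + 1) / (2 * Real.pi))

theorem continuous_freeHat (n : ℕ) : Continuous (freeHat n) := by
  have := expHat.continuous
  unfold freeHat
  fun_prop

theorem integrable_freeHat (n : ℕ) : Integrable (freeHat n) :=
  expHat.integrable.comp_add_right _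

theorem fourierInv_freeHat (n : ℕ) {t : ℝ} (ht : t ∈ Icc (-2 : ℝ) 2) :
    𝓕⁻ (freeHat n) t = Complex.exp (-(1 + Complex.I * (n * (n + 1))) * t) := by
  rw [fourierInv_eq_integral]
  have h := integral_add_right_eq_self (μ := (volume : Measure ℝ)) (fun ξ : ℝ =>
    Complex.exp (2 * Real.pi * Complex.I * (ξ - n * (n + 1) / (2 * Real.pi)) * t) * expHat ξ)
    ((n : ℝ) * (n + 1) / (2 * Real.pi))
  have e : ∀ ξ : ℝ, Complex.exp (2 * Real.pi * Complex.I * ξ * t) * freeHat n ξ =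
      (fun ξ : ℝ => Complex.exp (2 * Real.pi * Complex.I * (ξ - n * (n + 1) / (2 * Real.pi)) * t) *
        expHat ξ) (ξ + (n : ℝ) * (n + 1) / (2 * Real.pi)) := by
    intro ξ
    simp only [freeHat]
    congr 3
    push_cast
    ring
  simp_rw [e]
  rw [h]
  have e2 : ∀ ξ : ℝ, Complex.exp (2 * Real.pi * Complex.I * (ξ - n * (n + 1) / (2 * Real.pi)) * t) *
      expHat ξ = Complex.exp (-(Complex.I * (n * (n + 1))) * t) *
        (Complex.exp (2 * Real.pi * Complex.I * ξ * t) * expHat ξ) := by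
    intro ξ
    rw [← mul_assoc, ← Complex.exp_add]
    congr 2
    have : (Real.pi : ℂ) ≠ 0 := by exact_mod_cast Real.pi_ne_zero
    field_simp
    ring
  simp_rw [e2]
  rw [integral_const_mul, ← fourierInv_eq_integral, fourierInv_expHat ht, ← Complex.exp_add]
  congr 1
  ring

/-- The square of the norm of `freeHat n`, which does not depend on `n`. -/
noncomputable def freeConst : ℝ≥0∞ :=
  ∫⁻ ξ : ℝ, ENNReal.ofReal ((1 + |2 * Real.pi * ξ|) ^ (9 / 8 : ℝ)) * ‖expHat ξ‖ₑ ^ 2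

theorem freeConst_ne_top : freeConst ≠ ∞ := by
  have h := lintegral_schwartz_weight_ne_top expHat
    (w := fun x => (1 + |2 * Real.pi * x|) ^ (9 / 16 : ℝ)) (C := 64) (fun x => by positivity)
    fun x => ?_
  · refine ne_of_eq_of_ne (lintegral_congr fun ξ => ?_) h
    rw [mul_pow, ← ENNReal.ofReal_pow (by positivity), ← Real.rpow_mul_natCast (by positivity)]
    norm_num
  · have hx := abs_nonneg x
    have h1 : 1 + |2 * Real.pi * x| ≤ 8 * (1 + |x|) := by
      rw [abs_mul, abs_of_pos (by positivity : (0 : ℝ) < 2 * Real.pi)]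
      nlinarith [Real.pi_lt_four]
    calc ((1 + |2 * Real.pi * x|) ^ (9 / 16 : ℝ)) ^ 2
        ≤ ((1 + |2 * Real.pi * x|) ^ (1 : ℝ)) ^ 2 := by
          gcongr
          · simp
          · norm_num
      _ ≤ (8 * (1 + |x|)) ^ 2 := by rw [Real.rpow_one]; gcongr
      _ = 64 * (1 + |x|) ^ 2 := by ring
      _ ≤ 64 * (1 + |x|) ^ 4 := by
          gcongr
          · linarith
          · norm_num

theorem lintegral_freeHat (n : ℕ) :
    ∫⁻ ξ, ENNReal.ofReal (wt n ξ ^ (9 / 8 : ℝ)) * ‖freeHat n ξ‖ₑ ^ 2 = freeConst := by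
  rw [freeConst, ← lintegral_add_right_eq_self (μ := (volume : Measure ℝ))
    (fun ξ : ℝ => ENNReal.ofReal ((1 + |2 * Real.pi * ξ|) ^ (9 / 8 : ℝ)) * ‖expHat ξ‖ₑ ^ 2)
    ((n : ℝ) * (n + 1) / (2 * Real.pi))]
  refine lintegral_congr fun ξ => ?_
  rw [freeHat, wt]
  congr 5
  push_cast
  field_simp

/-- The family whose inverse Fourier transform on `[-2, 2]` is the solution of
`y' + (1 + i n (n + 1)) y = 𝓕⁻ H`, `y (t₀) = c`. -/
noncomputable def duhamel (t₀ : ℝ) (c : ℕ → ℂ) (H : ℕ → ℝ → ℂ) (n : ℕ) (ξ : ℝ) : ℂ :=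
  undamp H n ξ + (c n - 𝓕⁻ (undamp H n) t₀) *
    Complex.exp ((1 + Complex.I * (n * (n + 1))) * t₀) * freeHat n ξ

theorem measurable_duhamel (t₀ : ℝ) (c : ℕ → ℂ) {H : ℕ → ℝ → ℂ} (hH : ∀ n, Measurable (H n))
    (n : ℕ) : Measurable (duhamel t₀ c H n) :=
  (measurable_undamp hH n).add ((continuous_freeHat n).measurable.const_mul _)

theorem fourierInv_duhamel (t₀ : ℝ) (c : ℕ → ℂ) {H : ℕ → ℝ → ℂ} (hH : ∀ n, Integrable (H n))
    (n : ℕ) (t : ℝ) : 𝓕⁻ (duhamel t₀ c H n) t = 𝓕⁻ (undamp H n) t +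
      (c n - 𝓕⁻ (undamp H n) t₀) * Complex.exp ((1 + Complex.I * (n * (n + 1))) * t₀) *
        𝓕⁻ (freeHat n) t := by
  have := fourierInv_add_apply (integrable_undamp hH n) ((integrable_freeHat n).const_mul
    ((c n - 𝓕⁻ (undamp H n) t₀) * Complex.exp ((1 + Complex.I * (n * (n + 1))) * t₀))) t
  rw [fourierInv_const_mul_apply] at this
  exact this

theorem fourierInv_duhamel_self {t₀ : ℝ} (ht₀ : t₀ ∈ Icc (-2 : ℝ) 2) (c : ℕ → ℂ)
    {H : ℕ → ℝ → ℂ} (hH : ∀ n, Integrable (H n)) (n : ℕ) :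
    𝓕⁻ (duhamel t₀ c H n) t₀ = c n := by
  rw [fourierInv_duhamel t₀ c hH, fourierInv_freeHat n ht₀, mul_assoc, ← Complex.exp_add, neg_mul,
    add_neg_cancel, Complex.exp_zero]
  ring

theorem hasDerivAt_fourierInv_duhamel (t₀ : ℝ) (c : ℕ → ℂ) {H : ℕ → ℝ → ℂ}
    (hH : ∀ n, Integrable (H n)) (n : ℕ) {t : ℝ} (ht : t ∈ Ioo (-2 : ℝ) 2) :
    HasDerivAt (𝓕⁻ (duhamel t₀ c H n))
      (𝓕⁻ (H n) t - (1 + Complex.I * (n * (n + 1))) * 𝓕⁻ (duhamel t₀ c H n) t) t := by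
  have e : 𝓕⁻ (duhamel t₀ c H n) =ᶠ[𝓝 t] fun t => 𝓕⁻ (undamp H n) t +
      (c n - 𝓕⁻ (undamp H n) t₀) * Complex.exp ((1 + Complex.I * (n * (n + 1))) * t₀) *
        Complex.exp (-(1 + Complex.I * (n * (n + 1))) * t) := by
    filter_upwards [Ioo_mem_nhds ht.1 ht.2] with s hs
    rw [fourierInv_duhamel t₀ c hH, fourierInv_freeHat n (Ioo_subset_Icc_self hs)]
  refine HasDerivAt.congr_of_eventuallyEq ?_ e
  have h1 : HasDerivAt (fun s : ℝ => -(1 + Complex.I * (n * (n + 1))) * (s : ℂ))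
      (-(1 + Complex.I * (n * (n + 1)))) t := by
    simpa using (Complex.ofRealCLM.hasDerivAt (x := t)).const_mul
      (-(1 + Complex.I * (n * (n + 1))))
  refine ((hasDerivAt_fourierInv_undamp hH n t).add (h1.cexp.const_mul _)).congr_deriv ?_
  rw [e.eq_of_nhds]
  ring

/-- The constant in the energy estimate for `duhamel`. -/
noncomputable def duhConst : ℝ≥0∞ := 4 + 72 * freeConst * (1 + 2 * l1Const)

theorem duhConst_ne_top : duhConst ≠ ∞ := by
  have := freeConst_ne_top
  have := l1Const_ne_top
  unfold duhConst
  finiteness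

/-- The solution is the particular one plus a free wave correcting its value at t₀. The correction
is a sequence in ℓ², since the value of the particular solution at one time is controlled by the L¹
embedding. -/
theorem xn_duhamel_le {t₀ : ℝ} (ht₀ : t₀ ≤ 1) (c : ℕ → ℂ) {H : ℕ → ℝ → ℂ}
    (hH : ∀ n, Measurable (H n)) :
    xn (9 / 8) (duhamel t₀ c H) ≤ duhConst * (xn (-(7 / 8)) H + ∑' n, ‖c n‖ₑ ^ 2) := by
  have mU := measurable_undamp hH
  set U := undamp H with hU
  set a : ℕ → ℂ := fun n =>
    (c n - 𝓕⁻ (U n) t₀) * Complex.exp ((1 + Complex.I * (n * (n + 1))) * t₀) with ha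
  have hsplit : duhamel t₀ c H = U + fun n ξ => a n * freeHat n ξ := rfl
  -- The damped free wave is normalized at t₀ rather than at 0, which costs a factor exp t₀; as t₀ ≤
  -- 1 this is at most 3.
  have hexp : ∀ n : ℕ, ‖Complex.exp ((1 + Complex.I * ((n : ℂ) * (n + 1))) * t₀)‖ₑ ^ 2 ≤ 9 := by
    intro n
    have h1 : ‖Complex.exp ((1 + Complex.I * ((n : ℂ) * (n + 1))) * t₀)‖ ≤ 3 := by
      rw [Complex.norm_exp]
      have : ((1 + Complex.I * ((n : ℂ) * (n + 1))) * t₀).re = t₀ := by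
        simp [Complex.add_re, Complex.mul_re, Complex.add_im, Complex.mul_im]
      rw [this]
      exact (Real.exp_le_exp.2 ht₀).trans (by linarith [Real.exp_one_lt_d9])
    rw [← ofReal_norm]
    calc _ ≤ (ENNReal.ofReal 3) ^ 2 := by gcongr
      _ = 9 := by rw [ENNReal.ofReal_ofNat]; norm_num
  have h1 : xn (9 / 8) (fun n ξ => a n * freeHat n ξ) = freeConst * ∑' n, ‖a n‖ₑ ^ 2 := by
    rw [xn, ← ENNReal.tsum_mul_left]
    refine tsum_congr fun n => ?_
    rw [← lintegral_freeHat n, mul_comm, ← lintegral_const_mul' _ _ (by simp)]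
    refine lintegral_congr fun ξ => ?_
    rw [enorm_mul]
    ring
  have h2 : ∑' n, ‖a n‖ₑ ^ 2 ≤ 18 * ∑' n, ‖c n‖ₑ ^ 2 + 18 * ∑' n, ‖𝓕⁻ (U n) t₀‖ₑ ^ 2 := by
    rw [← ENNReal.tsum_mul_left, ← ENNReal.tsum_mul_left, ← ENNReal.tsum_add]
    refine ENNReal.tsum_le_tsum fun n => ?_
    rw [ha, enorm_mul, mul_pow]
    calc _ ≤ (2 * ‖c n‖ₑ ^ 2 + 2 * ‖𝓕⁻ (U n) t₀‖ₑ ^ 2) * 9 := by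
          gcongr
          · have := enorm_add_sq_le (c n) (-𝓕⁻ (U n) t₀)
            rwa [← sub_eq_add_neg, enorm_neg] at this
          · exact hexp n
      _ = _ := by ring
  have h3 : ∑' n, ‖𝓕⁻ (U n) t₀‖ₑ ^ 2 ≤ l1Const * xn (9 / 8) U := by
    refine le_trans (ENNReal.tsum_le_tsum fun n => ?_) (tsum_lintegral_enorm_sq_le mU)
    gcongr
    exact norm_fourierInv_le _ _
  have h4 := xn_undamp_le H
  rw [hsplit]
  refine (xn_add_le _ mU).trans ?_
  rw [h1]
  set X := xn (-(7 / 8)) H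
  set S := ∑' n, ‖c n‖ₑ ^ 2
  calc 2 * xn (9 / 8) U + 2 * (freeConst * ∑' n, ‖a n‖ₑ ^ 2)
      ≤ 2 * (2 * X) + 2 * (freeConst * (18 * S + 18 * (l1Const * (2 * X)))) := by
        gcongr
        refine h2.trans ?_
        gcongr
        exact h3.trans (by gcongr)
    _ = (4 + 72 * freeConst * l1Const) * X + 36 * freeConst * S := by ring
    _ ≤ (4 + 72 * freeConst * (1 + 2 * l1Const)) * X +
        (4 + 72 * freeConst * (1 + 2 * l1Const)) * S := by
        gcongr
        · calc l1Const ≤ 1 * l1Const + l1Const := by rw [one_mul]; exact le_self_add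
            _ = 2 * l1Const := by ring
            _ ≤ _ := le_add_self
        · calc 36 * freeConst ≤ 36 * freeConst * (2 * (1 + 2 * l1Const)) := by
                refine le_mul_of_one_le_right' ?_
                calc (1 : ℝ≥0∞) ≤ 1 + (1 + 4 * l1Const) := le_self_add
                  _ = _ := by ring
            _ = 72 * freeConst * (1 + 2 * l1Const) := by ring
            _ ≤ _ := le_add_self
    _ = _ := by rw [duhConst]; ring

/-! ### The localized nonlinearity -/

/-- The Cauchy product of two sequences. -/
def sconv (a b : ℕ → ℂ) (n : ℕ) : ℂ := ∑ p ∈ antidiag n, a p.1 * b p.2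

theorem fourierInv_tri {g₁ g₂ g₃ : ℕ → ℝ → ℂ} (h₁ : ∀ n, Integrable (g₁ n))
    (h₂ : ∀ n, Integrable (g₂ n)) (h₃ : ∀ n, Integrable (g₃ n)) (n : ℕ) (t : ℝ) :
    𝓕⁻ (tri g₁ g₂ g₃ n) t =
      sconv (sconv (fun n => 𝓕⁻ (g₁ n) t) fun n => 𝓕⁻ (g₂ n) t) (fun n => 𝓕⁻ (g₃ n) t) n := by
  rw [tri, fourierInv_bconv (integrable_bconv h₁ h₂) h₃]
  refine Finset.sum_congr rfl fun p _ => ?_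
  rw [fourierInv_bconv h₁ h₂]
  rfl

theorem measurable_tri {g₁ g₂ g₃ : ℕ → ℝ → ℂ} (h₁ : ∀ n, Measurable (g₁ n))
    (h₂ : ∀ n, Measurable (g₂ n)) (h₃ : ∀ n, Measurable (g₃ n)) (n : ℕ) :
    Measurable (tri g₁ g₂ g₃ n) := measurable_bconv (measurable_bconv h₁ h₂) h₃ n

theorem integrable_tri {g₁ g₂ g₃ : ℕ → ℝ → ℂ} (h₁ : ∀ n, Integrable (g₁ n))
    (h₂ : ∀ n, Integrable (g₂ n)) (h₃ : ∀ n, Integrable (g₃ n)) (n : ℕ) :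
    Integrable (tri g₁ g₂ g₃ n) := integrable_bconv (integrable_bconv h₁ h₂) h₃ n

/-- The right hand side of the damped equation, localized in time. -/
noncomputable def source (m l : ℝ) (g : ℕ → ℝ → ℂ) : ℕ → ℝ → ℂ :=
  (fun n ξ => -Complex.I * tri (loc m l g) (loc m l g) (loc m l g) n ξ) + loc m l g

/-- The difference of the localized cubic terms of `v` and `u`, with `d` in place of `v - u`. -/
noncomputable def triDiff (m l : ℝ) (d v u : ℕ → ℝ → ℂ) : ℕ → ℝ → ℂ :=
  tri (loc m l d) (loc m l v) (loc m l v) + tri (loc m l u) (loc m l d) (loc m l v) +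
    tri (loc m l u) (loc m l u) (loc m l d)

/-- The right hand side of the damped equation for the difference of two solutions. -/
noncomputable def diffSource (m l : ℝ) (d v u : ℕ → ℝ → ℂ) : ℕ → ℝ → ℂ :=
  (fun n ξ => -Complex.I * triDiff m l d v u n ξ) + loc m l d

theorem measurable_source (m l : ℝ) {g : ℕ → ℝ → ℂ} (hg : ∀ n, Measurable (g n)) (n : ℕ) :
    Measurable (source m l g n) := by
  have h := measurable_loc m l hg
  exact ((measurable_tri h h h n).const_mul _).add (h n)

theorem integrable_source (m : ℝ) {l : ℝ} (hl : 0 < l) {g : ℕ → ℝ → ℂ}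
    (hg : ∀ n, Integrable (g n)) (n : ℕ) : Integrable (source m l g n) := by
  have h := integrable_loc m hl hg
  exact ((integrable_tri h h h n).const_mul _).add (h n)

theorem measurable_triDiff (m l : ℝ) {d v u : ℕ → ℝ → ℂ} (hd : ∀ n, Measurable (d n))
    (hv : ∀ n, Measurable (v n)) (hu : ∀ n, Measurable (u n)) (n : ℕ) :
    Measurable (triDiff m l d v u n) := by
  have h := measurable_loc m l hd
  have h' := measurable_loc m l hv
  have h'' := measurable_loc m l hu
  exact ((measurable_tri h h' h' n).add (measurable_tri h'' h h' n)).add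
    (measurable_tri h'' h'' h n)

theorem integrable_triDiff (m : ℝ) {l : ℝ} (hl : 0 < l) {d v u : ℕ → ℝ → ℂ}
    (hd : ∀ n, Integrable (d n)) (hv : ∀ n, Integrable (v n)) (hu : ∀ n, Integrable (u n))
    (n : ℕ) : Integrable (triDiff m l d v u n) := by
  have h := integrable_loc m hl hd
  have h' := integrable_loc m hl hv
  have h'' := integrable_loc m hl hu
  exact ((integrable_tri h h' h' n).add (integrable_tri h'' h h' n)).add
    (integrable_tri h'' h'' h n)

theorem measurable_diffSource (m l : ℝ) {d v u : ℕ → ℝ → ℂ} (hd : ∀ n, Measurable (d n))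
    (hv : ∀ n, Measurable (v n)) (hu : ∀ n, Measurable (u n)) (n : ℕ) :
    Measurable (diffSource m l d v u n) :=
  ((measurable_triDiff m l hd hv hu n).const_mul _).add (measurable_loc m l hd n)

theorem integrable_diffSource (m : ℝ) {l : ℝ} (hl : 0 < l) {d v u : ℕ → ℝ → ℂ}
    (hd : ∀ n, Integrable (d n)) (hv : ∀ n, Integrable (v n)) (hu : ∀ n, Integrable (u n))
    (n : ℕ) : Integrable (diffSource m l d v u n) :=
  ((integrable_triDiff m hl hd hv hu n).const_mul _).add (integrable_loc m hl hd n)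

theorem source_sub_source (m : ℝ) {l : ℝ} (hl : 0 < l) {g h : ℕ → ℝ → ℂ}
    (hg : ∀ n, Integrable (g n)) (hh : ∀ n, Integrable (h n)) (n : ℕ) :
    (source m l g - source m l h) n =ᵐ[volume] diffSource m l (g - h) g h n := by
  have h1 := tri_sub_tri (integrable_loc m hl hg) (integrable_loc m hl hh) n
  have h2 := loc_sub m hl hg hh
  have e : triDiff m l (g - h) g h = tri (loc m l g - loc m l h) (loc m l g) (loc m l g) +
      tri (loc m l h) (loc m l g - loc m l h) (loc m l g) +
      tri (loc m l h) (loc m l h) (loc m l g - loc m l h) := by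
    simp only [triDiff, tri]
    rw [bconv_congr h2 fun n => EventuallyEq.rfl,
      bconv_congr (fun n => EventuallyEq.rfl) h2,
      bconv_congr (g := bconv (loc m l h) (loc m l h)) (fun n => EventuallyEq.rfl) h2]
  filter_upwards [h1, h2 n] with ξ a1 a2
  simp only [source, diffSource, Pi.sub_apply, Pi.add_apply] at a1 a2 ⊢
  rw [e, a2]
  simp only [Pi.add_apply]
  rw [← a1]
  ring

/-- The constant in the estimate of `diffSource`. -/
noncomputable def srcConst : ℝ≥0∞ := 16 * (convConst ^ 2 * locConst ^ 3) + 2 * locConst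

theorem srcConst_ne_top : srcConst ≠ ∞ := by
  have := convConst_ne_top
  have := locConst_ne_top
  unfold srcConst
  finiteness

/-- Each trilinear term has three localized factors and gains the third power of the small constant.
The linear term created by the damping gains only the first power, and that sets the rate. -/
theorem xn_diffSource_le (m : ℝ) {l : ℝ} (hl : 0 < l) (hl1 : l ≤ 1) {d v u : ℕ → ℝ → ℂ}
    (hd : ∀ n, Measurable (d n)) (hv : ∀ n, Measurable (v n)) (hu : ∀ n, Measurable (u n)) :
    xn (-(7 / 8)) (diffSource m l d v u) ≤ srcConst * ENNReal.ofReal (l ^ (1 / 8 : ℝ)) *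
      (1 + (xn (9 / 8) v + xn (9 / 8) u) ^ 2) * xn (9 / 8) d := by
  have h := measurable_loc m l hd
  have h' := measurable_loc m l hv
  have h'' := measurable_loc m l hu
  have e1 := xn_loc_le m hl hl1 hd
  have e2 := xn_loc_le m hl hl1 hv
  have e3 := xn_loc_le m hl hl1 hu
  have t1 := xn_tri_le h h' h'
  have t2 := xn_tri_le h'' h h'
  have t3 := xn_tri_le h'' h'' h
  have s1 := xn_add_le (-(7 / 8))
    (g := tri (loc m l d) (loc m l v) (loc m l v))
    (h := tri (loc m l u) (loc m l d) (loc m l v)) (fun n => measurable_tri h h' h' n)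
  have s2 := xn_add_le (-(7 / 8))
    (g := tri (loc m l d) (loc m l v) (loc m l v) + tri (loc m l u) (loc m l d) (loc m l v))
    (h := tri (loc m l u) (loc m l u) (loc m l d))
    (fun n => (measurable_tri h h' h' n).add (measurable_tri h'' h h' n))
  have s3 := xn_add_le (-(7 / 8)) (g := fun n ξ => -Complex.I * triDiff m l d v u n ξ)
    (h := loc m l d) (fun n => (measurable_triDiff m l hd hv hu n).const_mul _)
  rw [xn_const_mul] at s3
  have hI : ‖-Complex.I‖ₑ ^ 2 = 1 := by simp [← ofReal_norm]
  rw [hI, one_mul] at s3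
  have s4 : xn (-(7 / 8)) (loc m l d) ≤ xn (7 / 8) (loc m l d) := xn_mono (by norm_num) _
  set L := ENNReal.ofReal (l ^ (1 / 8 : ℝ)) with hL
  have hL1 : L ≤ 1 := by
    rw [← ENNReal.ofReal_one]
    exact ENNReal.ofReal_le_ofReal (Real.rpow_le_one hl.le hl1 (by norm_num))
  set D := xn (9 / 8) d
  set V := xn (9 / 8) v
  set U := xn (9 / 8) u
  have hL3 : L ^ 3 ≤ L := pow_le_of_le_one zero_le hL1 (by norm_num)
  refine s3.trans ?_
  have step : xn (-(7 / 8)) (triDiff m l d v u) ≤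
      8 * (convConst ^ 2 * locConst ^ 3) * L * ((V + U) ^ 2 * D) := by
    calc xn (-(7 / 8)) (triDiff m l d v u)
        ≤ 2 * (2 * (convConst ^ 2 * ((locConst * L * D) * (locConst * L * V) * (locConst * L * V)))
          + 2 * (convConst ^ 2 * ((locConst * L * U) * (locConst * L * D) * (locConst * L * V))))
          + 2 * (convConst ^ 2 *
            ((locConst * L * U) * (locConst * L * U) * (locConst * L * D))) := by
          refine s2.trans ?_
          gcongr
          · refine s1.trans ?_
            gcongr
            · exact t1.trans (by gcongr)
            · exact t2.trans (by gcongr)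
          · exact t3.trans (by gcongr)
      _ = (convConst ^ 2 * locConst ^ 3) * L ^ 3 *
          ((4 * (V * V) + 4 * (U * V) + 2 * (U * U)) * D) := by ring
      -- The surplus terms complete the quadratic form to 8 (V + U) ^ 2.
      _ ≤ (convConst ^ 2 * locConst ^ 3) * L *
          ((4 * (V * V) + 4 * (U * V) + 2 * (U * U) +
            (4 * (V * V) + 12 * (U * V) + 6 * (U * U))) * D) := by
          exact mul_le_mul' (mul_le_mul' le_rfl hL3) (mul_le_mul' le_self_add le_rfl)
      _ = _ := by ring
  calc 2 * xn (-(7 / 8)) (triDiff m l d v u) + 2 * xn (-(7 / 8)) (loc m l d)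
      ≤ 2 * (8 * (convConst ^ 2 * locConst ^ 3) * L * ((V + U) ^ 2 * D)) +
        2 * (locConst * L * D) := by
        gcongr
        exact s4.trans e1
    _ = (16 * (convConst ^ 2 * locConst ^ 3)) * ((V + U) ^ 2 * (L * D)) +
        (2 * locConst) * (L * D) := by ring
    _ ≤ srcConst * ((V + U) ^ 2 * (L * D)) + srcConst * (L * D) := by
        gcongr
        · exact le_self_add
        · exact le_add_self
    _ = _ := by ring

/-! ### The contraction estimate and the choice of the time scale. -/

theorem duhamel_congr (t₀ : ℝ) (c : ℕ → ℂ) {H H' : ℕ → ℝ → ℂ} {n : ℕ}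
    (h : H n =ᵐ[volume] H' n) : duhamel t₀ c H n =ᵐ[volume] duhamel t₀ c H' n := by
  have h1 : undamp H n =ᵐ[volume] undamp H' n := by
    filter_upwards [h] with ξ hξ
    rw [undamp, undamp, hξ]
  filter_upwards [h1] with ξ hξ
  rw [duhamel, duhamel, hξ, Real.fourierInv_congr_ae h1]

theorem duhamel_sub (t₀ : ℝ) (c c' : ℕ → ℂ) {H H' : ℕ → ℝ → ℂ} (hH : ∀ n, Integrable (H n))
    (hH' : ∀ n, Integrable (H' n)) :
    duhamel t₀ c H - duhamel t₀ c' H' = duhamel t₀ (c - c') (H - H') := by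
  funext n ξ
  have e : undamp (H - H') n = undamp H n - undamp H' n := by
    funext ξ
    simp [undamp, sub_div]
  simp only [duhamel, Pi.sub_apply]
  rw [e, fourierInv_sub_apply (integrable_undamp hH n) (integrable_undamp hH' n)]
  simp only [Pi.sub_apply]
  ring

/-- The contraction estimate for the map `g ↦ duhamel t₀ c (source m l g)`. -/
theorem xn_duhamel_source_sub_le {t₀ : ℝ} (ht₀ : t₀ ≤ 1) (m : ℝ) {l : ℝ} (hl : 0 < l)
    (hl1 : l ≤ 1) (c c' : ℕ → ℂ) {g h : ℕ → ℝ → ℂ} (hg : ∀ n, Measurable (g n))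
    (hh : ∀ n, Measurable (h n)) (hg' : xn (9 / 8) g ≠ ∞) (hh' : xn (9 / 8) h ≠ ∞) :
    xn (9 / 8) (duhamel t₀ c (source m l g) - duhamel t₀ c' (source m l h)) ≤
      duhConst * (srcConst * ENNReal.ofReal (l ^ (1 / 8 : ℝ)) *
        (1 + (xn (9 / 8) g + xn (9 / 8) h) ^ 2) * xn (9 / 8) (g - h) +
        ∑' n, ‖c n - c' n‖ₑ ^ 2) := by
  have ig := integrable_of_xn hg hg'
  have ih := integrable_of_xn hh hh'
  rw [duhamel_sub t₀ c c' (integrable_source m hl ig) (integrable_source m hl ih),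
    xn_congr fun n => duhamel_congr t₀ (c - c') (source_sub_source m hl ig ih n)]
  have mgh : ∀ n, Measurable ((g - h) n) := fun n => (hg n).sub (hh n)
  refine (xn_duhamel_le ht₀ _ (measurable_diffSource m l mgh hg hh)).trans ?_
  gcongr
  · exact xn_diffSource_le m hl hl1 mgh hg hh
  · exact le_of_eq rfl

theorem exists_small_length {A : ℝ≥0∞} (hA : A ≠ ∞) :
    ∃ l : ℝ, 0 < l ∧ l ≤ 1 ∧ A * ENNReal.ofReal (l ^ (1 / 8 : ℝ)) ≤ 1 / 4 := by
  set ε : ℝ := 1 / (4 * (A.toReal + 1)) with hε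
  have hA0 : 0 ≤ A.toReal := ENNReal.toReal_nonneg
  have hε0 : 0 < ε := by positivity
  have hε1 : ε ≤ 1 := by
    rw [hε, div_le_one (by positivity)]
    linarith
  -- The eighth power undoes the exponent 1/8.
  refine ⟨ε ^ 8, by positivity, pow_le_one₀ hε0.le hε1, ?_⟩
  have h1 : (ε ^ 8) ^ (1 / 8 : ℝ) = ε := by
    rw [← Real.rpow_natCast, ← Real.rpow_mul hε0.le]
    norm_num
  rw [h1, ← ENNReal.ofReal_toReal hA, ← ENNReal.ofReal_mul hA0]
  have h2 : A.toReal * ε ≤ 1 / 4 := by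
    rw [hε, mul_one_div, div_le_div_iff₀ (by positivity) (by norm_num)]
    linarith
  refine (ENNReal.ofReal_le_ofReal h2).trans (le_of_eq ?_)
  rw [ENNReal.ofReal_div_of_pos (by norm_num)]
  norm_num

/-! ### The solution space -/

/-- The measure on `ℕ × ℝ` with density `wt ^ (9/8)`. -/
noncomputable def solMeasure : Measure (ℕ × ℝ) :=
  (Measure.count.prod volume).withDensity fun z => ENNReal.ofReal (wt z.1 z.2 ^ (9 / 8 : ℝ))

theorem measurable_wt_uncurry :
    Measurable fun z : ℕ × ℝ => ENNReal.ofReal (wt z.1 z.2 ^ (9 / 8 : ℝ)) := by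
  unfold wt
  have : Measurable fun z : ℕ × ℝ => (((z.1 : ℤ)) : ℝ) := by fun_prop
  fun_prop

theorem lintegral_solMeasure {f : ℕ × ℝ → ℝ≥0∞} (hf : Measurable f) :
    ∫⁻ z, f z ∂solMeasure =
      ∑' n : ℕ, ∫⁻ ξ, ENNReal.ofReal (wt n ξ ^ (9 / 8 : ℝ)) * f (n, ξ) := by
  have := measurable_wt_uncurry
  rw [solMeasure, lintegral_withDensity_eq_lintegral_mul _ this hf,
    lintegral_prod _ (by fun_prop), lintegral_count]
  rfl

theorem ae_of_ae_solMeasure {p : ℕ × ℝ → Prop} (h : ∀ᵐ z ∂solMeasure, p z) (n : ℕ) :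
    ∀ᵐ ξ : ℝ, p (n, ξ) := by
  rw [solMeasure, ae_withDensity_iff measurable_wt_uncurry] at h
  have h2 := Measure.ae_ae_of_ae_prod h
  rw [Measure.ae_count_iff] at h2
  filter_upwards [h2 n] with ξ hξ
  refine hξ ?_
  have := wt_pos n ξ
  simpa using Real.rpow_pos_of_pos this _

/-- The family of functions of an element of the solution space. -/
noncomputable def fam (f : Lp ℂ 2 solMeasure) (n : ℕ) (ξ : ℝ) : ℂ := f (n, ξ)

theorem measurable_fam (f : Lp ℂ 2 solMeasure) (n : ℕ) : Measurable (fam f n) :=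
  (Lp.stronglyMeasurable f).measurable.comp measurable_prodMk_left

theorem eLpNorm_uncurry_sq {g : ℕ → ℝ → ℂ} (hg : ∀ n, Measurable (g n)) :
    eLpNorm (fun z : ℕ × ℝ => g z.1 z.2) 2 solMeasure ^ 2 = xn (9 / 8) g := by
  have hm : Measurable fun z : ℕ × ℝ => g z.1 z.2 := measurable_from_prod_countable_right hg
  have h := eLpNorm_nnreal_pow_eq_lintegral (μ := solMeasure) (f := fun z : ℕ × ℝ => g z.1 z.2)
    (p := 2) (by norm_num)
  norm_num at h
  rw [h, lintegral_solMeasure (by fun_prop)]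
  rfl

theorem memLp_uncurry {g : ℕ → ℝ → ℂ} (hg : ∀ n, Measurable (g n)) (h : xn (9 / 8) g ≠ ∞) :
    MemLp (fun z : ℕ × ℝ => g z.1 z.2) 2 solMeasure := by
  have hm : Measurable fun z : ℕ × ℝ => g z.1 z.2 := measurable_from_prod_countable_right hg
  refine ⟨hm.aestronglyMeasurable, ?_⟩
  rw [lt_top_iff_ne_top]
  intro hc
  rw [← eLpNorm_uncurry_sq hg, hc] at h
  simp at h

theorem enorm_sq_eq_xn (f : Lp ℂ 2 solMeasure) : ‖f‖ₑ ^ 2 = xn (9 / 8) (fam f) := by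
  rw [Lp.enorm_def, ← eLpNorm_uncurry_sq (measurable_fam f)]
  rfl

theorem xn_fam_ne_top (f : Lp ℂ 2 solMeasure) : xn (9 / 8) (fam f) ≠ ∞ := by
  rw [← enorm_sq_eq_xn]
  simp

theorem fam_sub (f g : Lp ℂ 2 solMeasure) (n : ℕ) :
    fam (f - g) n =ᵐ[volume] (fam f - fam g) n := by
  filter_upwards [ae_of_ae_solMeasure (Lp.coeFn_sub f g) n] with ξ hξ
  exact hξ

theorem edist_sq_eq_xn (f g : Lp ℂ 2 solMeasure) :
    edist f g ^ 2 = xn (9 / 8) (fam f - fam g) := by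
  rw [edist_eq_enorm_sub, enorm_sq_eq_xn, xn_congr (fam_sub f g)]

theorem fam_toLp {g : ℕ → ℝ → ℂ} (h : MemLp (fun z : ℕ × ℝ => g z.1 z.2) 2 solMeasure) (n : ℕ) :
    fam (h.toLp _) n =ᵐ[volume] g n :=
  ae_of_ae_solMeasure h.coeFn_toLp n

theorem xn_zero (s : ℝ) : xn s 0 = 0 := by
  simp [xn]

theorem source_zero (m l : ℝ) : source m l 0 = 0 := by
  have h1 : loc m l 0 = 0 := by
    funext n
    simp [loc]
  funext n ξ
  simp [source, h1, tri, bconv]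

theorem duhamel_zero (t₀ : ℝ) : duhamel t₀ 0 0 = 0 := by
  have h : undamp 0 = 0 := by
    funext n ξ
    simp [undamp]
  funext n ξ
  simp [duhamel, h, fourierInv_eq_integral]

/-- Banach's theorem for g ↦ duhamel 0 c (source 0 l g) on the ball of squared radius M. The factor
1/4 is for squared norms, so the map contracts by 1/2; half of M is left for the data, which
explains the factor 2 in `hc`. -/
theorem exists_fixed_point {M : ℝ≥0∞} (hM : M ≠ ∞) {l : ℝ} (hl : 0 < l) (hl1 : l ≤ 1)
    (hs : duhConst * srcConst * (1 + (M + M) ^ 2) * ENNReal.ofReal (l ^ (1 / 8 : ℝ)) ≤ 1 / 4)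
    {c : ℕ → ℂ} (hc : 2 * duhConst * ∑' n, ‖c n‖ₑ ^ 2 ≤ M) :
    ∃ g : ℕ → ℝ → ℂ, (∀ n, Measurable (g n)) ∧ xn (9 / 8) g ≤ M ∧
      ∀ n, g n =ᵐ[volume] duhamel 0 c (source 0 l g) n := by
  have quarter : (1 / 4 : ℝ≥0∞) = (1 / 2) ^ 2 := by
    rw [one_div, one_div, ← ENNReal.inv_pow]; norm_num
  have key : ∀ (c c' : ℕ → ℂ) {g h : ℕ → ℝ → ℂ}, (∀ n, Measurable (g n)) →
      (∀ n, Measurable (h n)) → xn (9 / 8) g ≤ M → xn (9 / 8) h ≤ M →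
      xn (9 / 8) (duhamel 0 c (source 0 l g) - duhamel 0 c' (source 0 l h)) ≤
        1 / 4 * xn (9 / 8) (g - h) + duhConst * ∑' n, ‖c n - c' n‖ₑ ^ 2 := by
    intro c c' g h hg hh bg bh
    refine (xn_duhamel_source_sub_le zero_le_one 0 hl hl1 c c' hg hh
      (ne_top_of_le_ne_top hM bg) (ne_top_of_le_ne_top hM bh)).trans ?_
    rw [mul_add]
    refine add_le_add ?_ le_rfl
    calc _ ≤ duhConst * (srcConst * ENNReal.ofReal (l ^ (1 / 8 : ℝ)) * (1 + (M + M) ^ 2) *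
          xn (9 / 8) (g - h)) := by gcongr
      _ = duhConst * srcConst * (1 + (M + M) ^ 2) * ENNReal.ofReal (l ^ (1 / 8 : ℝ)) *
          xn (9 / 8) (g - h) := by ring
      _ ≤ _ := by gcongr
  -- The zero family with zero data is sent to zero, so the difference estimate against it bounds
  -- the image itself.
  have bound : ∀ {g : ℕ → ℝ → ℂ}, (∀ n, Measurable (g n)) → xn (9 / 8) g ≤ M →
      xn (9 / 8) (duhamel 0 c (source 0 l g)) ≤ M := by
    intro g hg bg
    have := key c 0 hg (h := 0) (fun _ => measurable_const) bg (by rw [xn_zero]; exact zero_le)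
    rw [source_zero, duhamel_zero, sub_zero, sub_zero] at this
    simp only [Pi.zero_apply, sub_zero] at this
    refine this.trans ?_
    have h2 : duhConst * ∑' n, ‖c n‖ₑ ^ 2 ≤ 1 / 2 * M := by
      calc duhConst * ∑' n, ‖c n‖ₑ ^ 2 = 1 / 2 * (2 * duhConst * ∑' n, ‖c n‖ₑ ^ 2) := by
            rw [one_div, ← mul_assoc, ← mul_assoc, ENNReal.inv_mul_cancel (by norm_num) (by simp),
              one_mul]
        _ ≤ _ := by gcongr
    calc 1 / 4 * xn (9 / 8) g + duhConst * ∑' n, ‖c n‖ₑ ^ 2 ≤ 1 / 2 * M + 1 / 2 * M := by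
          gcongr
          norm_num
      _ = M := by rw [← add_mul, ENNReal.add_halves, one_mul]
  have mem : ∀ f : Lp ℂ 2 solMeasure, MemLp
      (fun z : ℕ × ℝ => duhamel 0 c (source 0 l (fam f)) z.1 z.2) 2 solMeasure := by
    intro f
    have mf := measurable_fam f
    refine memLp_uncurry (measurable_duhamel 0 c (measurable_source 0 l mf)) ?_
    refine ne_top_of_le_ne_top ?_ (xn_duhamel_le zero_le_one c (measurable_source 0 l mf))
    have h1 := xn_diffSource_le 0 hl hl1 mf mf (u := 0) (fun _ => measurable_const)
    have h2 : xn (-(7 / 8)) (source 0 l (fam f)) =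
        xn (-(7 / 8)) (diffSource 0 l (fam f) (fam f) 0) := by
      refine xn_congr (fun n => ?_) _
      have := source_sub_source 0 hl (integrable_of_xn mf (xn_fam_ne_top f)) (h := 0)
        (fun _ => integrable_zero _ _ _) n
      rwa [source_zero, sub_zero, sub_zero] at this
    have h3 : xn (-(7 / 8)) (source 0 l (fam f)) ≠ ∞ := by
      rw [h2]
      refine ne_top_of_le_ne_top ?_ h1
      have := xn_fam_ne_top f
      have := srcConst_ne_top
      rw [xn_zero]
      finiteness
    have h4 : ∑' n, ‖c n‖ₑ ^ 2 ≠ ∞ := by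
      intro h
      rw [h, ENNReal.mul_top] at hc
      · exact hM (top_le_iff.1 hc)
      · rw [duhConst]; simp
    have := duhConst_ne_top
    finiteness
  set Φ : Lp ℂ 2 solMeasure → Lp ℂ 2 solMeasure := fun f => (mem f).toLp _ with hΦ
  have famΦ : ∀ f n, fam (Φ f) n =ᵐ[volume] duhamel 0 c (source 0 l (fam f)) n :=
    fun f n => fam_toLp (mem f) n
  set s : Set (Lp ℂ 2 solMeasure) := {f | ‖f‖ₑ ^ 2 ≤ M} with hs'
  have hsc : IsComplete s := by
    refine IsClosed.isComplete (isClosed_le ?_ continuous_const)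
    exact (ENNReal.continuous_pow 2).comp continuous_enorm
  have maps : MapsTo Φ s s := by
    intro f hf
    change ‖f‖ₑ ^ 2 ≤ M at hf
    change ‖Φ f‖ₑ ^ 2 ≤ M
    rw [enorm_sq_eq_xn] at hf ⊢
    rw [xn_congr (famΦ f)]
    exact bound (measurable_fam f) hf
  have contr : ContractingWith (1 / 2) (maps.restrict Φ s s) := by
    refine ⟨by rw [← NNReal.coe_lt_coe]; norm_num, fun f g => ?_⟩
    have hf : xn (9 / 8) (fam f) ≤ M := by rw [← enorm_sq_eq_xn]; exact f.2
    have hg : xn (9 / 8) (fam g) ≤ M := by rw [← enorm_sq_eq_xn]; exact g.2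
    have h1 := key c c (measurable_fam f) (measurable_fam g) hf hg
    simp only [sub_self, enorm_zero, ne_eq, OfNat.ofNat_ne_zero, not_false_eq_true, zero_pow,
      tsum_zero, mul_zero, add_zero] at h1
    have h2 : edist (Φ f) (Φ g) ^ 2 ≤ (1 / 2 * edist (f : Lp ℂ 2 solMeasure) g) ^ 2 := by
      rw [mul_pow, ← quarter, edist_sq_eq_xn, edist_sq_eq_xn]
      refine le_trans (le_of_eq (xn_congr (fun n => ?_) _)) h1
      exact (famΦ f n).sub (famΦ g n)
    have h3 := (ENNReal.pow_le_pow_left_iff two_ne_zero).1 h2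
    have e : ((1 / 2 : ℝ≥0) : ℝ≥0∞) = 1 / 2 := by norm_num
    rw [e]
    exact h3
  obtain ⟨f, hf, hfix, -⟩ := contr.exists_fixedPoint' hsc maps (x := 0)
    (by change ‖(0 : Lp ℂ 2 solMeasure)‖ₑ ^ 2 ≤ M; simp) (edist_ne_top _ _)
  refine ⟨fam f, measurable_fam f, ?_, fun n => ?_⟩
  · rw [← enorm_sq_eq_xn]
    exact hf
  · have := famΦ f n
    rwa [hfix] at this

theorem xn_sub_le_of_fixed_point {M : ℝ≥0∞} (hM : M ≠ ∞) {l : ℝ} (hl : 0 < l) (hl1 : l ≤ 1)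
    (hs : duhConst * srcConst * (1 + (M + M) ^ 2) * ENNReal.ofReal (l ^ (1 / 8 : ℝ)) ≤ 1 / 4)
    {c c' : ℕ → ℂ} {g h : ℕ → ℝ → ℂ} (mg : ∀ n, Measurable (g n)) (mh : ∀ n, Measurable (h n))
    (bg : xn (9 / 8) g ≤ M) (bh : xn (9 / 8) h ≤ M)
    (eg : ∀ n, g n =ᵐ[volume] duhamel 0 c (source 0 l g) n)
    (eh : ∀ n, h n =ᵐ[volume] duhamel 0 c' (source 0 l h) n) :
    xn (9 / 8) (g - h) ≤ 2 * duhConst * ∑' n, ‖c n - c' n‖ₑ ^ 2 := by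
  have h1 := xn_duhamel_source_sub_le zero_le_one 0 hl hl1 c c' mg mh
    (ne_top_of_le_ne_top hM bg) (ne_top_of_le_ne_top hM bh)
  have e : xn (9 / 8) (g - h) =
      xn (9 / 8) (duhamel 0 c (source 0 l g) - duhamel 0 c' (source 0 l h)) :=
    xn_congr (fun n => (eg n).sub (eh n)) _
  rw [← e] at h1
  -- Finiteness is needed to absorb half of the difference norm into the left side below.
  have hfin : xn (9 / 8) (g - h) ≠ ∞ := by
    have h2 := xn_add_le (9 / 8) (g := g) (h := fun n ξ => -1 * h n ξ) mg
    rw [xn_const_mul] at h2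
    have e : g + (fun n ξ => -1 * h n ξ) = g - h := by
      funext n ξ
      simp [sub_eq_add_neg]
    rw [e] at h2
    refine ne_top_of_le_ne_top ?_ h2
    have := ne_top_of_le_ne_top hM bg
    have := ne_top_of_le_ne_top hM bh
    finiteness
  set X := xn (9 / 8) (g - h)
  set S := ∑' n, ‖c n - c' n‖ₑ ^ 2
  have h2 : X ≤ 1 / 2 * X + duhConst * S := by
    refine h1.trans ?_
    rw [mul_add]
    refine add_le_add ?_ le_rfl
    calc _ ≤ duhConst * (srcConst * ENNReal.ofReal (l ^ (1 / 8 : ℝ)) * (1 + (M + M) ^ 2) * X) := by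
          gcongr
      _ = duhConst * srcConst * (1 + (M + M) ^ 2) * ENNReal.ofReal (l ^ (1 / 8 : ℝ)) * X := by ring
      _ ≤ 1 / 4 * X := by gcongr
      _ ≤ _ := by gcongr; norm_num
  have h3 : 1 / 2 * X + 1 / 2 * X = X := by rw [← add_mul, ENNReal.add_halves, one_mul]
  have h4 : 1 / 2 * X ≤ duhConst * S := by
    have hf : 1 / 2 * X ≠ ∞ := by finiteness
    nth_rewrite 1 [← h3] at h2
    exact (ENNReal.add_le_add_iff_left hf).1 h2
  calc X = 1 / 2 * X + 1 / 2 * X := h3.symm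
    _ ≤ duhConst * S + duhConst * S := by gcongr
    _ = _ := by ring

/-! ### The equation for the coefficients -/

/-- The coefficients at time `t` of a family. -/
noncomputable def coef (g : ℕ → ℝ → ℂ) (t : ℝ) (n : ℕ) : ℂ := 𝓕⁻ (g n) t

/-- The Cauchy product of three copies of a sequence. -/
def cubic (a : ℕ → ℂ) : ℕ → ℂ := sconv (sconv a a) a

theorem sconv_sub_left (a a' b : ℕ → ℂ) : sconv (a - a') b = sconv a b - sconv a' b := by
  funext n
  simp [sconv, sub_mul]

theorem sconv_sub_right (a b b' : ℕ → ℂ) : sconv a (b - b') = sconv a b - sconv a b' := by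
  funext n
  simp [sconv, mul_sub]

theorem cubic_sub_cubic (a b : ℕ → ℂ) :
    cubic a - cubic b = sconv (sconv (a - b) a) a + sconv (sconv b (a - b)) a +
      sconv (sconv b b) (a - b) := by
  simp only [cubic, sconv_sub_left, sconv_sub_right]
  abel

theorem continuous_coef {g : ℕ → ℝ → ℂ} (hg : ∀ n, Integrable (g n)) (n : ℕ) :
    Continuous fun t => coef g t n := continuous_fourierInv (hg n)

theorem continuous_cubic_coef {g : ℕ → ℝ → ℂ} (hg : ∀ n, Integrable (g n)) (n : ℕ) :
    Continuous fun t => cubic (coef g t) n := by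
  have h := continuous_coef hg
  simp only [cubic, sconv]
  fun_prop

theorem coef_sub {g h : ℕ → ℝ → ℂ} (hg : ∀ n, Integrable (g n)) (hh : ∀ n, Integrable (h n))
    (t : ℝ) : coef (g - h) t = coef g t - coef h t :=
  funext fun n => fourierInv_sub_apply (hg n) (hh n) t

theorem coef_loc {m l t : ℝ} (hl : 0 < l) (ht : |t - m| ≤ 2 * l) {g : ℕ → ℝ → ℂ}
    (hg : ∀ n, Integrable (g n)) : coef (loc m l g) t = coef g t :=
  funext fun n => fourierInv_loc hl ht hg n

theorem coef_tri {g₁ g₂ g₃ : ℕ → ℝ → ℂ} (h₁ : ∀ n, Integrable (g₁ n))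
    (h₂ : ∀ n, Integrable (g₂ n)) (h₃ : ∀ n, Integrable (g₃ n)) (t : ℝ) :
    coef (tri g₁ g₂ g₃) t = sconv (sconv (coef g₁ t) (coef g₂ t)) (coef g₃ t) :=
  funext fun n => fourierInv_tri h₁ h₂ h₃ n t

theorem coef_source {m l t : ℝ} (hl : 0 < l) (ht : |t - m| ≤ 2 * l) {g : ℕ → ℝ → ℂ}
    (hg : ∀ n, Integrable (g n)) (n : ℕ) :
    coef (source m l g) t n = -Complex.I * cubic (coef g t) n + coef g t n := by
  have h := integrable_loc m hl hg
  have e := fourierInv_add_apply ((integrable_tri h h h n).const_mul (-Complex.I)) (h n) t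
  rw [fourierInv_const_mul_apply] at e
  refine e.trans ?_
  change -Complex.I * coef (tri _ _ _) t n + coef (loc m l g) t n = _
  rw [coef_tri h h h, coef_loc hl ht hg, cubic]

theorem coef_diffSource {m l t : ℝ} (hl : 0 < l) (ht : |t - m| ≤ 2 * l) {d v u : ℕ → ℝ → ℂ}
    (hd : ∀ n, Integrable (d n)) (hv : ∀ n, Integrable (v n)) (hu : ∀ n, Integrable (u n))
    (h : coef d t = coef v t - coef u t) (n : ℕ) :
    coef (diffSource m l d v u) t n =
      -Complex.I * (cubic (coef v t) n - cubic (coef u t) n) + coef d t n := by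
  have id := integrable_loc m hl hd
  have iv := integrable_loc m hl hv
  have iu := integrable_loc m hl hu
  have e := fourierInv_add_apply ((integrable_triDiff m hl hd hv hu n).const_mul (-Complex.I))
    (id n) t
  rw [fourierInv_const_mul_apply] at e
  have e2 : 𝓕⁻ (triDiff m l d v u n) t = cubic (coef v t) n - cubic (coef u t) n := by
    have i1 := integrable_tri id iv iv n
    have i2 := integrable_tri iu id iv n
    have i3 := integrable_tri iu iu id n
    have a1 := fourierInv_add_apply (i1.add i2) i3 t
    rw [fourierInv_add_apply i1 i2] at a1
    refine a1.trans ?_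
    change coef (tri _ _ _) t n + coef (tri _ _ _) t n + coef (tri _ _ _) t n = _
    rw [coef_tri id iv iv, coef_tri iu id iv, coef_tri iu iu id, coef_loc hl ht hd,
      coef_loc hl ht hv, coef_loc hl ht hu, h]
    exact (congrFun (cubic_sub_cubic (coef v t) (coef u t)) n).symm
  refine e.trans ?_
  rw [e2]
  change _ + coef (loc m l d) t n = _
  rw [coef_loc hl ht hd]

/-- The coefficients of `g` solve the equation on `J`. -/
def SolvesOn (J : Set ℝ) (g : ℕ → ℝ → ℂ) : Prop :=
  ∀ t ∈ J, ∀ n, HasDerivWithinAt (fun s => coef g s n)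
    (-(Complex.I * (n * (n + 1))) * coef g t n - Complex.I * cubic (coef g t) n) J t

theorem SolvesOn.mono {J J' : Set ℝ} {g : ℕ → ℝ → ℂ} (h : SolvesOn J g) (hJ : J' ⊆ J) :
    SolvesOn J' g := fun t ht n => (h t (hJ ht) n).mono hJ

/-- On [-l, l] the cutoffs equal 1, so the source has coefficients -i a∗a∗a + a and the extra a
cancels the damping. Since l ≤ 1, the interval lies inside (-2, 2), where the free waves are exact.
-/
theorem solvesOn_of_fixed_point {l : ℝ} (hl : 0 < l) (hl1 : l ≤ 1) {c : ℕ → ℂ}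
    {g : ℕ → ℝ → ℂ} (mg : ∀ n, Measurable (g n)) (hg : xn (9 / 8) g ≠ ∞)
    (e : ∀ n, g n =ᵐ[volume] duhamel 0 c (source 0 l g) n) :
    coef g 0 = c ∧ SolvesOn (Icc (-l) l) g := by
  have ig := integrable_of_xn mg hg
  have is := integrable_source 0 hl ig
  have ec : ∀ n, 𝓕⁻ (g n) = 𝓕⁻ (duhamel 0 c (source 0 l g) n) := fun n =>
    funext fun t => Real.fourierInv_congr_ae (e n) t
  constructor
  · funext n
    rw [coef, ec n, fourierInv_duhamel_self (by norm_num) c is]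
  · intro t ht n
    have h := hasDerivAt_fourierInv_duhamel 0 c is n (t := t)
      ⟨by linarith [ht.1], by linarith [ht.2]⟩
    rw [← ec n] at h
    have hs : 𝓕⁻ (source 0 l g n) t = _ := coef_source (m := 0) hl
      (by rw [sub_zero]; exact (abs_le.2 ht).trans (by linarith)) ig n
    rw [hs] at h
    refine (h.congr_deriv ?_).hasDerivWithinAt
    simp only [coef]
    ring

theorem eqOn_zero_of_linear {J : Set ℝ} (hJ : Convex ℝ J) {κ : ℂ} {e : ℝ → ℂ} {t₀ : ℝ}
    (ht₀ : t₀ ∈ J) (he : ∀ t ∈ J, HasDerivWithinAt e (-κ * e t) J t) (h0 : e t₀ = 0)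
    {t : ℝ} (ht : t ∈ J) : e t = 0 := by
  have hd : ∀ s ∈ J, HasDerivWithinAt (fun s : ℝ => Complex.exp (κ * s) * e s) 0 J s := by
    intro s hs
    have h1 : HasDerivAt (fun s : ℝ => κ * (s : ℂ)) κ s := by
      simpa using (Complex.ofRealCLM.hasDerivAt (x := s)).const_mul κ
    refine (h1.cexp.hasDerivWithinAt.mul (he s hs)).congr_deriv ?_
    ring
  have := hJ.norm_image_sub_le_of_norm_hasDerivWithin_le (C := 0) hd (by simp) ht₀ ht
  rw [h0, mul_zero, sub_zero, zero_mul, norm_le_zero_iff] at this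
  exact (mul_eq_zero.1 this).resolve_left (Complex.exp_ne_zero _)

theorem enorm_coef_sq_le {g : ℕ → ℝ → ℂ} (mg : ∀ n, Measurable (g n)) (t : ℝ) (n : ℕ) :
    ‖coef g t n‖ₑ ^ 2 ≤ l1Const * xn (9 / 8) g := by
  calc ‖coef g t n‖ₑ ^ 2 ≤ (∫⁻ ξ, ‖g n ξ‖ₑ) ^ 2 := by gcongr; exact norm_fourierInv_le _ _
    _ ≤ _ := (ENNReal.le_tsum n).trans (tsum_lintegral_enorm_sq_le mg)

theorem tsum_enorm_coef_sq_le {g : ℕ → ℝ → ℂ} (mg : ∀ n, Measurable (g n)) (t : ℝ) :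
    ∑' n, ‖coef g t n‖ₑ ^ 2 ≤ l1Const * xn (9 / 8) g := by
  refine le_trans (ENNReal.tsum_le_tsum fun n => ?_) (tsum_lintegral_enorm_sq_le mg)
  gcongr
  exact norm_fourierInv_le _ _

/-- Dominated convergence over the degrees: each term is continuous in time, and the L¹ norms of the
g n are square summable. -/
theorem tendsto_tsum_enorm_coef_sub_sq {g : ℕ → ℝ → ℂ} (mg : ∀ n, Measurable (g n))
    (hg : xn (9 / 8) g ≠ ∞) (t : ℝ) :
    Tendsto (fun s => ∑' n, ‖coef g s n - coef g t n‖ₑ ^ 2) (𝓝 t) (𝓝 0) := by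
  have ig := integrable_of_xn mg hg
  have h := tendsto_lintegral_filter_of_dominated_convergence (μ := Measure.count) (l := 𝓝 t)
    (F := fun s n => ‖coef g s n - coef g t n‖ₑ ^ 2) (f := fun _ => 0)
    (fun n => 4 * (∫⁻ ξ, ‖g n ξ‖ₑ) ^ 2)
    (Eventually.of_forall fun s => measurable_of_countable _)
    (Eventually.of_forall fun s => Eventually.of_forall fun n => ?_) ?_
    (Eventually.of_forall fun n => ?_)
  · simpa [lintegral_count] using h
  · have h1 := enorm_add_sq_le (coef g s n) (-coef g t n)
    rw [← sub_eq_add_neg, enorm_neg] at h1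
    refine h1.trans ?_
    calc _ ≤ 2 * (∫⁻ ξ, ‖g n ξ‖ₑ) ^ 2 + 2 * (∫⁻ ξ, ‖g n ξ‖ₑ) ^ 2 := by
          gcongr <;> exact norm_fourierInv_le _ _
      _ = _ := by ring
  · rw [lintegral_count, ENNReal.tsum_mul_left]
    have h1 := ne_top_of_le_ne_top (ENNReal.mul_ne_top l1Const_ne_top hg)
      (tsum_lintegral_enorm_sq_le mg)
    finiteness
  · have h1 : Tendsto (fun s => coef g s n - coef g t n) (𝓝 t) (𝓝 0) := by
      have := ((continuous_coef ig n).tendsto t).sub_const (coef g t n)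
      simpa using this
    have h2 := ((ENNReal.continuous_pow 2).tendsto _).comp (continuous_enorm.tendsto _ |>.comp h1)
    simpa [Function.comp_def] using h2

/-- The family v - u need not be small, and it satisfies no equation outside the interval. On the
interval, however, its coefficients depend only on the source, so any family d with these
coefficients can be replaced by `duhamel t₀ 0 (diffSource t₀ l d v u)`, which has the same
coefficients there and a quarter of the squared norm. Iteration forces the coefficients to vanish.
-/
theorem coef_eq_of_close {M : ℝ≥0∞} {l : ℝ} (hl : 0 < l) (hl1 : l ≤ 1)
    (hs : duhConst * srcConst * (1 + (M + M) ^ 2) * ENNReal.ofReal (l ^ (1 / 8 : ℝ)) ≤ 1 / 4)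
    (hM : M ≠ ∞) {v u : ℕ → ℝ → ℂ} (mv : ∀ n, Measurable (v n)) (mu : ∀ n, Measurable (u n))
    (bv : xn (9 / 8) v ≤ M) (bu : xn (9 / 8) u ≤ M) {t₀ t₁ : ℝ}
    (hJ : uIcc t₀ t₁ ⊆ Icc (-1) 1) (hclose : |t₁ - t₀| ≤ l) (sv : SolvesOn (uIcc t₀ t₁) v)
    (su : SolvesOn (uIcc t₀ t₁) u) (h0 : coef v t₀ = coef u t₀) : coef v t₁ = coef u t₁ := by
  have hv := ne_top_of_le_ne_top hM bv
  have hu := ne_top_of_le_ne_top hM bu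
  have iv := integrable_of_xn mv hv
  have iu := integrable_of_xn mu hu
  have hfin : xn (9 / 8) (v - u) ≠ ∞ := by
    have h2 := xn_add_le (9 / 8) (g := v) (h := fun n ξ => -1 * u n ξ) mv
    rw [xn_const_mul] at h2
    have e : v + (fun n ξ => -1 * u n ξ) = v - u := by
      funext n ξ
      simp [sub_eq_add_neg]
    rw [e] at h2
    refine ne_top_of_le_ne_top ?_ h2
    finiteness
  have t₀J : t₀ ∈ uIcc t₀ t₁ := left_mem_uIcc
  have t₁J : t₁ ∈ uIcc t₀ t₁ := right_mem_uIcc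
  have step : ∀ d : ℕ → ℝ → ℂ, (∀ n, Measurable (d n)) → xn (9 / 8) d ≠ ∞ →
      (∀ t ∈ uIcc t₀ t₁, coef d t = coef v t - coef u t) →
      ∃ d' : ℕ → ℝ → ℂ, (∀ n, Measurable (d' n)) ∧ xn (9 / 8) d' ≤ 1 / 4 * xn (9 / 8) d ∧
        ∀ t ∈ uIcc t₀ t₁, coef d' t = coef v t - coef u t := by
    intro d md hd ed
    have id := integrable_of_xn md hd
    have iS := integrable_diffSource t₀ hl id iv iu
    refine ⟨duhamel t₀ 0 (diffSource t₀ l d v u),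
      measurable_duhamel _ _ (measurable_diffSource t₀ l md mv mu), ?_, ?_⟩
    · refine (xn_duhamel_le (hJ t₀J).2 _ (measurable_diffSource t₀ l md mv mu)).trans ?_
      simp only [Pi.zero_apply, enorm_zero, ne_eq, OfNat.ofNat_ne_zero, not_false_eq_true,
        zero_pow, tsum_zero, add_zero]
      calc _ ≤ duhConst * (srcConst * ENNReal.ofReal (l ^ (1 / 8 : ℝ)) * (1 + (M + M) ^ 2) *
            xn (9 / 8) d) := by
            gcongr
            refine (xn_diffSource_le t₀ hl hl1 md mv mu).trans ?_
            gcongr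
        _ = duhConst * srcConst * (1 + (M + M) ^ 2) * ENNReal.ofReal (l ^ (1 / 8 : ℝ)) *
            xn (9 / 8) d := by ring
        _ ≤ _ := by gcongr
    · intro t ht
      funext n
      -- The nonlinear terms of the new representative and of v - u agree on the interval, so their
      -- discrepancy solves the homogeneous damped equation with value 0 at t₀.
      have key := eqOn_zero_of_linear (convex_uIcc t₀ t₁) (κ := 1 + Complex.I * (n * (n + 1)))
        (e := fun s => coef (duhamel t₀ 0 (diffSource t₀ l d v u)) s n -
          (coef v s n - coef u s n)) t₀J (fun s hs => ?_) ?_ ht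
      · exact sub_eq_zero.1 key
      · have hsJ := hJ hs
        have h1 := (hasDerivAt_fourierInv_duhamel t₀ 0 iS n (t := s)
          ⟨by linarith [hsJ.1], by linarith [hsJ.2]⟩).hasDerivWithinAt (s := uIcc t₀ t₁)
        have h2 : 𝓕⁻ (diffSource t₀ l d v u n) s = _ := coef_diffSource (m := t₀) (t := s) hl
          ((abs_sub_left_of_mem_uIcc hs).trans (hclose.trans (by linarith))) id iv iu (ed s hs) n
        rw [h2] at h1
        refine (h1.sub ((sv s hs n).sub (su s hs n))).congr_deriv ?_
        rw [ed s hs]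
        simp only [coef, Pi.sub_apply]
        ring
      · have h1 : coef (duhamel t₀ 0 (diffSource t₀ l d v u)) t₀ n = 0 :=
          fourierInv_duhamel_self (Icc_subset_Icc (by norm_num) (by norm_num) (hJ t₀J)) 0 iS n
        simp only [h1, h0]
        ring
  have iter : ∀ k : ℕ, ∃ d : ℕ → ℝ → ℂ, (∀ n, Measurable (d n)) ∧
      xn (9 / 8) d ≤ (1 / 4) ^ k * xn (9 / 8) (v - u) ∧
        ∀ t ∈ uIcc t₀ t₁, coef d t = coef v t - coef u t := by
    intro k
    induction k with
    | zero =>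
      exact ⟨v - u, fun n => (mv n).sub (mu n), by simp, fun t _ => coef_sub iv iu t⟩
    | succ k ih =>
      obtain ⟨d, md, bd, ed⟩ := ih
      have hd : xn (9 / 8) d ≠ ∞ := by
        refine ne_top_of_le_ne_top ?_ bd
        finiteness
      obtain ⟨d', md', bd', ed'⟩ := step d md hd ed
      refine ⟨d', md', bd'.trans ?_, ed'⟩
      rw [pow_succ', mul_assoc]
      gcongr
  funext n
  have small : ∀ k : ℕ, ‖coef v t₁ n - coef u t₁ n‖ₑ ^ 2 ≤
      (1 / 4) ^ k * (l1Const * xn (9 / 8) (v - u)) := by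
    intro k
    obtain ⟨d, md, bd, ed⟩ := iter k
    have h1 := enorm_coef_sq_le md t₁ n
    rw [ed t₁ t₁J] at h1
    refine h1.trans ?_
    calc _ ≤ l1Const * ((1 / 4) ^ k * xn (9 / 8) (v - u)) := by gcongr
      _ = _ := by ring
  have lim : Tendsto (fun k : ℕ => (1 / 4 : ℝ≥0∞) ^ k * (l1Const * xn (9 / 8) (v - u))) atTop
      (𝓝 0) := by
    have h1 : Tendsto (fun k : ℕ => (1 / 4 : ℝ≥0∞) ^ k) atTop (𝓝 0) :=
      ENNReal.tendsto_pow_atTop_nhds_zero_of_lt_one (by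
        rw [one_div]
        exact ENNReal.inv_lt_one.2 (by norm_num))
    have := ENNReal.Tendsto.mul_const h1 (b := l1Const * xn (9 / 8) (v - u))
      (Or.inr (ENNReal.mul_ne_top l1Const_ne_top hfin))
    simpa using this
  have hz : ‖coef v t₁ n - coef u t₁ n‖ₑ ^ 2 = 0 :=
    le_antisymm (ge_of_tendsto' lim small) zero_le
  exact sub_eq_zero.1 (enorm_eq_zero.1 (pow_eq_zero_iff two_ne_zero |>.1 hz))

/-- Uniqueness for the coefficients. -/
theorem coef_eq_of_solvesOn {v u : ℕ → ℝ → ℂ} (mv : ∀ n, Measurable (v n))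
    (mu : ∀ n, Measurable (u n)) (hv : xn (9 / 8) v ≠ ∞) (hu : xn (9 / 8) u ≠ ∞) {α β : ℝ}
    (hα : -1 ≤ α) (hβ : β ≤ 1) (h0J : (0 : ℝ) ∈ Icc α β) (sv : SolvesOn (Icc α β) v)
    (su : SolvesOn (Icc α β) u) (h0 : coef v 0 = coef u 0) {t : ℝ} (ht : t ∈ Icc α β) :
    coef v t = coef u t := by
  set M := xn (9 / 8) v + xn (9 / 8) u
  have hM : M ≠ ∞ := ENNReal.add_ne_top.2 ⟨hv, hu⟩
  obtain ⟨l, hl, hl1, hs⟩ := exists_small_length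
    (A := duhConst * srcConst * (1 + (M + M) ^ 2)) (by
      have := duhConst_ne_top
      have := srcConst_ne_top
      finiteness)
  -- The admissible step l depends only on the norms of the two families, not on the starting time.
  -- Hence N equal steps lead from 0 to t.
  obtain ⟨N, hN⟩ := exists_nat_gt (|t| / l)
  have hN0 : (0 : ℝ) < N := (by positivity : 0 ≤ |t| / l).trans_lt hN
  have mem : ∀ k : ℕ, k ≤ N → (k / N * t : ℝ) ∈ Icc α β := by
    intro k hk
    have h1 : (k / N : ℝ) ≤ 1 := by
      rw [div_le_one hN0]
      exact_mod_cast hk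
    have := (convex_Icc α β).smul_mem_of_zero_mem h0J ht
      (t := (k / N : ℝ)) ⟨by positivity, h1⟩
    simpa using this
  have main : ∀ k : ℕ, k ≤ N → coef v (k / N * t) = coef u (k / N * t) := by
    intro k
    induction k with
    | zero => intro _; simpa using h0
    | succ k ih =>
      intro hk
      have hsub : uIcc (k / N * t : ℝ) ((k + 1 : ℕ) / N * t) ⊆ Icc α β :=
        uIcc_subset_Icc (mem k (by omega)) (mem (k + 1) hk)
      refine coef_eq_of_close hl hl1 hs hM mv mu le_self_add le_add_self
        (hsub.trans (Icc_subset_Icc hα hβ)) ?_ (sv.mono hsub) (su.mono hsub) (ih (by omega))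
      have e : ((k + 1 : ℕ) / N * t - k / N * t : ℝ) = t / N := by
        push_cast
        ring
      rw [e, abs_div, abs_of_pos hN0, div_le_iff₀ hN0]
      rw [div_lt_iff₀ hl] at hN
      linarith
  have := main N le_rfl
  rwa [div_self hN0.ne', one_mul] at this

/-! ### The integral equation -/

theorem solvesOn_of_duhamel {J : Set ℝ} {g : ℕ → ℝ → ℂ} (hg : ∀ n, Integrable (g n))
    {c : ℕ → ℂ} (h : ∀ t ∈ J, ∀ n : ℕ, coef g t n =
      Complex.exp (-Complex.I * ((t * (n * (n + 1)) : ℝ) : ℂ)) * c n - Complex.I *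
        ∫ s in (0 : ℝ)..t, Complex.exp (-Complex.I * (((t - s) * (n * (n + 1)) : ℝ) : ℂ)) *
          cubic (coef g s) n) : SolvesOn J g := by
  intro t ht n
  set μ : ℂ := Complex.I * (n * (n + 1)) with hμ
  have hN := continuous_cubic_coef hg n
  have e : ∀ t : ℝ, Complex.exp (-Complex.I * ((t * (n * (n + 1)) : ℝ) : ℂ)) * c n - Complex.I *
      ∫ s in (0 : ℝ)..t, Complex.exp (-Complex.I * (((t - s) * (n * (n + 1)) : ℝ) : ℂ)) *
        cubic (coef g s) n = Complex.exp (-μ * t) * (c n - Complex.I *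
          ∫ s in (0 : ℝ)..t, Complex.exp (μ * s) * cubic (coef g s) n) := by
    intro t
    have e1 : ∀ s : ℝ, Complex.exp (-Complex.I * (((t - s) * (n * (n + 1)) : ℝ) : ℂ)) *
        cubic (coef g s) n = Complex.exp (-μ * t) * (Complex.exp (μ * s) * cubic (coef g s) n) := by
      intro s
      rw [← mul_assoc (Complex.exp _) (Complex.exp _), ← Complex.exp_add, hμ]
      congr 2
      push_cast
      ring
    simp_rw [e1]
    rw [intervalIntegral.integral_const_mul, mul_sub]
    have e2 : -Complex.I * ((t * (n * (n + 1)) : ℝ) : ℂ) = -μ * t := by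
      rw [hμ]
      push_cast
      ring
    rw [e2]
    ring
  have hc : Continuous fun s : ℝ => Complex.exp (μ * s) * cubic (coef g s) n := by fun_prop
  have d1 : HasDerivAt (fun t : ℝ => ∫ s in (0 : ℝ)..t, Complex.exp (μ * s) * cubic (coef g s) n)
      (Complex.exp (μ * t) * cubic (coef g t) n) t :=
    (hc.integral_hasStrictDerivAt 0 t).hasDerivAt
  have d2 : HasDerivAt (fun s : ℝ => -μ * (s : ℂ)) (-μ) t := by
    simpa using (Complex.ofRealCLM.hasDerivAt (x := t)).const_mul (-μ)
  have d3 := d2.cexp.mul ((d1.const_mul Complex.I).const_sub (c n))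
  have hval : coef g t n = _ := (h t ht n).trans (e t)
  refine (d3.hasDerivWithinAt.congr_deriv ?_).congr (fun s hs => (h s hs n).trans (e s)) hval
  rw [hval]
  have hexp : Complex.exp (-μ * t) * Complex.exp (μ * t) = 1 := by
    rw [← Complex.exp_add]
    simp
  linear_combination (-Complex.I * cubic (coef g t) n) * hexp

theorem duhamel_of_solvesOn {α β : ℝ} {g : ℕ → ℝ → ℂ} (hg : ∀ n, Integrable (g n))
    (h0 : (0 : ℝ) ∈ Icc α β) (h : SolvesOn (Icc α β) g) {t : ℝ} (ht : t ∈ Icc α β) (n : ℕ) :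
    coef g t n = Complex.exp (-Complex.I * ((t * (n * (n + 1)) : ℝ) : ℂ)) * coef g 0 n -
      Complex.I * ∫ s in (0 : ℝ)..t,
        Complex.exp (-Complex.I * (((t - s) * (n * (n + 1)) : ℝ) : ℂ)) * cubic (coef g s) n := by
  have hN := continuous_cubic_coef hg n
  have hC := continuous_coef hg n
  have hsub : uIcc 0 t ⊆ Icc α β := uIcc_subset_Icc h0 ht
  set E : ℝ → ℂ := fun s => Complex.exp (-Complex.I * (((t - s) * (n * (n + 1)) : ℝ) : ℂ)) with hE
  have hEc : Continuous E := by fun_prop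
  have d : ∀ s ∈ uIcc 0 t, HasDerivWithinAt (fun s => E s * coef g s n)
      (-Complex.I * (E s * cubic (coef g s) n)) (uIcc 0 t) s := by
    intro s hs
    have d1 : HasDerivAt (fun s : ℝ => -Complex.I * (((t - s) * (n * (n + 1)) : ℝ) : ℂ))
        (Complex.I * (n * (n + 1))) s := by
      have := (((hasDerivAt_id s).const_sub t).mul_const ((n : ℝ) * (n + 1))).ofReal_comp.const_mul
        (-Complex.I)
      refine this.congr_deriv ?_
      push_cast
      ring
    refine (d1.cexp.hasDerivWithinAt.mul ((h.mono hsub) s hs n)).congr_deriv ?_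
    ring
  have ftc := intervalIntegral.integral_eq_sub_of_hasDeriv_right (a := 0) (b := t)
    (f := fun s => E s * coef g s n) (f' := fun s => -Complex.I * (E s * cubic (coef g s) n))
    (by fun_prop) (fun s hs => ?_) (by
      have : Continuous fun s => -Complex.I * (E s * cubic (coef g s) n) := by fun_prop
      exact this.intervalIntegrable _ _)
  · rw [intervalIntegral.integral_const_mul] at ftc
    have e1 : E t = 1 := by simp [hE]
    have e0 : E 0 = Complex.exp (-Complex.I * ((t * (n * (n + 1)) : ℝ) : ℂ)) := by simp [hE]
    rw [e1, e0] at ftc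
    linear_combination -ftc
  · have hs' : s ∈ uIcc 0 t := ⟨hs.1.le, hs.2.le⟩
    exact ((d s hs').hasDerivAt (Icc_mem_nhds hs.1 hs.2)).hasDerivWithinAt

/-! ### The Fourier transform on `L²` -/

section

variable {F G : Type*} [NormedAddCommGroup F] [InnerProductSpace ℂ F] [CompleteSpace F]
  [NormedAddCommGroup G] [InnerProductSpace ℂ G] [CompleteSpace G]

omit [CompleteSpace F] in
theorem integrable_schwartz_smul (φ : SchwartzMap ℝ ℂ) (f : Lp F 2 (volume : Measure ℝ)) :
    Integrable fun t => φ t • f t := by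
  have h : MemLp (fun t => φ t • f t) 1 (volume : Measure ℝ) :=
    MemLp.smul (p := 2) (q := 2) (Lp.memLp f) (φ.memLp 2 volume)
  exact memLp_one_iff_integrable.mp h

/-- Checked on tempered distributions, into which Lp embeds injectively: a continuous linear map
commutes with integration against a Schwartz function. -/
theorem fourier_compLp (L : F →L[ℂ] G) (f : Lp F 2 (volume : Measure ℝ)) :
    (𝓕 (L.compLp f) : Lp G 2 (volume : Measure ℝ)) = L.compLp (𝓕 f) := by
  have key : (Lp.toTemperedDistributionCLM G (volume : Measure ℝ) 2) (𝓕 (L.compLp f)) =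
      (Lp.toTemperedDistributionCLM G (volume : Measure ℝ) 2) (L.compLp (𝓕 f)) := by
    ext φ
    have int : ∀ (ψ : SchwartzMap ℝ ℂ) (h : Lp F 2 (volume : Measure ℝ)),
        ∫ t, ψ t • (L.compLp h) t = L (∫ t, ψ t • h t) := by
      intro ψ h
      rw [← L.integral_comp_comm (integrable_schwartz_smul ψ h)]
      refine integral_congr_ae ?_
      filter_upwards [L.coeFn_compLp h] with t ht
      rw [ht, map_smul]
    rw [Lp.toTemperedDistributionCLM_apply, Lp.toTemperedDistributionCLM_apply,
      ← Lp.fourier_toTemperedDistribution_eq, TemperedDistribution.fourier_apply,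
      Lp.toTemperedDistribution_apply, Lp.toTemperedDistribution_apply, int, int,
      ← Lp.toTemperedDistribution_apply, ← Lp.toTemperedDistribution_apply,
      ← Lp.fourier_toTemperedDistribution_eq, TemperedDistribution.fourier_apply]
  exact LinearMap.ker_eq_bot.mp
    (Lp.ker_toTemperedDistributionCLM_eq_bot (F := G) (μ := (volume : Measure ℝ)) (p := 2)) key

theorem fourierInv_compLp (L : F →L[ℂ] G) (f : Lp F 2 (volume : Measure ℝ)) :
    (𝓕⁻ (L.compLp f) : Lp G 2 (volume : Measure ℝ)) = L.compLp (𝓕⁻ f) := by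
  have h := fourier_compLp L (𝓕⁻ f)
  rw [FourierTransform.fourier_fourierInv_eq] at h
  rw [← h, FourierTransform.fourierInv_fourier_eq]

end

/-- The inverse transform on L², which is not defined by an integral, agrees with the integral
formula on L¹ ∩ L²: pair both with a test function and move the transform onto it by Fubini. -/
theorem coeFn_fourierInv (f : Lp ℂ 2 (volume : Measure ℝ)) (hf : Integrable f) :
    ((𝓕⁻ f : Lp ℂ 2 (volume : Measure ℝ)) : ℝ → ℂ) =ᵐ[volume] 𝓕⁻ (f : ℝ → ℂ) := by
  refine ae_eq_of_integral_contDiff_smul_eq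
    ((Lp.memLp (𝓕⁻ f : Lp ℂ 2 (volume : Measure ℝ))).locallyIntegrable (by norm_num))
    (continuous_fourierInv hf).locallyIntegrable fun g hg hc => ?_
  have hg₁ : HasCompactSupport (Complex.ofRealCLM ∘ g) := hc.comp_left rfl
  have hg₂ : ContDiff ℝ (⊤ : ℕ∞) (Complex.ofRealCLM ∘ g) := by fun_prop
  set φ := hg₁.toSchwartzMap hg₂ with hφ
  have e : ∀ h : ℝ → ℂ, ∫ x, g x • h x = ∫ x, φ x • h x := fun h =>
    integral_congr_ae (Eventually.of_forall fun x => by simp [hφ])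
  rw [e, e, ← Lp.toTemperedDistribution_apply, ← Lp.fourierInv_toTemperedDistribution_eq,
    TemperedDistribution.fourierInv_apply, Lp.toTemperedDistribution_apply]
  have h1 := VectorFourier.integral_fourierIntegral_smul_eq_flip (𝕜 := ℝ) (L := -innerₗ ℝ)
    (μ := volume) (ν := volume) (e := Real.fourierChar) (f := φ) (g := f)
    Real.continuous_fourierChar (by fun_prop) φ.integrable hf
  have e2 : ∀ h : ℝ → ℂ, VectorFourier.fourierIntegral Real.fourierChar volume (-innerₗ ℝ) h
      = 𝓕⁻ h := by
    intro h
    ext t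
    rw [Real.fourierInv_eq, VectorFourier.fourierIntegral]
    simp
  have e3 : ∀ h : ℝ → ℂ, VectorFourier.fourierIntegral Real.fourierChar volume (-innerₗ ℝ).flip h
      = 𝓕⁻ h := by
    intro h
    ext t
    rw [Real.fourierInv_eq, VectorFourier.fourierIntegral]
    simp [mul_comm]
  rw [e2, e3] at h1
  rw [← h1, SchwartzMap.fourierInv_coe]

theorem lintegral_enorm_sq_Lp {α E : Type*} [MeasurableSpace α] {μ : Measure α}
    [NormedAddCommGroup E] (f : Lp E 2 μ) : ∫⁻ t, ‖f t‖ₑ ^ 2 ∂μ = ‖f‖ₑ ^ 2 := by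
  rw [Lp.enorm_def, eLpNorm_eq_lintegral_rpow_enorm_toReal (by norm_num) (by norm_num),
    ← ENNReal.rpow_natCast, ← ENNReal.rpow_mul]
  simp

theorem lintegral_enorm_fourierInv_sq {f : ℝ → ℂ} (hf : Integrable f)
    (hm : MemLp f 2 (volume : Measure ℝ)) :
    ∫⁻ t, ‖𝓕⁻ f t‖ₑ ^ 2 = ∫⁻ ξ, ‖f ξ‖ₑ ^ 2 := by
  have hae := hm.coeFn_toLp
  have h := coeFn_fourierInv hm.toLp (hf.congr hae.symm)
  have e : 𝓕⁻ (hm.toLp : ℝ → ℂ) = 𝓕⁻ f := by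
    ext t
    rw [fourierInv_eq_integral, fourierInv_eq_integral]
    refine integral_congr_ae ?_
    filter_upwards [hae] with ξ hξ
    rw [hξ]
  rw [e] at h
  have h1 : ∫⁻ t, ‖𝓕⁻ f t‖ₑ ^ 2 = ‖(𝓕⁻ hm.toLp : Lp ℂ 2 (volume : Measure ℝ))‖ₑ ^ 2 := by
    rw [← lintegral_enorm_sq_Lp]
    refine lintegral_congr_ae ?_
    filter_upwards [h] with t ht
    rw [ht]
  have h2 : ∫⁻ t, ‖f t‖ₑ ^ 2 = ‖(hm.toLp : Lp ℂ 2 (volume : Measure ℝ))‖ₑ ^ 2 := by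
    rw [← lintegral_enorm_sq_Lp]
    refine lintegral_congr_ae ?_
    filter_upwards [hae] with t ht
    rw [ht]
  have h3 := Lp.norm_fourier_eq (𝓕⁻ hm.toLp : Lp ℂ 2 (volume : Measure ℝ))
  rw [FourierTransform.fourier_fourierInv_eq] at h3
  rw [h1, h2, ← ofReal_norm, ← ofReal_norm, h3]

theorem memLp_two_of_lintegral {f : ℝ → ℂ} (hf : Measurable f) (h : ∫⁻ ξ, ‖f ξ‖ₑ ^ 2 ≠ ∞) :
    MemLp f 2 (volume : Measure ℝ) := by
  refine ⟨hf.aestronglyMeasurable, ?_⟩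
  rw [eLpNorm_lt_top_iff_lintegral_rpow_enorm_lt_top (by norm_num) (by norm_num)]
  simpa using h.lt_top

theorem xn_exponent_zero (g : ℕ → ℝ → ℂ) : xn 0 g = ∑' n, ∫⁻ ξ, ‖g n ξ‖ₑ ^ 2 := by
  simp [xn]

theorem memLp_of_xn {s : ℝ} (hs : 0 ≤ s) {g : ℕ → ℝ → ℂ} (hg : ∀ n, Measurable (g n))
    (h : xn s g ≠ ∞) (n : ℕ) : MemLp (g n) 2 (volume : Measure ℝ) := by
  refine memLp_two_of_lintegral (hg n) (ne_top_of_le_ne_top h ((xn_mono hs g).trans' ?_))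
  rw [xn_exponent_zero]
  exact ENNReal.le_tsum n

/-- Coefficients in ℓ² do not by themselves make the square of the function lie in the same class.
Plancherel in time applied to the bilinear estimate gives it for almost every time; this makes the
cube integrable. -/
theorem ae_tsum_sconv_coef_ne_top {g : ℕ → ℝ → ℂ} (hg : ∀ n, Measurable (g n))
    (h : xn (9 / 8) g ≠ ∞) :
    ∀ᵐ t, ∑' n, ‖sconv (coef g t) (coef g t) n‖ₑ ^ 2 ≠ ∞ := by
  have ig := integrable_of_xn hg h
  have hb : xn 0 (bconv g g) ≠ ∞ := by
    refine ne_top_of_le_ne_top ?_ (xn_bconv_le hg hg)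
    have h1 := ne_top_of_le_ne_top h (xn_mono (show (7 / 8 : ℝ) ≤ 9 / 8 by norm_num) g)
    exact ENNReal.mul_ne_top convConst_ne_top (ENNReal.mul_ne_top h1 h1)
  have mb := measurable_bconv hg hg
  have ib := integrable_bconv ig ig
  have e : ∀ n t, 𝓕⁻ (bconv g g n) t = sconv (coef g t) (coef g t) n := fun n t =>
    fourierInv_bconv ig ig n t
  have h2 : ∫⁻ t, ∑' n, ‖sconv (coef g t) (coef g t) n‖ₑ ^ 2 = xn 0 (bconv g g) := by
    rw [lintegral_tsum, xn_exponent_zero]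
    · refine tsum_congr fun n => ?_
      simp_rw [← e]
      exact lintegral_enorm_fourierInv_sq (ib n) (memLp_of_xn le_rfl mb hb n)
    · intro n
      simp_rw [← e]
      exact (continuous_fourierInv (ib n)).measurable.enorm.pow_const 2 |>.aemeasurable
  have h3 := ae_lt_top' (f := fun t => ∑' n, ‖sconv (coef g t) (coef g t) n‖ₑ ^ 2) ?_
    (h2 ▸ hb)
  · filter_upwards [h3] with t ht using ht.ne
  · refine AEMeasurable.tsum fun n => ?_
    simp_rw [← e]
    exact (continuous_fourierInv (ib n)).measurable.enorm.pow_const 2 |>.aemeasurable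

/-! ### Gaussian integrals of polynomials -/

/-- The function on `ℝ³` given by a polynomial. -/
noncomputable def polyFun (p : MvPolynomial (Fin 3) ℂ) (x : EuclideanSpace ℝ (Fin 3)) : ℂ :=
  MvPolynomial.aeval (fun i => ((x i : ℝ) : ℂ)) p

@[simp] theorem polyFun_C (c : ℂ) (x : EuclideanSpace ℝ (Fin 3)) :
    polyFun (MvPolynomial.C c) x = c := by simp [polyFun]

@[simp] theorem polyFun_X (i : Fin 3) (x : EuclideanSpace ℝ (Fin 3)) :
    polyFun (MvPolynomial.X i) x = ((x i : ℝ) : ℂ) := by simp [polyFun]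

@[simp] theorem polyFun_zero (x : EuclideanSpace ℝ (Fin 3)) : polyFun 0 x = 0 := by
  simp [polyFun]

@[simp] theorem polyFun_add (p q : MvPolynomial (Fin 3) ℂ) (x : EuclideanSpace ℝ (Fin 3)) :
    polyFun (p + q) x = polyFun p x + polyFun q x := by simp [polyFun]

@[simp] theorem polyFun_mul (p q : MvPolynomial (Fin 3) ℂ) (x : EuclideanSpace ℝ (Fin 3)) :
    polyFun (p * q) x = polyFun p x * polyFun q x := by simp [polyFun]

@[simp] theorem polyFun_smul (c : ℂ) (p : MvPolynomial (Fin 3) ℂ)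
    (x : EuclideanSpace ℝ (Fin 3)) : polyFun (c • p) x = c * polyFun p x := by simp [polyFun]

@[simp] theorem polyFun_pow (p : MvPolynomial (Fin 3) ℂ) (n : ℕ)
    (x : EuclideanSpace ℝ (Fin 3)) : polyFun (p ^ n) x = polyFun p x ^ n := by simp [polyFun]

theorem polyFun_map_conj (p : MvPolynomial (Fin 3) ℂ) (x : EuclideanSpace ℝ (Fin 3)) :
    polyFun (p.map (starRingEnd ℂ)) x = starRingEnd ℂ (polyFun p x) := by
  induction p using MvPolynomial.induction_on with
  | C c => simp
  | add p q hp hq => simp [hp, hq]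
  | mul_X p i hp => simp [hp]

theorem continuous_polyFun (p : MvPolynomial (Fin 3) ℂ) : Continuous (polyFun p) := by
  induction p using MvPolynomial.induction_on with
  | C c => simpa [funext fun x => polyFun_C c x] using continuous_const
  | add p q hp hq => exact (hp.add hq).congr fun x => (polyFun_add p q x).symm
  | mul_X p i hp =>
    rw [show polyFun (p * MvPolynomial.X i) = fun x => polyFun p x * ((x i : ℝ) : ℂ) from
      funext fun x => by simp]
    fun_prop

theorem polyFun_smul_of_isHomogeneous {p : MvPolynomial (Fin 3) ℂ} {d : ℕ}
    (hp : p.IsHomogeneous d) (r : ℝ) (x : EuclideanSpace ℝ (Fin 3)) :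
    polyFun p (r • x) = (r : ℂ) ^ d * polyFun p x := by
  rw [polyFun, polyFun, MvPolynomial.aeval_def, MvPolynomial.aeval_def, MvPolynomial.eval₂_eq,
    MvPolynomial.eval₂_eq, Finset.mul_sum]
  refine Finset.sum_congr rfl fun m hm => ?_
  have hd : ∑ i ∈ m.support, m i = d := by
    rw [← hp (MvPolynomial.mem_support_iff.mp hm), Finsupp.weight_apply, Finsupp.sum]
    simp
  simp only [PiLp.smul_apply, smul_eq_mul, Complex.ofReal_mul, mul_pow, Finset.prod_mul_distrib]
  rw [Finset.prod_pow_eq_pow_sum, hd]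
  ring

theorem exists_norm_polyFun_le (p : MvPolynomial (Fin 3) ℂ) :
    ∃ C : ℝ, ∃ d : ℕ, 0 ≤ C ∧ ∀ x, ‖polyFun p x‖ ≤ C * (1 + ‖x‖) ^ d := by
  induction p using MvPolynomial.induction_on with
  | C c => exact ⟨‖c‖, 0, norm_nonneg _, fun x => by simp⟩
  | add p q hp hq =>
    obtain ⟨C, d, hC, h⟩ := hp
    obtain ⟨C', d', hC', h'⟩ := hq
    refine ⟨C + C', max d d', by positivity, fun x => ?_⟩
    have h1 : (1 : ℝ) ≤ 1 + ‖x‖ := by linarith [norm_nonneg x]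
    rw [polyFun_add, add_mul]
    refine (norm_add_le _ _).trans (add_le_add ((h x).trans ?_) ((h' x).trans ?_))
    · gcongr
      exact le_max_left _ _
    · gcongr
      exact le_max_right _ _
  | mul_X p i hp =>
    obtain ⟨C, d, hC, h⟩ := hp
    refine ⟨C, d + 1, hC, fun x => ?_⟩
    rw [polyFun_mul, norm_mul, polyFun_X, Complex.norm_real, pow_succ, ← mul_assoc]
    have := PiLp.norm_apply_le x i
    gcongr
    · exact h x
    · linarith

/-- The Gaussian `e^{-|x|²}`, complex valued. -/
noncomputable def gauss (x : EuclideanSpace ℝ (Fin 3)) : ℂ := (Real.exp (-‖x‖ ^ 2) : ℝ)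

theorem continuous_gauss : Continuous gauss := by unfold gauss; fun_prop

theorem integrable_polyFun_mul_gauss (p : MvPolynomial (Fin 3) ℂ) :
    Integrable fun x => polyFun p x * gauss x := by
  obtain ⟨C, d, hC, h⟩ := exists_norm_polyFun_le p
  have hg : Integrable fun x : EuclideanSpace ℝ (Fin 3) => Real.exp (-(1 / 2) * ‖x‖ ^ 2) := by
    have := GaussianFourier.integrable_cexp_neg_mul_sq_norm_add (V := EuclideanSpace ℝ (Fin 3))
      (b := 1 / 2) (by norm_num) 0 0
    refine this.norm.congr (Eventually.of_forall fun x => ?_)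
    simp only [Complex.norm_exp]
    congr 1
    simp [← Complex.ofReal_pow]
  refine Integrable.mono' (hg.const_mul (C * (d.factorial * Real.exp (3 / 2))))
    ((continuous_polyFun p).mul continuous_gauss).aestronglyMeasurable
    (Eventually.of_forall fun x => ?_)
  have h0 := norm_nonneg x
  rw [norm_mul, gauss, Complex.norm_real, Real.norm_of_nonneg (Real.exp_pos _).le]
  -- Half of the Gaussian absorbs the polynomial: (1 + s)^d ≤ d! exp (1 + s) and 1 + s ≤ 3/2 + s²/2
  -- for s = ‖x‖.
  have h1 := Real.pow_div_factorial_le_exp (1 + ‖x‖) (by positivity) d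
  rw [div_le_iff₀ (by positivity)] at h1
  have h2 : Real.exp (1 + ‖x‖) ≤ Real.exp (3 / 2) * Real.exp (1 / 2 * ‖x‖ ^ 2) := by
    rw [← Real.exp_add]
    refine Real.exp_le_exp.mpr ?_
    nlinarith [sq_nonneg (‖x‖ - 1)]
  have h3 : Real.exp (1 / 2 * ‖x‖ ^ 2) * Real.exp (-‖x‖ ^ 2) = Real.exp (-(1 / 2) * ‖x‖ ^ 2) := by
    rw [← Real.exp_add]
    ring_nf
  calc ‖polyFun p x‖ * Real.exp (-‖x‖ ^ 2)
      ≤ C * (Real.exp (3 / 2) * Real.exp (1 / 2 * ‖x‖ ^ 2) * d.factorial) *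
        Real.exp (-‖x‖ ^ 2) := by
        gcongr
        refine (h x).trans ?_
        gcongr
        exact h1.trans (by gcongr)
    _ = _ := by rw [← h3]; ring

theorem hasLineDerivAt_polyFun (p : MvPolynomial (Fin 3) ℂ) (i : Fin 3)
    (x : EuclideanSpace ℝ (Fin 3)) :
    HasLineDerivAt ℝ (polyFun p) (polyFun (MvPolynomial.pderiv i p) x) x
      (EuclideanSpace.single i 1) := by
  unfold HasLineDerivAt
  induction p using MvPolynomial.induction_on with
  | C c => simpa using hasDerivAt_const (0 : ℝ) c
  | add p q hp hq =>
    simp only [polyFun_add, map_add]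
    exact hp.add hq
  | mul_X p j hp =>
    have h1 : HasDerivAt (fun t : ℝ => (((x + t • EuclideanSpace.single i (1 : ℝ) :
        EuclideanSpace ℝ (Fin 3)) j : ℝ) : ℂ)) (if j = i then 1 else 0) 0 := by
      have : HasDerivAt (fun t : ℝ => x j + t * (if j = i then 1 else 0)) (if j = i then 1 else 0)
          (0 : ℝ) := by
        simpa using ((hasDerivAt_id (0 : ℝ)).mul_const (if j = i then (1 : ℝ) else 0)).const_add
          (x j)
      have := this.ofReal_comp
      refine (this.congr_deriv (by split_ifs <;> simp)).congr_of_eventuallyEq ?_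
      exact Eventually.of_forall fun t => by simp
    have h2 := hp.mul h1
    simp only [polyFun_mul, polyFun_X]
    refine h2.congr_deriv ?_
    rw [MvPolynomial.pderiv_mul, MvPolynomial.pderiv_X]
    by_cases h : j = i
    · subst h; simp [polyFun]
    · simp [h, polyFun]

theorem hasLineDerivAt_gauss (i : Fin 3) (x : EuclideanSpace ℝ (Fin 3)) :
    HasLineDerivAt ℝ gauss (-2 * ((x i : ℝ) : ℂ) * gauss x) x (EuclideanSpace.single i 1) := by
  unfold HasLineDerivAt gauss
  have e : ∀ t : ℝ, ‖x + t • EuclideanSpace.single i (1 : ℝ)‖ ^ 2 = ‖x‖ ^ 2 + 2 * x i * t + t ^ 2 := by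
    intro t
    rw [norm_add_sq_real, inner_smul_right, norm_smul]
    simp [EuclideanSpace.inner_single_right]
    ring
  simp only [e]
  have h : HasDerivAt (fun t : ℝ => -(‖x‖ ^ 2 + 2 * x i * t + t ^ 2)) (-(2 * x i)) 0 := by
    have := (((hasDerivAt_id (0 : ℝ)).const_mul (2 * x i)).const_add (‖x‖ ^ 2)).add
      (hasDerivAt_pow 2 (0 : ℝ))
    exact (this.congr_deriv (by simp)).fun_neg
  refine h.exp.ofReal_comp.congr_deriv ?_
  push_cast
  simp
  ring

/-- The Gaussian integral of a polynomial. -/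
noncomputable def gaussInt : MvPolynomial (Fin 3) ℂ →ₗ[ℂ] ℂ where
  toFun p := ∫ x, polyFun p x * gauss x
  map_add' p q := by
    rw [← integral_add (integrable_polyFun_mul_gauss p) (integrable_polyFun_mul_gauss q)]
    simp [add_mul]
  map_smul' c p := by
    simp [mul_assoc, integral_const_mul]

theorem gaussInt_X_mul (i : Fin 3) (p : MvPolynomial (Fin 3) ℂ) :
    gaussInt (MvPolynomial.X i * p) = 1 / 2 * gaussInt (MvPolynomial.pderiv i p) := by
  have h := integral_bilinear_hasLineDerivAt_right_eq_neg_left_of_integrable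
    (μ := (volume : Measure (EuclideanSpace ℝ (Fin 3)))) (B := ContinuousLinearMap.mul ℝ ℂ)
    (f := polyFun p) (f' := polyFun (MvPolynomial.pderiv i p)) (g := gauss)
    (g' := fun x => -2 * ((x i : ℝ) : ℂ) * gauss x) (v := EuclideanSpace.single i 1)
    (integrable_polyFun_mul_gauss _) ?_ (integrable_polyFun_mul_gauss _)
    (fun x _ => hasLineDerivAt_polyFun p i x) (fun x _ => hasLineDerivAt_gauss i x)
  · have e : ∀ x, polyFun p x * (-2 * ((x i : ℝ) : ℂ) * gauss x) =
        -2 * (polyFun (MvPolynomial.X i * p) x * gauss x) := by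
      intro x; simp; ring
    simp only [ContinuousLinearMap.mul_apply', e, integral_const_mul] at h
    change (∫ x, polyFun (MvPolynomial.X i * p) x * gauss x) =
      1 / 2 * ∫ x, polyFun (MvPolynomial.pderiv i p) x * gauss x
    linear_combination (-1 / 2) * h
  · refine ((integrable_polyFun_mul_gauss (MvPolynomial.X i * p)).const_mul (-2)).congr
      (Eventually.of_forall fun x => ?_)
    simp
    ring

/-- Euler's identity writes k p as ∑ xᵢ ∂ᵢp, each xᵢ is integrated by parts against the Gaussian,
and Δp = 0 removes the second derivatives. -/
theorem natCast_mul_gaussInt {k : ℕ} {p : MvPolynomial (Fin 3) ℂ} (hp : p ∈ harmonicPoly k)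
    (q : MvPolynomial (Fin 3) ℂ) :
    (k : ℂ) * gaussInt (p * q) =
      1 / 2 * gaussInt (∑ i, MvPolynomial.pderiv i p * MvPolynomial.pderiv i q) := by
  obtain ⟨h1, h2⟩ := hp
  have euler := MvPolynomial.IsHomogeneous.sum_X_mul_pderiv
    ((MvPolynomial.mem_homogeneousSubmodule k p).mp h1)
  have lap : ∑ i, MvPolynomial.pderiv i (MvPolynomial.pderiv i p) = 0 := by
    simpa [polyLaplacian] using h2
  have e1 : (k : ℂ) * gaussInt (p * q) = gaussInt ((k • p) * q) := by
    rw [smul_mul_assoc, map_nsmul, nsmul_eq_mul]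
  rw [e1, ← euler, Finset.sum_mul, map_sum]
  simp_rw [mul_assoc, gaussInt_X_mul, MvPolynomial.pderiv_mul, map_add]
  rw [← Finset.mul_sum, Finset.sum_add_distrib, ← map_sum, ← Finset.sum_mul, lap, zero_mul,
    map_zero, zero_add, map_sum]

/-- The gradient form in `natCast_mul_gaussInt` is symmetric in the two polynomials, so the integral
times j equals the integral times k. -/
theorem gaussInt_mul_eq_zero {j k : ℕ} (hjk : j ≠ k) {p q : MvPolynomial (Fin 3) ℂ}
    (hp : p ∈ harmonicPoly j) (hq : q ∈ harmonicPoly k) : gaussInt (p * q) = 0 := by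
  have h1 := natCast_mul_gaussInt hp q
  have h2 := natCast_mul_gaussInt hq p
  rw [mul_comm q p] at h2
  simp_rw [mul_comm (MvPolynomial.pderiv _ q)] at h2
  have h3 : ((j : ℂ) - k) * gaussInt (p * q) = 0 := by rw [sub_mul, h1, h2, sub_self]
  exact (mul_eq_zero.mp h3).resolve_left (sub_ne_zero.mpr (Nat.cast_injective.ne hjk))

/-! ### Integrals over the sphere -/

/-- The radial factor of the Gaussian integral of a homogeneous function of degree `d`. -/
noncomputable def radial (d : ℕ) : ℝ := 1 / 2 * Real.Gamma ((d + 3) / 2)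

theorem radial_pos (d : ℕ) : 0 < radial d := by
  unfold radial
  have := Real.Gamma_pos_of_pos (show (0 : ℝ) < (d + 3) / 2 by positivity)
  positivity

theorem radial_add_two (d : ℕ) : radial (d + 2) = (d + 3) / 2 * radial d := by
  unfold radial
  rw [show (((d + 2 : ℕ) : ℝ) + 3) / 2 = (d + 3) / 2 + 1 by push_cast; ring,
    Real.Gamma_add_one (by positivity)]
  ring

theorem integral_volumeIoiPow (d : ℕ) :
    ∫ r : Ioi (0 : ℝ), ((r : ℝ) : ℂ) ^ d * ((Real.exp (-(r : ℝ) ^ 2) : ℝ) : ℂ)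
      ∂(Measure.volumeIoiPow 2) = radial d := by
  have e : (∫ r : Ioi (0 : ℝ), ((r : ℝ) : ℂ) ^ d * ((Real.exp (-(r : ℝ) ^ 2) : ℝ) : ℂ)
      ∂(Measure.volumeIoiPow 2)) =
      ((∫ r : Ioi (0 : ℝ), (r : ℝ) ^ d * Real.exp (-(r : ℝ) ^ 2) ∂(Measure.volumeIoiPow 2) : ℝ) :
        ℂ) := by
    rw [← integral_complex_ofReal]
    push_cast
    rfl
  rw [e]
  congr 1
  have h := _root_.integral_rpow_mul_exp_neg_rpow (p := 2) (q := d + 2) (by norm_num)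
    (by linarith [(Nat.cast_nonneg d : (0 : ℝ) ≤ d)])
  rw [radial, show ((d : ℝ) + 3) / 2 = (d + 2 + 1) / 2 by ring, ← h]
  simp only [Measure.volumeIoiPow, ENNReal.ofReal]
  rw [integral_withDensity_eq_integral_smul,
    integral_subtype_comap measurableSet_Ioi fun a : ℝ =>
      Real.toNNReal (a ^ 2) • (a ^ d * Real.exp (-a ^ 2))]
  · refine setIntegral_congr_fun measurableSet_Ioi fun x hx => ?_
    have hx' : (0 : ℝ) < x := hx
    rw [NNReal.smul_def, Real.coe_toNNReal _ (by positivity), smul_eq_mul,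
      show (d : ℝ) + 2 = ((d + 2 : ℕ) : ℝ) by push_cast; ring, Real.rpow_natCast,
      show (x : ℝ) ^ (2 : ℝ) = x ^ 2 from Real.rpow_natCast x 2]
    ring
  · fun_prop

/-- Polar coordinates. The radial factor is positive, so orthogonality and norms on the sphere can
be read off from flat Gaussian integrals, with no calculus on the sphere. -/
theorem gaussInt_of_isHomogeneous {d : ℕ} {p : MvPolynomial (Fin 3) ℂ} (hp : p.IsHomogeneous d) :
    gaussInt p = radial d * ∫ x : S2, polyFun p x ∂surf := by
  set μ : Measure (EuclideanSpace ℝ (Fin 3)) := volume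
  have hdim : Module.finrank ℝ (EuclideanSpace ℝ (Fin 3)) - 1 = 2 := by simp
  have h := μ.measurePreserving_homeomorphUnitSphereProd.integral_comp
    (Homeomorph.measurableEmbedding _) (fun z : S2 × Ioi (0 : ℝ) =>
      polyFun p z.1 * (((z.2 : ℝ) : ℂ) ^ d * ((Real.exp (-(z.2 : ℝ) ^ 2) : ℝ) : ℂ)))
  rw [hdim, integral_prod_mul (fun x : S2 => polyFun p x)
    (fun r : Ioi (0 : ℝ) => ((r : ℝ) : ℂ) ^ d * ((Real.exp (-(r : ℝ) ^ 2) : ℝ) : ℂ)),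
    integral_volumeIoiPow] at h
  rw [mul_comm, ← h]
  change ∫ x, polyFun p x * gauss x ∂μ = _
  have hres := integral_subtype_comap (μ := μ)
    (measurableSet_singleton (0 : EuclideanSpace ℝ (Fin 3))).compl
    (fun x => polyFun p x * gauss x)
  rw [restrict_compl_singleton] at hres
  rw [← hres]
  refine integral_congr_ae (Eventually.of_forall fun x => ?_)
  have hx : (0 : ℝ) < ‖(x : EuclideanSpace ℝ (Fin 3))‖ := norm_pos_iff.mpr x.2
  have e : polyFun p (x : EuclideanSpace ℝ (Fin 3)) = polyFun p
      (‖(x : EuclideanSpace ℝ (Fin 3))‖ • (‖(x : EuclideanSpace ℝ (Fin 3))‖⁻¹ •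
        (x : EuclideanSpace ℝ (Fin 3)))) := by
    rw [smul_smul, mul_inv_cancel₀ hx.ne', one_smul]
  dsimp only
  rw [e, polyFun_smul_of_isHomogeneous hp]
  simp [gauss]
  ring

theorem aeval_coord_apply (p : MvPolynomial (Fin 3) ℂ) (x : S2) :
    MvPolynomial.aeval (R := ℂ) coord p x = polyFun p x := by
  induction p using MvPolynomial.induction_on with
  | C c => simp
  | add p q hp hq => simp [hp, hq]
  | mul_X p i hp => simp [hp, coord]

theorem coeFn_restrictPoly (p : MvPolynomial (Fin 3) ℂ) :
    (restrictPoly p : S2 → ℂ) =ᵐ[surf] fun x => polyFun p x := by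
  have h := ContinuousMap.coeFn_toLp (p := 2) (𝕜 := ℂ) surf (MvPolynomial.aeval (R := ℂ) coord p)
  refine h.trans (Eventually.of_forall fun x => aeval_coord_apply p x)

theorem inner_restrictPoly (p q : MvPolynomial (Fin 3) ℂ) :
    inner ℂ (restrictPoly p) (restrictPoly q) =
      ∫ x : S2, polyFun (p.map (starRingEnd ℂ) * q) x ∂surf := by
  rw [L2.inner_def]
  refine integral_congr_ae ?_
  filter_upwards [coeFn_restrictPoly p, coeFn_restrictPoly q] with x h1 h2
  rw [h1, h2, RCLike.inner_apply, polyFun_mul, polyFun_map_conj, mul_comm]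

theorem map_conj_mem_harmonicPoly {k : ℕ} {p : MvPolynomial (Fin 3) ℂ} (hp : p ∈ harmonicPoly k) :
    p.map (starRingEnd ℂ) ∈ harmonicPoly k := by
  obtain ⟨h1, h2⟩ := hp
  refine ⟨((MvPolynomial.mem_homogeneousSubmodule k p).mp h1).map _, ?_⟩
  have lap : ∑ i, MvPolynomial.pderiv i (MvPolynomial.pderiv i p) = 0 := by
    simpa [polyLaplacian] using h2
  have := congrArg (MvPolynomial.map (starRingEnd ℂ)) lap
  simp only [map_sum, map_zero, ← MvPolynomial.pderiv_map] at this
  simpa [polyLaplacian] using this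

theorem inner_eq_zero_of_mem_harm {j k : ℕ} (hjk : j ≠ k) {u v : L2S} (hu : u ∈ harm j)
    (hv : v ∈ harm k) : inner ℂ u v = 0 := by
  obtain ⟨p, hp, rfl⟩ := hu
  obtain ⟨q, hq, rfl⟩ := hv
  have h0 := gaussInt_mul_eq_zero hjk (map_conj_mem_harmonicPoly hp) hq
  have h1 := (MvPolynomial.mem_homogeneousSubmodule _ _).mp (map_conj_mem_harmonicPoly hp).1
  have h2 := (MvPolynomial.mem_homogeneousSubmodule _ _).mp hq.1
  rw [gaussInt_of_isHomogeneous (h1.mul h2)] at h0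
  rw [inner_restrictPoly]
  exact (mul_eq_zero.mp h0).resolve_left (by exact_mod_cast (radial_pos _).ne')

/-! ### The highest weight harmonics -/

/-- The polynomial `x₁ + i x₂`. -/
noncomputable def zPoly : MvPolynomial (Fin 3) ℂ :=
  MvPolynomial.X 0 + MvPolynomial.C Complex.I * MvPolynomial.X 1

theorem psi_eq (k : ℕ) : psi k = restrictPoly (zPoly ^ k) := rfl

theorem isHomogeneous_zPoly : zPoly.IsHomogeneous 1 := by
  refine (MvPolynomial.isHomogeneous_X _ _).add ?_
  have := (MvPolynomial.isHomogeneous_C (Fin 3) Complex.I).mul (MvPolynomial.isHomogeneous_X ℂ 1)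
  simpa using this

theorem pderiv_zPoly_pow (i : Fin 3) (k : ℕ) :
    MvPolynomial.pderiv i (zPoly ^ k) =
      MvPolynomial.C ((k : ℂ) * ![1, Complex.I, 0] i) * zPoly ^ (k - 1) := by
  have h : MvPolynomial.pderiv i zPoly = MvPolynomial.C (![1, Complex.I, 0] i) := by
    unfold zPoly
    fin_cases i <;> simp [MvPolynomial.pderiv_X]
  rw [MvPolynomial.pderiv_pow, h, map_mul, map_natCast]
  ring

theorem zPoly_pow_mem_harmonicPoly (k : ℕ) : zPoly ^ k ∈ harmonicPoly k := by
  refine ⟨?_, ?_⟩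
  · rw [SetLike.mem_coe, MvPolynomial.mem_homogeneousSubmodule]
    simpa using isHomogeneous_zPoly.pow k
  · have : ∑ i, MvPolynomial.pderiv i (MvPolynomial.pderiv i (zPoly ^ k)) = 0 := by
      simp_rw [pderiv_zPoly_pow, MvPolynomial.pderiv_C_mul, pderiv_zPoly_pow, ← mul_assoc,
        ← map_mul]
      rw [← Finset.sum_mul, ← map_sum, Fin.sum_univ_three]
      have : (k : ℂ) * ![1, Complex.I, 0] 0 * (((k - 1 : ℕ) : ℂ) * ![1, Complex.I, 0] 0) +
          (k : ℂ) * ![1, Complex.I, 0] 1 * (((k - 1 : ℕ) : ℂ) * ![1, Complex.I, 0] 1) +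
          (k : ℂ) * ![1, Complex.I, 0] 2 * (((k - 1 : ℕ) : ℂ) * ![1, Complex.I, 0] 2) = 0 := by
        simp
        linear_combination (k : ℂ) * ((k - 1 : ℕ) : ℂ) * Complex.I_mul_I
      rw [this, map_zero, zero_mul]
    simpa [polyLaplacian] using this

theorem psi_mem_harm (k : ℕ) : psi k ∈ harm k := ⟨_, zPoly_pow_mem_harmonicPoly k, rfl⟩

/-- The function `x₁ + i x₂` on the sphere. -/
noncomputable def zFun (x : S2) : ℂ := polyFun zPoly x

theorem continuous_zFun : Continuous zFun :=
  (continuous_polyFun zPoly).comp continuous_subtype_val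

theorem coeFn_psi (k : ℕ) : (psi k : S2 → ℂ) =ᵐ[surf] fun x => zFun x ^ k := by
  filter_upwards [coeFn_restrictPoly (zPoly ^ k)] with x hx
  rw [psi_eq, hx, polyFun_pow, zFun]

/-- The squared norm of `(x₁ + i x₂)^k` in `L²(S²)`. -/
noncomputable def psiSq (k : ℕ) : ℝ := ‖psi k‖ ^ 2

theorem inner_psi_self (k : ℕ) : inner ℂ (psi k) (psi k) = (psiSq k : ℂ) := by
  rw [inner_self_eq_norm_sq_to_K, psiSq]
  push_cast
  rfl

theorem radial_mul_psiSq (k : ℕ) : gaussInt ((zPoly ^ k).map (starRingEnd ℂ) * zPoly ^ k) =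
    radial (k + k) * psiSq k := by
  have h1 := (MvPolynomial.mem_homogeneousSubmodule _ _).mp
    (map_conj_mem_harmonicPoly (zPoly_pow_mem_harmonicPoly k)).1
  have h2 := (MvPolynomial.mem_homogeneousSubmodule _ _).mp (zPoly_pow_mem_harmonicPoly k).1
  rw [gaussInt_of_isHomogeneous (h1.mul h2), ← inner_psi_self, psi_eq, inner_restrictPoly]

/-- Taking conj(z)^(k+1) and z^(k+1) in `natCast_mul_gaussInt`, the gradient form is
2(k+1)²|z|^(2k); the radial factors of degrees 2k+2 and 2k have ratio k + 3/2. -/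
theorem psiSq_succ (k : ℕ) : (k + 3 / 2) * psiSq (k + 1) = (k + 1) * psiSq k := by
  have h := natCast_mul_gaussInt (map_conj_mem_harmonicPoly (zPoly_pow_mem_harmonicPoly (k + 1)))
    (zPoly ^ (k + 1))
  have e : ∑ i, MvPolynomial.pderiv i ((zPoly ^ (k + 1)).map (starRingEnd ℂ)) *
      MvPolynomial.pderiv i (zPoly ^ (k + 1)) =
      (2 * ((k : ℂ) + 1) ^ 2) • ((zPoly ^ k).map (starRingEnd ℂ) * zPoly ^ k) := by
    simp_rw [MvPolynomial.pderiv_map, pderiv_zPoly_pow, map_mul, MvPolynomial.map_C]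
    rw [Fin.sum_univ_three, MvPolynomial.smul_eq_C_mul]
    simp only [Nat.add_sub_cancel, map_mul, map_pow, map_add, map_natCast, map_one,
      Matrix.cons_val_zero, Matrix.cons_val_one, Matrix.cons_val, map_zero, Complex.conj_I, map_neg]
    have hI : (MvPolynomial.C Complex.I : MvPolynomial (Fin 3) ℂ) * MvPolynomial.C Complex.I = -1 := by
      rw [← map_mul, Complex.I_mul_I, map_neg, map_one]
    have h2 : (MvPolynomial.C 2 : MvPolynomial (Fin 3) ℂ) = 2 := map_ofNat _ 2
    rw [h2]
    push_cast
    linear_combination (-(MvPolynomial.map (starRingEnd ℂ) zPoly ^ k * zPoly ^ k * ((k : MvPolynomial (Fin 3) ℂ) + 1) ^ 2)) * hI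
  rw [e, map_smul, radial_mul_psiSq, radial_mul_psiSq, show k + 1 + (k + 1) = k + k + 2 by ring,
    radial_add_two] at h
  have hr := radial_pos (k + k)
  have h' : ((k + 1 : ℕ) : ℝ) * ((((k + k : ℕ) : ℝ) + 3) / 2 * radial (k + k) * psiSq (k + 1)) =
      1 / 2 * (2 * ((k : ℝ) + 1) ^ 2 * (radial (k + k) * psiSq k)) := by
    rw [smul_eq_mul] at h
    have hc := congrArg Complex.re h
    have e2 : ((k + 1 : ℕ) : ℂ) * (((((((k + k : ℕ) : ℝ) + 3) / 2 * radial (k + k) : ℝ)) : ℂ) *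
        (psiSq (k + 1) : ℂ)) = ((((k + 1 : ℕ) : ℝ) * ((((k + k : ℕ) : ℝ) + 3) / 2 *
          radial (k + k) * psiSq (k + 1)) : ℝ) : ℂ) := by push_cast; ring
    have e3 : 1 / 2 * (2 * ((k : ℂ) + 1) ^ 2 * ((radial (k + k) : ℂ) * (psiSq k : ℂ))) =
        ((1 / 2 * (2 * ((k : ℝ) + 1) ^ 2 * (radial (k + k) * psiSq k)) : ℝ) : ℂ) := by
      push_cast; ring
    rw [e2, e3] at hc
    simpa only [Complex.ofReal_re] using hc
  push_cast at h'
  have hk : (0 : ℝ) < k + 1 := by positivity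
  refine mul_left_cancel₀ (mul_pos hk hr).ne' ?_
  linear_combination h'

/-! ### Sobolev norms on the closed span -/

theorem psiSq_nonneg (k : ℕ) : 0 ≤ psiSq k := by unfold psiSq; positivity

theorem psiSq_zero_pos : 0 < psiSq 0 := by
  have h := inner_restrictPoly 1 1
  have h1 : psi 0 = restrictPoly 1 := by rw [psi_eq, pow_zero]
  rw [← h1, inner_psi_self] at h
  have e : ∀ x : S2, polyFun (MvPolynomial.map (starRingEnd ℂ) 1 * 1) x = 1 := by
    intro x; simp [polyFun]
  simp only [e, integral_const] at h
  have h2 : psiSq 0 = surf.real univ := by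
    rw [Complex.real_smul, mul_one] at h
    exact_mod_cast h
  rw [h2]
  have : surf univ ≠ 0 := by
    rw [Ne, Measure.measure_univ_eq_zero]
    exact Measure.toSphere_ne_zero _
  exact ENNReal.toReal_pos this (measure_ne_top _ _)

/-- By the recursion, psiSq k ^ 2 * (k + 1) decreases and psiSq k ^ 2 * (k + 1/2) increases.
Together they fix the size k^(-1/2) of `psiSq k` without Stirling's formula. -/
theorem psiSq_bounds (k : ℕ) :
    psiSq k ^ 2 * (k + 1) ≤ psiSq 0 ^ 2 ∧ psiSq 0 ^ 2 / 2 ≤ psiSq k ^ 2 * (k + 1 / 2) := by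
  induction k with
  | zero =>
    constructor
    · norm_num
    · norm_num
      linarith
  | succ k ih =>
    have h := psiSq_succ k
    have hk : (0 : ℝ) ≤ k := Nat.cast_nonneg k
    have e : psiSq (k + 1) = (k + 1) / (k + 3 / 2) * psiSq k := by
      field_simp
      linear_combination 2 * h
    rw [e]
    push_cast
    refine ⟨le_trans ?_ ih.1, ih.2.trans ?_⟩
    · have : ((k : ℝ) + 1) ^ 2 / (k + 3 / 2) ^ 2 * (k + 1 + 1) ≤ k + 1 := by
        rw [div_mul_eq_mul_div, div_le_iff₀ (by positivity)]
        nlinarith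
      calc _ = psiSq k ^ 2 * (((k : ℝ) + 1) ^ 2 / (k + 3 / 2) ^ 2 * (k + 1 + 1)) := by
            rw [mul_pow, div_pow]; ring
        _ ≤ _ := by gcongr
    · have : (k : ℝ) + 1 / 2 ≤ ((k : ℝ) + 1) ^ 2 / (k + 3 / 2) ^ 2 * (k + 1 + 1 / 2) := by
        rw [div_mul_eq_mul_div, le_div_iff₀ (by positivity)]
        nlinarith
      calc _ ≤ psiSq k ^ 2 * (((k : ℝ) + 1) ^ 2 / (k + 3 / 2) ^ 2 * (k + 1 + 1 / 2)) := by gcongr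
        _ = _ := by rw [mul_pow, div_pow]; ring

theorem psiSq_pos (k : ℕ) : 0 < psiSq k := by
  have h := (psiSq_bounds k).2
  have h0 := psiSq_zero_pos
  refine (psiSq_nonneg k).lt_of_ne' fun h1 => ?_
  rw [h1] at h
  norm_num at h
  nlinarith

theorem psi_ne_zero (k : ℕ) : psi k ≠ 0 := by
  intro h
  have := psiSq_pos k
  rw [psiSq, h] at this
  simp at this

theorem bracket_pos (a : ℝ) : 0 < bracket a := Real.sqrt_pos.mpr (by positivity)

theorem freq_sq (k : ℕ) : freq k ^ 2 = k * (k + 1) := Real.sq_sqrt (by positivity)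

theorem bracket_freq_rpow_pow_four (k : ℕ) :
    (bracket (freq k) ^ (2 * (1 / 4) : ℝ)) ^ 4 = 1 + (k : ℝ) * (k + 1) := by
  rw [← Real.rpow_natCast, ← Real.rpow_mul (bracket_pos _).le,
    show (2 * (1 / 4) * ((4 : ℕ) : ℝ) : ℝ) = ((2 : ℕ) : ℝ) by norm_num, Real.rpow_natCast, bracket,
    Real.sq_sqrt (by positivity), freq_sq]

/-- This is why 1/4 is the right exponent: the Sobolev weight grows exactly as the squared norms
decay, and H^{1/4} on the span becomes ℓ². After taking fourth powers it reduces to (k + 1/2)² ≤ 1 +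
k(k+1) ≤ (k + 1)². -/
theorem sobWeight_bounds (k : ℕ) :
    bracket (freq k) ^ (2 * (1 / 4) : ℝ) * psiSq k ≤ psiSq 0 ∧
      psiSq 0 / 2 ≤ bracket (freq k) ^ (2 * (1 / 4) : ℝ) * psiSq k := by
  have hb := Real.rpow_nonneg (bracket_pos (freq k)).le (2 * (1 / 4))
  have h4 := bracket_freq_rpow_pow_four k
  have h0 := psiSq_zero_pos
  have hk := psiSq_pos k
  obtain ⟨h1, h2⟩ := psiSq_bounds k
  have hk' : (0 : ℝ) ≤ k := Nat.cast_nonneg k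
  have e : (bracket (freq k) ^ (2 * (1 / 4) : ℝ) * psiSq k) ^ 4 =
      (1 + (k : ℝ) * (k + 1)) * psiSq k ^ 4 := by rw [mul_pow, h4]
  constructor
  · refine (pow_le_pow_iff_left₀ (by positivity) h0.le (by norm_num : 4 ≠ 0)).mp ?_
    rw [e]
    calc (1 + (k : ℝ) * (k + 1)) * psiSq k ^ 4 ≤ (k + 1) ^ 2 * psiSq k ^ 4 := by
          gcongr; nlinarith
      _ = (psiSq k ^ 2 * (k + 1)) ^ 2 := by ring
      _ ≤ (psiSq 0 ^ 2) ^ 2 := by gcongr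
      _ = _ := by ring
  · refine (pow_le_pow_iff_left₀ (by positivity) (by positivity) (by norm_num : 4 ≠ 0)).mp ?_
    rw [e]
    calc (psiSq 0 / 2) ^ 4 ≤ (psiSq 0 ^ 2 / 2) ^ 2 := by
          have : 0 ≤ psiSq 0 ^ 4 := by positivity
          nlinarith
      _ ≤ (psiSq k ^ 2 * (k + 1 / 2)) ^ 2 := by gcongr
      _ = ((k : ℝ) + 1 / 2) ^ 2 * psiSq k ^ 4 := by ring
      _ ≤ _ := by gcongr; nlinarith

theorem inner_psi_of_ne {j k : ℕ} (h : j ≠ k) : inner ℂ (psi j) (psi k) = 0 :=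
  inner_eq_zero_of_mem_harm h (psi_mem_harm j) (psi_mem_harm k)

/-- The closed linear span of the `(x₁ + i x₂)^k`. -/
noncomputable def homSpan : Submodule ℂ L2S := (Submodule.span ℂ (Set.range psi)).topologicalClosure

theorem psi_mem_homSpan (k : ℕ) : psi k ∈ homSpan :=
  Submodule.le_topologicalClosure _ (Submodule.subset_span ⟨k, rfl⟩)

theorem isClosed_homSpan : IsClosed (homSpan : Set L2S) := Submodule.isClosed_topologicalClosure _

/-- The `k`-th coefficient of a function with respect to the `(x₁ + i x₂)^k`. -/
noncomputable def hcoef (k : ℕ) : L2S →L[ℂ] ℂ := ((psiSq k : ℂ))⁻¹ • innerSL ℂ (psi k)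

theorem hcoef_apply (k : ℕ) (u : L2S) : hcoef k u = (psiSq k : ℂ)⁻¹ * inner ℂ (psi k) u := rfl

theorem inner_psi_eq (k : ℕ) (u : L2S) : inner ℂ (psi k) u = psiSq k * hcoef k u := by
  rw [hcoef_apply, mul_inv_cancel_left₀]
  exact_mod_cast (psiSq_pos k).ne'

theorem hcoef_psi (k j : ℕ) : hcoef k (psi j) = if j = k then 1 else 0 := by
  rw [hcoef_apply]
  split_ifs with h
  · subst h
    rw [inner_psi_self, inv_mul_cancel₀]
    exact_mod_cast (psiSq_pos j).ne'
  · rw [inner_psi_of_ne (Ne.symm h), mul_zero]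

theorem proj_psi (k j : ℕ) : proj k (psi j) = if j = k then psi k else 0 := by
  split_ifs with h
  · subst h
    exact Submodule.starProjection_eq_self_iff.mpr (psi_mem_harm j)
  · rw [proj, Submodule.starProjection_apply_eq_zero_iff, Submodule.mem_orthogonal]
    exact fun u hu => inner_eq_zero_of_mem_harm (Ne.symm h) hu (psi_mem_harm j)

theorem eqOn_homSpan {E : Type*} [NormedAddCommGroup E] [NormedSpace ℂ E] {A B : L2S →L[ℂ] E}
    (h : ∀ j, A (psi j) = B (psi j)) {u : L2S} (hu : u ∈ homSpan) : A u = B u := by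
  have h1 : Submodule.span ℂ (Set.range psi) ≤ (A - B).ker := by
    rw [Submodule.span_le]
    rintro _ ⟨j, rfl⟩
    simp [h j]
  have h2 : homSpan ≤ (A - B).ker :=
    Submodule.topologicalClosure_minimal _ h1 (ContinuousLinearMap.isClosed_ker (A - B))
  have h3 := h2 hu
  rw [LinearMap.mem_ker] at h3
  exact sub_eq_zero.mp h3

theorem proj_of_mem_homSpan (k : ℕ) {u : L2S} (hu : u ∈ homSpan) :
    proj k u = hcoef k u • psi k := by
  refine eqOn_homSpan (A := proj k) (B := (hcoef k).smulRight (psi k)) (fun j => ?_) hu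
  rw [proj_psi, ContinuousLinearMap.smulRight_apply, hcoef_psi]
  split_ifs <;> simp

theorem inner_of_mem_harm {n : ℕ} {Y : L2S} (hY : Y ∈ harm n) {u : L2S} (hu : u ∈ homSpan) :
    inner ℂ Y u = hcoef n u * inner ℂ Y (psi n) := by
  refine eqOn_homSpan (A := innerSL ℂ Y) (B := inner ℂ Y (psi n) • hcoef n) (fun j => ?_) hu |>.trans
    ?_
  · simp only [innerSL_apply_apply, smul_apply, hcoef_psi]
    split_ifs with h
    · subst h; simp
    · rw [inner_eq_zero_of_mem_harm (Ne.symm h) hY (psi_mem_harm j)]; simp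
  · simp [mul_comm]

theorem eq_of_hcoef_eq {u v : L2S} (hu : u ∈ homSpan) (hv : v ∈ homSpan)
    (h : ∀ k, hcoef k u = hcoef k v) : u = v := by
  have hw : u - v ∈ homSpan := sub_mem hu hv
  have h0 : ∀ j, innerSL ℂ (u - v) (psi j) = (0 : L2S →L[ℂ] ℂ) (psi j) := by
    intro j
    have : inner ℂ (psi j) (u - v) = 0 := by rw [inner_psi_eq, map_sub, h j, sub_self, mul_zero]
    rw [innerSL_apply_apply, inner_eq_zero_symm.mp this]
    rfl
  have := eqOn_homSpan h0 hw
  rw [innerSL_apply_apply, zero_apply, inner_self_eq_zero] at this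
  exact sub_eq_zero.mp this

theorem enorm_psi_sq (k : ℕ) : ‖psi k‖ₑ ^ 2 = ENNReal.ofReal (psiSq k) := by
  rw [psiSq, ENNReal.ofReal_pow (norm_nonneg _), ofReal_norm]

theorem sobNorm_sq {u : L2S} (hu : u ∈ homSpan) :
    sobNorm (1 / 4) u ^ 2 = ∑' k, ENNReal.ofReal (bracket (freq k) ^ (2 * (1 / 4) : ℝ) * psiSq k) *
      ‖hcoef k u‖ₑ ^ 2 := by
  rw [sobNorm, ← ENNReal.rpow_natCast, ← ENNReal.rpow_mul]
  norm_num only [ENNReal.rpow_one, Nat.cast_ofNat]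
  refine tsum_congr fun k => ?_
  rw [proj_of_mem_homSpan k hu, enorm_smul, mul_pow, enorm_psi_sq,
    ENNReal.ofReal_mul (Real.rpow_nonneg (bracket_pos _).le _)]
  ring

theorem sobNorm_sq_le {u : L2S} (hu : u ∈ homSpan) :
    sobNorm (1 / 4) u ^ 2 ≤ ENNReal.ofReal (psiSq 0) * ∑' k, ‖hcoef k u‖ₑ ^ 2 := by
  rw [sobNorm_sq hu, ← ENNReal.tsum_mul_left]
  gcongr with k
  exact (sobWeight_bounds k).1

theorem le_sobNorm_sq {u : L2S} (hu : u ∈ homSpan) :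
    ENNReal.ofReal (psiSq 0 / 2) * ∑' k, ‖hcoef k u‖ₑ ^ 2 ≤ sobNorm (1 / 4) u ^ 2 := by
  rw [sobNorm_sq hu, ← ENNReal.tsum_mul_left]
  gcongr with k
  exact (sobWeight_bounds k).2

theorem tsum_hcoef_sq_le {u : L2S} (hu : u ∈ homSpan) :
    ∑' k, ‖hcoef k u‖ₑ ^ 2 ≤ (ENNReal.ofReal (psiSq 0 / 2))⁻¹ * sobNorm (1 / 4) u ^ 2 := by
  have h0 := psiSq_zero_pos
  rw [← ENNReal.div_eq_inv_mul, ENNReal.le_div_iff_mul_le (by simp [h0]) (by simp), mul_comm]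
  exact le_sobNorm_sq hu

/-! ### Orthogonal series -/

theorem summable_of_orthogonal {E : Type*} [NormedAddCommGroup E] [InnerProductSpace ℂ E]
    [CompleteSpace E] {v : ℕ → E} (h : ∀ j k, j ≠ k → inner ℂ (v j) (v k) = 0)
    (hs : ∑' k, ‖v k‖ₑ ^ 2 ≠ ∞) : Summable v := by
  have hV : OrthogonalFamily ℂ (fun k => Submodule.span ℂ {v k})
      (fun k => (Submodule.span ℂ {v k}).subtypeₗᵢ) := by
    intro j k hjk x y
    obtain ⟨a, ha⟩ := Submodule.mem_span_singleton.mp x.2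
    obtain ⟨b, hb⟩ := Submodule.mem_span_singleton.mp y.2
    simp only [Submodule.coe_subtypeₗᵢ, Submodule.subtype_apply]
    rw [← ha, ← hb, inner_smul_left, inner_smul_right, h j k hjk]
    simp
  have h1 := (hV.summable_iff_norm_sq_summable
    (fun k => ⟨v k, Submodule.mem_span_singleton_self _⟩)).mpr ?_
  · simpa using h1
  · have h2 : ∀ k, ‖v k‖ₑ ^ 2 = ENNReal.ofReal (‖v k‖ ^ 2) := fun k => by
      rw [ENNReal.ofReal_pow (norm_nonneg _), ofReal_norm]
    simp_rw [h2] at hs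
    have := ENNReal.summable_toReal hs
    refine this.congr fun k => ?_
    rw [ENNReal.toReal_ofReal (by positivity)]
    rfl

theorem psiSq_le (k : ℕ) : psiSq k ≤ psiSq 0 := by
  refine (pow_le_pow_iff_left₀ (psiSq_nonneg k) (psiSq_nonneg 0) (two_ne_zero)).mp
    (le_trans ?_ (psiSq_bounds k).1)
  have : (0 : ℝ) ≤ psiSq k ^ 2 * k := by positivity
  linarith

theorem summable_smul_psi {a : ℕ → ℂ} (ha : ∑' k, ‖a k‖ₑ ^ 2 ≠ ∞) :
    Summable fun k => a k • psi k := by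
  refine summable_of_orthogonal (fun j k hjk => ?_) ?_
  · rw [inner_smul_left, inner_smul_right, inner_psi_of_ne hjk]
    simp
  · refine ne_top_of_le_ne_top (ENNReal.mul_ne_top (b := ENNReal.ofReal (psiSq 0)) ha (by simp)) ?_
    rw [← ENNReal.tsum_mul_right]
    gcongr with k
    rw [enorm_smul, mul_pow, enorm_psi_sq]
    gcongr
    exact psiSq_le k

/-- The function `∑ₖ aₖ (x₁ + i x₂)^k` on the sphere. -/
noncomputable def synth (a : ℕ → ℂ) : L2S := ∑' k, a k • psi k

theorem synth_mem_homSpan (a : ℕ → ℂ) : synth a ∈ homSpan := by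
  by_cases h : Summable fun k => a k • psi k
  · refine isClosed_homSpan.mem_of_tendsto h.hasSum (Eventually.of_forall fun s => ?_)
    exact sum_mem fun k _ => Submodule.smul_mem _ _ (psi_mem_homSpan k)
  · rw [synth, tsum_eq_zero_of_not_summable h]
    exact zero_mem _

theorem hcoef_synth {a : ℕ → ℂ} (ha : ∑' k, ‖a k‖ₑ ^ 2 ≠ ∞) (k : ℕ) : hcoef k (synth a) = a k := by
  rw [synth, (hcoef k).map_tsum (summable_smul_psi ha), tsum_eq_single k]
  · simp [hcoef_psi]
  · intro j hj
    simp [hcoef_psi, hj]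

theorem synth_hcoef {u : L2S} (hu : u ∈ homSpan) (h : ∑' k, ‖hcoef k u‖ₑ ^ 2 ≠ ∞) :
    synth (fun k => hcoef k u) = u :=
  eq_of_hcoef_eq (synth_mem_homSpan _) hu fun k => hcoef_synth h k

/-! ### Products of functions in the closed span -/

theorem tendsto_psiSq : Tendsto psiSq atTop (𝓝 0) := by
  have h : Tendsto (fun k : ℕ => psiSq 0 ^ 2 / (k + 1 : ℝ)) atTop (𝓝 0) :=
    tendsto_const_div_atTop_nhds_zero_nat (psiSq 0 ^ 2) |>.comp (tendsto_add_atTop_nat 1) |>.congr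
      fun k => by simp
  have h2 : Tendsto (fun k => psiSq k ^ 2) atTop (𝓝 0) := by
    refine squeeze_zero (fun k => by positivity) (fun k => ?_) h
    rw [le_div_iff₀ (by positivity)]
    exact (psiSq_bounds k).1
  have h3 := h2.sqrt
  rw [Real.sqrt_zero] at h3
  exact h3.congr fun k => Real.sqrt_sq (psiSq_nonneg k)

/-- Where |z| ≥ 1 every |ψₖ|² is at least 1, so the measure of this set is at most ‖ψₖ‖², which
tends to 0. -/
theorem ae_norm_zFun_lt_one : ∀ᵐ x ∂surf, ‖zFun x‖ < 1 := by
  rw [ae_iff]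
  have hle : ∀ k, surf {x | ¬‖zFun x‖ < 1} ≤ ENNReal.ofReal (psiSq k) := by
    intro k
    rw [← enorm_psi_sq, ← lintegral_enorm_sq_Lp]
    have hm : MeasurableSet {x : S2 | ¬‖zFun x‖ < 1} :=
      (measurableSet_lt continuous_zFun.norm.measurable measurable_const).compl
    rw [← lintegral_indicator_one hm]
    refine lintegral_mono_ae ?_
    filter_upwards [coeFn_psi k] with x hx
    rw [hx]
    by_cases h : ‖zFun x‖ < 1
    · simp [h]
    · rw [indicator_of_mem (by exact h), Pi.one_apply, enorm_pow]
      have : 1 ≤ ‖zFun x‖ₑ := by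
        rw [← ofReal_norm, ENNReal.one_le_ofReal]
        exact not_lt.mp h
      exact one_le_pow₀ (one_le_pow₀ this)
  have h0 : Tendsto (fun k => ENNReal.ofReal (psiSq k)) atTop (𝓝 0) := by
    simpa using ENNReal.tendsto_ofReal tendsto_psiSq
  exact le_antisymm (ge_of_tendsto' h0 hle) (zero_le)

theorem norm_le_of_tsum {a : ℕ → ℂ} (ha : ∑' k, ‖a k‖ₑ ^ 2 ≠ ∞) :
    ∃ C : ℝ, 0 ≤ C ∧ ∀ k, ‖a k‖ ≤ C := by
  refine ⟨Real.sqrt (∑' k, ‖a k‖ₑ ^ 2).toReal, Real.sqrt_nonneg _, fun k => Real.le_sqrt_of_sq_le ?_⟩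
  have h : ‖a k‖ₑ ^ 2 ≤ ∑' k, ‖a k‖ₑ ^ 2 := ENNReal.le_tsum (f := fun k => ‖a k‖ₑ ^ 2) k
  have := ENNReal.toReal_mono ha h
  simpa using this

theorem summable_norm_mul_pow {a : ℕ → ℂ} (ha : ∑' k, ‖a k‖ₑ ^ 2 ≠ ∞) {z : ℂ} (hz : ‖z‖ < 1) :
    Summable fun k => ‖a k * z ^ k‖ := by
  obtain ⟨C, hC, h⟩ := norm_le_of_tsum ha
  refine Summable.of_nonneg_of_le (fun k => norm_nonneg _) (fun k => ?_)
    ((summable_geometric_of_lt_one (norm_nonneg z) hz).mul_left C)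
  rw [norm_mul, norm_pow]
  gcongr
  exact h k

/-- A subsequence of the partial sums converges almost everywhere to the L² sum, and for |z| < 1 the
power series converges because its coefficients are bounded. -/
theorem coeFn_synth {a : ℕ → ℂ} (ha : ∑' k, ‖a k‖ₑ ^ 2 ≠ ∞) :
    ∀ᵐ x ∂surf, synth a x = ∑' k, a k * zFun x ^ k := by
  have h1 := (summable_smul_psi ha).hasSum.tendsto_sum_nat
  obtain ⟨ns, hns, h2⟩ := (tendstoInMeasure_of_tendsto_Lp h1).exists_seq_tendsto_ae
  have h3 : ∀ᵐ x ∂surf, ∀ N, (∑ k ∈ Finset.range N, a k • psi k : L2S) x =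
      ∑ k ∈ Finset.range N, a k * zFun x ^ k := by
    rw [ae_all_iff]
    intro N
    have h4 : ∀ᵐ x ∂surf, ∀ k, (a k • psi k : L2S) x = a k * zFun x ^ k := by
      rw [ae_all_iff]
      intro k
      filter_upwards [Lp.coeFn_smul (a k) (psi k), coeFn_psi k] with x hx hx'
      rw [hx, Pi.smul_apply, hx', smul_eq_mul]
    filter_upwards [Lp.coeFn_fun_finsetSum (Finset.range N) (fun k => a k • psi k), h4] with x hx hx'
    rw [hx]
    exact Finset.sum_congr rfl fun k _ => hx' k
  filter_upwards [h2, h3, ae_norm_zFun_lt_one] with x hx hx' hz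
  have h5 := (summable_norm_mul_pow ha hz).of_norm.hasSum.tendsto_sum_nat.comp hns.tendsto_atTop
  refine tendsto_nhds_unique hx (h5.congr fun i => ?_)
  rw [Function.comp_apply, hx']

theorem synth_mul_synth {a b : ℕ → ℂ} (ha : ∑' k, ‖a k‖ₑ ^ 2 ≠ ∞) (hb : ∑' k, ‖b k‖ₑ ^ 2 ≠ ∞)
    (hab : ∑' k, ‖sconv a b k‖ₑ ^ 2 ≠ ∞) :
    ∀ᵐ x ∂surf, synth a x * synth b x = synth (sconv a b) x := by
  filter_upwards [coeFn_synth ha, coeFn_synth hb, coeFn_synth hab, ae_norm_zFun_lt_one] with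
    x h1 h2 h3 hz
  rw [h1, h2, h3, tsum_mul_tsum_eq_tsum_sum_antidiagonal_of_summable_norm
    (summable_norm_mul_pow ha hz) (summable_norm_mul_pow hb hz)]
  refine tsum_congr fun n => ?_
  rw [sconv, Finset.sum_mul]
  refine Finset.sum_congr rfl fun p hp => ?_
  rw [← (mem_antidiag.mp hp : p.1 + p.2 = n), pow_add]
  ring

theorem integrable_cube_synth {a : ℕ → ℂ} (ha : ∑' k, ‖a k‖ₑ ^ 2 ≠ ∞)
    (hb : ∑' k, ‖sconv a a k‖ₑ ^ 2 ≠ ∞) : Integrable (fun x => synth a x ^ 3) surf := by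
  have h : Integrable (fun x => synth (sconv a a) x * synth a x) surf :=
    (Lp.memLp (synth (sconv a a))).integrable_mul (Lp.memLp (synth a))
  refine h.congr ?_
  filter_upwards [synth_mul_synth ha ha hb] with x hx
  rw [← hx]
  ring

theorem hasSum_inner_synth {a : ℕ → ℂ} (ha : ∑' k, ‖a k‖ₑ ^ 2 ≠ ∞) (Q : L2S) :
    HasSum (fun k => a k * inner ℂ Q (psi k)) (inner ℂ Q (synth a)) := by
  have := (summable_smul_psi ha).hasSum.mapL (innerSL ℂ Q)
  simpa [inner_smul_right, synth] using this

/-- Pairing conj(p) z^j with ψₖ is pairing p with ψⱼ₊ₖ, and orthogonality leaves only j + k = n. -/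
theorem integral_conj_mul_synth_mul_pow {n : ℕ} {p : MvPolynomial (Fin 3) ℂ}
    (hp : p ∈ harmonicPoly n) {a : ℕ → ℂ} (ha : ∑' k, ‖a k‖ₑ ^ 2 ≠ ∞) (j : ℕ) :
    ∫ x : S2, starRingEnd ℂ (polyFun p x) * synth a x * zFun x ^ j ∂surf =
      if j ≤ n then a (n - j) * inner ℂ (restrictPoly p) (psi n) else 0 := by
  set Q : L2S := restrictPoly (p * (zPoly ^ j).map (starRingEnd ℂ)) with hQ
  have hQae := coeFn_restrictPoly (p * (zPoly ^ j).map (starRingEnd ℂ))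
  have key : ∀ u : L2S, inner ℂ Q u =
      ∫ x : S2, starRingEnd ℂ (polyFun p x) * u x * zFun x ^ j ∂surf := by
    intro u
    rw [L2.inner_def]
    refine integral_congr_ae ?_
    filter_upwards [hQae] with x hx
    rw [hx, polyFun_mul, polyFun_map_conj, RCLike.inner_apply, map_mul, polyFun_pow, zFun]
    simp
    ring
  rw [← key]
  have h1 : ∀ k, inner ℂ Q (psi k) = inner ℂ (restrictPoly p) (psi (j + k)) := by
    intro k
    rw [key, L2.inner_def]
    refine integral_congr_ae ?_
    filter_upwards [coeFn_psi k, coeFn_psi (j + k), coeFn_restrictPoly p] with x h1 h2 h3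
    rw [h1, h2, h3, RCLike.inner_apply, pow_add]
    ring
  have hY : restrictPoly p ∈ harm n := ⟨p, hp, rfl⟩
  have h2 := (hasSum_inner_synth ha Q).tsum_eq
  simp_rw [h1] at h2
  rw [← h2]
  split_ifs with hj
  · rw [tsum_eq_single (n - j)]
    · rw [Nat.add_sub_cancel' hj]
    · intro k hk
      rw [inner_eq_zero_of_mem_harm (by omega) hY (psi_mem_harm _), mul_zero]
  · refine (tsum_congr fun k => ?_).trans tsum_zero
    rw [inner_eq_zero_of_mem_harm (by omega) hY (psi_mem_harm _), mul_zero]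

/-- The product need only be in L¹: one factor is absorbed with Y into an L² function, the other is
expanded in its L² series, and only the degrees j ≤ n contribute. Hence it applies to u² · u, though
u³ may fail to be in L². -/
theorem integral_conj_mul_synth_mul_synth {n : ℕ} {Y : L2S} (hY : Y ∈ harm n) {a b : ℕ → ℂ}
    (ha : ∑' k, ‖a k‖ₑ ^ 2 ≠ ∞) (hb : ∑' k, ‖b k‖ₑ ^ 2 ≠ ∞) :
    ∫ x : S2, starRingEnd ℂ (Y x) * (synth b x * synth a x) ∂surf =
      sconv b a n * inner ℂ Y (psi n) := by
  obtain ⟨p, hp, rfl⟩ := hY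
  set V : S2 → ℂ := fun x => polyFun p x * starRingEnd ℂ (synth a x) with hV
  have hpc : Continuous fun x : S2 => polyFun p x :=
    (continuous_polyFun p).comp continuous_subtype_val
  have hVm : MemLp V 2 surf := by
    obtain ⟨C, hC⟩ := isCompact_univ.exists_bound_of_continuousOn hpc.continuousOn
    refine MemLp.of_le_mul (c := C) (Lp.memLp (synth a)) ?_ (Eventually.of_forall fun x => ?_)
    · exact hpc.aestronglyMeasurable.mul
        (Complex.continuous_conj.comp_aestronglyMeasurable (Lp.memLp (synth a)).1)
    · rw [hV, norm_mul, RCLike.norm_conj]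
      gcongr
      exact hC x (mem_univ x)
  have key : ∀ u : L2S, inner ℂ hVm.toLp u =
      ∫ x : S2, starRingEnd ℂ (polyFun p x) * synth a x * u x ∂surf := by
    intro u
    rw [L2.inner_def]
    refine integral_congr_ae ?_
    filter_upwards [hVm.coeFn_toLp] with x hx
    rw [hx, RCLike.inner_apply, hV, map_mul]
    simp
    ring
  have e1 : ∫ x : S2, starRingEnd ℂ (restrictPoly p x) * (synth b x * synth a x) ∂surf =
      inner ℂ hVm.toLp (synth b) := by
    rw [key]
    refine integral_congr_ae ?_
    filter_upwards [coeFn_restrictPoly p] with x hx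
    rw [hx]
    ring
  have e2 : ∀ j, inner ℂ hVm.toLp (psi j) =
      if j ≤ n then a (n - j) * inner ℂ (restrictPoly p) (psi n) else 0 := by
    intro j
    rw [key, ← integral_conj_mul_synth_mul_pow hp ha]
    refine integral_congr_ae ?_
    filter_upwards [coeFn_psi j] with x hx
    rw [hx]
  rw [e1, ← (hasSum_inner_synth hb _).tsum_eq, tsum_eq_sum (s := Finset.range (n + 1))]
  · rw [sconv, Finset.Nat.sum_antidiagonal_eq_sum_range_succ (fun i j => b i * a j),
      Finset.sum_mul]
    refine Finset.sum_congr rfl fun j hj => ?_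
    rw [e2, if_pos (by simpa [Nat.lt_succ_iff] using hj)]
    ring
  · intro j hj
    rw [e2, if_neg (by simpa [Nat.lt_succ_iff] using hj), mul_zero]

theorem integral_conj_mul_cube_synth {n : ℕ} {Y : L2S} (hY : Y ∈ harm n) {a : ℕ → ℂ}
    (ha : ∑' k, ‖a k‖ₑ ^ 2 ≠ ∞) (hb : ∑' k, ‖sconv a a k‖ₑ ^ 2 ≠ ∞) :
    ∫ x : S2, starRingEnd ℂ (Y x) * synth a x ^ 3 ∂surf = cubic a n * inner ℂ Y (psi n) := by
  rw [cubic, ← integral_conj_mul_synth_mul_synth hY ha hb]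
  refine integral_congr_ae ?_
  filter_upwards [synth_mul_synth ha ha hb] with x hx
  rw [← hx]
  ring

/-! ### Space-time functions and families of coefficients -/

theorem bracket_le_wt (n : ℕ) (ξ : ℝ) : bracket (2 * Real.pi * ξ + freq n ^ 2) ≤ wt n ξ := by
  rw [freq_sq, bracket, wt]
  refine Real.sqrt_le_left (by positivity) |>.mpr ?_
  push_cast
  nlinarith [abs_nonneg (2 * Real.pi * ξ + (n : ℝ) * (n + 1)),
    sq_abs (2 * Real.pi * ξ + (n : ℝ) * (n + 1))]

theorem wt_le_bracket (n : ℕ) (ξ : ℝ) : wt n ξ ≤ 2 * bracket (2 * Real.pi * ξ + freq n ^ 2) := by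
  rw [freq_sq, bracket, wt]
  have h1 : (1 : ℝ) ≤ √(1 + (2 * Real.pi * ξ + (n : ℝ) * (n + 1)) ^ 2) :=
    Real.one_le_sqrt.mpr (by nlinarith)
  have h2 : |2 * Real.pi * ξ + (n : ℝ) * (n + 1)| ≤
      √(1 + (2 * Real.pi * ξ + (n : ℝ) * (n + 1)) ^ 2) := by
    refine Real.abs_le_sqrt (by linarith)
  push_cast
  linarith

theorem xWeight_eq (n : ℕ) (ξ : ℝ) :
    (bracket (2 * Real.pi * ξ + freq n ^ 2) ^ (9 / 16 : ℝ) * bracket (freq n) ^ (1 / 4 : ℝ)) ^ 2 =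
      bracket (2 * Real.pi * ξ + freq n ^ 2) ^ (9 / 8 : ℝ) *
        bracket (freq n) ^ (2 * (1 / 4) : ℝ) := by
  have e : ∀ x s : ℝ, 0 < x → (x ^ s) ^ 2 = x ^ (2 * s) := fun x s hx => by
    rw [← Real.rpow_natCast, ← Real.rpow_mul hx.le, mul_comm, Nat.cast_ofNat]
  rw [mul_pow, e _ _ (bracket_pos _), e _ _ (bracket_pos _)]
  norm_num

theorem xWeight_mul_le (n : ℕ) (ξ : ℝ) :
    (bracket (2 * Real.pi * ξ + freq n ^ 2) ^ (9 / 16 : ℝ) * bracket (freq n) ^ (1 / 4 : ℝ)) ^ 2 *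
      psiSq n ≤ psiSq 0 * wt n ξ ^ (9 / 8 : ℝ) := by
  rw [xWeight_eq, mul_assoc, mul_comm]
  have h0 := psiSq_pos n
  have h1 := Real.rpow_nonneg (bracket_pos (freq n)).le (2 * (1 / 4))
  gcongr
  · exact Real.rpow_nonneg (bracket_pos _).le _
  · exact psiSq_zero_pos.le
  · exact (sobWeight_bounds n).1
  · exact (bracket_pos _).le
  · exact bracket_le_wt n ξ

theorem le_xWeight_mul (n : ℕ) (ξ : ℝ) :
    psiSq 0 / 8 * wt n ξ ^ (9 / 8 : ℝ) ≤
    (bracket (2 * Real.pi * ξ + freq n ^ 2) ^ (9 / 16 : ℝ) * bracket (freq n) ^ (1 / 4 : ℝ)) ^ 2 *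
      psiSq n := by
  rw [xWeight_eq, mul_assoc]
  have h0 := psiSq_zero_pos
  have h2 := Real.rpow_nonneg (bracket_pos (2 * Real.pi * ξ + freq n ^ 2)).le (9 / 8)
  have h3 : wt n ξ ^ (9 / 8 : ℝ) ≤ 4 * bracket (2 * Real.pi * ξ + freq n ^ 2) ^ (9 / 8 : ℝ) := by
    calc wt n ξ ^ (9 / 8 : ℝ) ≤ (2 * bracket (2 * Real.pi * ξ + freq n ^ 2)) ^ (9 / 8 : ℝ) :=
          Real.rpow_le_rpow (wt_pos _ _).le (wt_le_bracket n ξ) (by norm_num)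
      _ = 2 ^ (9 / 8 : ℝ) * bracket (2 * Real.pi * ξ + freq n ^ 2) ^ (9 / 8 : ℝ) :=
          Real.mul_rpow (by norm_num) (bracket_pos _).le
      _ ≤ _ := by
          gcongr
          calc (2 : ℝ) ^ (9 / 8 : ℝ) ≤ 2 ^ (2 : ℝ) :=
                Real.rpow_le_rpow_of_exponent_le (by norm_num) (by norm_num)
            _ = 4 := by norm_num
  calc psiSq 0 / 8 * wt n ξ ^ (9 / 8 : ℝ)
      ≤ psiSq 0 / 8 * (4 * bracket (2 * Real.pi * ξ + freq n ^ 2) ^ (9 / 8 : ℝ)) := by gcongr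
    _ = bracket (2 * Real.pi * ξ + freq n ^ 2) ^ (9 / 8 : ℝ) * (psiSq 0 / 2) := by ring
    _ ≤ _ := by gcongr; exact (sobWeight_bounds n).2

theorem xNorm_sq (f : Lp L2S 2 (volume : Measure ℝ)) :
    xNorm (1 / 4) (9 / 16) f ^ 2 = ∑' k : ℕ, ∫⁻ ξ : ℝ,
      ENNReal.ofReal ((bracket (2 * Real.pi * ξ + freq k ^ 2) ^ (9 / 16 : ℝ) *
        bracket (freq k) ^ (1 / 4 : ℝ)) ^ 2) *
      ‖proj k ((𝓕 f : Lp L2S 2 (volume : Measure ℝ)) ξ)‖ₑ ^ 2 := by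
  rw [xNorm, ← ENNReal.rpow_natCast, ← ENNReal.rpow_mul]
  norm_num only [ENNReal.rpow_one, Nat.cast_ofNat]
  refine tsum_congr fun k => lintegral_congr_ae ?_
  rw [fourier_compLp]
  filter_upwards [(proj k).coeFn_compLp (𝓕 f)] with ξ hξ
  rw [hξ]

theorem hcoef_proj (k : ℕ) (u : L2S) : hcoef k (proj k u) = hcoef k u := by
  rw [hcoef_apply, hcoef_apply, proj, ← Submodule.inner_starProjection_left_eq_right,
    Submodule.starProjection_eq_self_iff.mpr (psi_mem_harm k)]

/-- Cauchy–Schwarz inside 𝓗ₖ. Extensions in the definition of the restriction norm need not take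
values in the span, so `proj k u` need not be a multiple of `psi k`. -/
theorem psiSq_mul_hcoef_le (k : ℕ) (u : L2S) :
    ENNReal.ofReal (psiSq k) * ‖hcoef k u‖ₑ ^ 2 ≤ ‖proj k u‖ₑ ^ 2 := by
  have h0 := psiSq_pos k
  have hn : 0 < ‖psi k‖ := norm_pos_iff.mpr (psi_ne_zero k)
  have h : ‖psi k‖ * ‖hcoef k u‖ ≤ ‖proj k u‖ := by
    have h1 := norm_inner_le_norm (𝕜 := ℂ) (psi k) (proj k u)
    rw [inner_psi_eq, hcoef_proj, norm_mul, Complex.norm_real, Real.norm_of_nonneg h0.le, psiSq,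
      sq, mul_assoc] at h1
    exact le_of_mul_le_mul_left h1 hn
  rw [← enorm_psi_sq, ← mul_pow, ← ofReal_norm, ← ofReal_norm, ← ofReal_norm,
    ← ENNReal.ofReal_mul hn.le]
  gcongr

theorem exists_family_of_xNorm_lt_top {f : Lp L2S 2 (volume : Measure ℝ)}
    (hf : xNorm (1 / 4) (9 / 16) f < ∞) :
    ∃ g : ℕ → ℝ → ℂ, (∀ n, Measurable (g n)) ∧ xn (9 / 8) g ≠ ∞ ∧
      ∀ᵐ t, ∀ k, coef g t k = hcoef k (f t) := by
  set h : ℕ → Lp ℂ 2 (volume : Measure ℝ) := fun k => (hcoef k).compLp (𝓕 f) with hh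
  have mg : ∀ n, Measurable (h n : ℝ → ℂ) := fun n => (Lp.stronglyMeasurable (h n)).measurable
  have hS : ENNReal.ofReal (psiSq 0 / 8) ≠ 0 := by simpa using psiSq_zero_pos
  have hx : xn (9 / 8) (fun n => (h n : ℝ → ℂ)) ≠ ∞ := by
    have hle : ENNReal.ofReal (psiSq 0 / 8) * xn (9 / 8) (fun n => (h n : ℝ → ℂ)) ≤
        xNorm (1 / 4) (9 / 16) f ^ 2 := by
      rw [xNorm_sq, xn, ← ENNReal.tsum_mul_left]
      refine ENNReal.tsum_le_tsum fun k => ?_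
      rw [← lintegral_const_mul' _ _ (by simp)]
      refine lintegral_mono_ae ?_
      filter_upwards [(hcoef k).coeFn_compLp (𝓕 f)] with ξ hξ
      have hξ' : (h k : ℝ → ℂ) ξ = hcoef k ((𝓕 f : Lp L2S 2 (volume : Measure ℝ)) ξ) := hξ
      rw [hξ', ← mul_assoc, ← ENNReal.ofReal_mul (by linarith [psiSq_zero_pos])]
      refine (mul_le_mul' (ENNReal.ofReal_le_ofReal (le_xWeight_mul k ξ)) le_rfl).trans ?_
      rw [ENNReal.ofReal_mul (sq_nonneg _), mul_assoc]
      gcongr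
      exact psiSq_mul_hcoef_le k _
    intro htop
    rw [htop, ENNReal.mul_top hS, top_le_iff] at hle
    exact (ENNReal.pow_lt_top hf).ne hle
  refine ⟨fun n => h n, mg, hx, ?_⟩
  rw [ae_all_iff]
  intro k
  have h1 := coeFn_fourierInv (h k) (integrable_of_xn mg hx k)
  have h2 : (𝓕⁻ (h k) : Lp ℂ 2 (volume : Measure ℝ)) = (hcoef k).compLp f := by
    rw [hh]
    dsimp only
    rw [fourierInv_compLp, FourierTransform.fourierInv_fourier_eq]
  rw [h2] at h1
  filter_upwards [h1, (hcoef k).coeFn_compLp f] with t h3 h4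
  rw [coef, ← h3, h4]

/-- The orthogonal series ∑ gₖ ψₖ converges in L² of frequency with values in L²(S²), and its
inverse transform is the required function. -/
theorem exists_extension_of_xn {g : ℕ → ℝ → ℂ} (mg : ∀ n, Measurable (g n))
    (hg : xn (9 / 8) g ≠ ∞) :
    ∃ f : Lp L2S 2 (volume : Measure ℝ), (∀ᵐ t, f t = synth (coef g t)) ∧
      xNorm (1 / 4) (9 / 16) f ^ 2 ≤ ENNReal.ofReal (psiSq 0) * xn (9 / 8) g := by
  have ig := integrable_of_xn mg hg
  have hm : ∀ n, MemLp (g n) 2 (volume : Measure ℝ) := memLp_of_xn (by norm_num) mg hg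
  set h : ℕ → Lp ℂ 2 (volume : Measure ℝ) := fun n => (hm n).toLp with hh
  have hae : ∀ n, (h n : ℝ → ℂ) =ᵐ[volume] g n := fun n => (hm n).coeFn_toLp
  set T : ℕ → ℂ →L[ℂ] L2S := fun k => ContinuousLinearMap.toSpanSingleton ℂ (psi k) with hT
  set v : ℕ → Lp L2S 2 (volume : Measure ℝ) := fun k => (T k).compLp (h k) with hv
  have hvae : ∀ k, ∀ᵐ ξ, v k ξ = g k ξ • psi k := by
    intro k
    filter_upwards [(T k).coeFn_compLp (h k), hae k] with ξ h1 h2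
    rw [h1, h2, hT, ContinuousLinearMap.toSpanSingleton_apply]
  have hsum : Summable v := by
    refine summable_of_orthogonal (fun j k hjk => ?_) ?_
    · rw [L2.inner_def]
      refine integral_eq_zero_of_ae ?_
      filter_upwards [hvae j, hvae k] with ξ h1 h2
      rw [h1, h2, inner_smul_left, inner_smul_right, inner_psi_of_ne hjk]
      simp
    · have hle : ∑' k, ‖v k‖ₑ ^ 2 ≤ ENNReal.ofReal (psiSq 0) * xn 0 g := by
        rw [xn_exponent_zero, ← ENNReal.tsum_mul_left]
        refine ENNReal.tsum_le_tsum fun k => ?_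
        rw [← lintegral_enorm_sq_Lp, ← lintegral_const_mul' _ _ (by simp)]
        refine lintegral_mono_ae ?_
        filter_upwards [hvae k] with ξ h1
        rw [h1, enorm_smul, mul_pow, enorm_psi_sq, mul_comm]
        gcongr
        exact psiSq_le k
      refine ne_top_of_le_ne_top (ENNReal.mul_ne_top (by simp) ?_) hle
      exact ne_top_of_le_ne_top hg (xn_mono (by norm_num) g)
  set F : Lp L2S 2 (volume : Measure ℝ) := ∑' k, v k with hF
  have hhF : ∀ k, (hcoef k).compLp F = h k := by
    intro k
    have h1 := ((hcoef k).compLpL 2 (volume : Measure ℝ)).map_tsum hsum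
    change (hcoef k).compLp F = ∑' j, (hcoef k).compLp (v j) at h1
    rw [h1, tsum_eq_single k]
    · refine Lp.ext ?_
      filter_upwards [(hcoef k).coeFn_compLp (v k), hvae k, hae k] with ξ h2 h3 h4
      rw [h2, h3, h4, map_smul, hcoef_psi, if_pos rfl, smul_eq_mul, mul_one]
    · intro j hj
      refine Lp.ext ?_
      filter_upwards [(hcoef k).coeFn_compLp (v j), hvae j, Lp.coeFn_zero ℂ 2 (volume : Measure ℝ)]
        with ξ h2 h3 h4
      rw [h2, h3, h4, map_smul, hcoef_psi, if_neg hj, smul_zero, Pi.zero_apply]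
  have : CompleteSpace homSpan := isClosed_homSpan.completeSpace_coe
  -- Coefficients determine a function only within the closed span. The projection onto it commutes
  -- with the Fourier transform, so both F and its inverse transform take values there almost
  -- everywhere.
  set P : L2S →L[ℂ] L2S := homSpan.starProjection with hP
  have hPF : P.compLp F = F := by
    have h1 := (P.compLpL 2 (volume : Measure ℝ)).map_tsum hsum
    change P.compLp F = ∑' j, P.compLp (v j) at h1
    rw [h1]
    refine tsum_congr fun j => Lp.ext ?_
    filter_upwards [P.coeFn_compLp (v j), hvae j] with ξ h2 h3
    rw [h2, h3, map_smul, hP, Submodule.starProjection_eq_self_iff.mpr (psi_mem_homSpan j)]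
  refine ⟨𝓕⁻ F, ?_, ?_⟩
  · have hc : ∀ᵐ t, ∀ k, hcoef k ((𝓕⁻ F : Lp L2S 2 (volume : Measure ℝ)) t) = coef g t k := by
      rw [ae_all_iff]
      intro k
      have h1 := coeFn_fourierInv (h k) ((ig k).congr (hae k).symm)
      rw [← hhF k, fourierInv_compLp] at h1
      filter_upwards [h1, (hcoef k).coeFn_compLp (𝓕⁻ F)] with t h2 h3
      rw [← h3, h2, hhF, coef, fourierInv_eq_integral, fourierInv_eq_integral]
      refine integral_congr_ae ?_
      filter_upwards [hae k] with ξ hξ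
      rw [hξ]
    have hmem : ∀ᵐ t, (𝓕⁻ F : Lp L2S 2 (volume : Measure ℝ)) t ∈ homSpan := by
      have h1 : P.compLp (𝓕⁻ F) = 𝓕⁻ F := by rw [← fourierInv_compLp, hPF]
      have h2 := P.coeFn_compLp (𝓕⁻ F)
      rw [h1] at h2
      filter_upwards [h2] with t ht
      exact Submodule.starProjection_eq_self_iff.mp ht.symm
    filter_upwards [hc, hmem] with t h1 h2
    refine eq_of_hcoef_eq h2 (synth_mem_homSpan _) fun k => ?_
    rw [h1, hcoef_synth]
    exact ne_top_of_le_ne_top (ENNReal.mul_ne_top l1Const_ne_top hg) (tsum_enorm_coef_sq_le mg t)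
  · rw [xNorm_sq, FourierTransform.fourier_fourierInv_eq, xn, ← ENNReal.tsum_mul_left]
    refine ENNReal.tsum_le_tsum fun k => ?_
    rw [← lintegral_const_mul' _ _ (by simp)]
    refine lintegral_mono_ae ?_
    have h2 := P.coeFn_compLp F
    rw [hPF] at h2
    have h3 := (hcoef k).coeFn_compLp F
    rw [hhF] at h3
    filter_upwards [h2, h3, hae k] with ξ h4 h5 h6
    have hmem : F ξ ∈ homSpan := Submodule.starProjection_eq_self_iff.mp h4.symm
    rw [proj_of_mem_homSpan k hmem, ← h5, h6, enorm_smul, mul_pow ‖g k ξ‖ₑ, enorm_psi_sq,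
      ← mul_assoc, mul_right_comm, ← ENNReal.ofReal_mul (sq_nonneg _), ← mul_assoc,
      ← ENNReal.ofReal_mul psiSq_zero_pos.le]
    exact mul_le_mul' (ENNReal.ofReal_le_ofReal (xWeight_mul_le k ξ)) le_rfl

/-! ### The initial value problem -/

theorem le_rpow_half_of_sq_le {a b : ℝ≥0∞} (h : a ^ 2 ≤ b) : a ≤ b ^ (1 / 2 : ℝ) := by
  refine le_trans (le_of_eq ?_) (ENNReal.rpow_le_rpow h (by norm_num : (0 : ℝ) ≤ 1 / 2))
  rw [← ENNReal.rpow_natCast, ← ENNReal.rpow_mul]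
  norm_num

section

variable {g h : ℕ → ℝ → ℂ} (mg : ∀ n, Measurable (g n)) (hg : xn (9 / 8) g ≠ ∞)
  (mh : ∀ n, Measurable (h n)) (hh : xn (9 / 8) h ≠ ∞)

include mg hg

theorem tsum_coef_ne_top (t : ℝ) : ∑' n, ‖coef g t n‖ₑ ^ 2 ≠ ∞ :=
  ne_top_of_le_ne_top (ENNReal.mul_ne_top l1Const_ne_top hg) (tsum_enorm_coef_sq_le mg t)

theorem hcoef_synth_coef (t : ℝ) (k : ℕ) : hcoef k (synth (coef g t)) = coef g t k :=
  hcoef_synth (tsum_coef_ne_top mg hg t) k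

theorem sobNorm_synth_coef_sub_le (s t : ℝ) :
    sobNorm (1 / 4) (synth (coef g s) - synth (coef g t)) ^ 2 ≤
      ENNReal.ofReal (psiSq 0) * ∑' n, ‖coef g s n - coef g t n‖ₑ ^ 2 := by
  refine (sobNorm_sq_le (sub_mem (synth_mem_homSpan _) (synth_mem_homSpan _))).trans_eq ?_
  simp only [map_sub, hcoef_synth_coef mg hg]

theorem synth_coef_mem_Hhom (t : ℝ) : synth (coef g t) ∈ Hhom (1 / 4) := by
  refine ⟨synth_mem_homSpan _, ?_⟩
  have h1 := sobNorm_sq_le (synth_mem_homSpan (coef g t))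
  simp only [hcoef_synth_coef mg hg] at h1
  have h2 := h1.trans_lt (ENNReal.mul_lt_top (by simp) (tsum_coef_ne_top mg hg t).lt_top)
  by_contra h3
  rw [not_lt, top_le_iff] at h3
  rw [h3] at h2
  simp at h2

theorem contHhom_synth_coef (J : Set ℝ) :
    ContHhom (1 / 4) J fun t => synth (coef g t) := by
  refine ⟨fun t _ => synth_coef_mem_Hhom mg hg t, fun t _ => ?_⟩
  have h1 := ENNReal.Tendsto.const_mul (a := ENNReal.ofReal (psiSq 0))
    ((tendsto_tsum_enorm_coef_sub_sq mg hg t).mono_left (nhdsWithin_le_nhds (s := J)))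
    (Or.inr (by simp))
  have h2 := ((ENNReal.continuous_rpow_const (y := (1 / 2 : ℝ))).tendsto _).comp h1
  rw [mul_zero, ENNReal.zero_rpow_of_pos (by norm_num)] at h2
  exact tendsto_of_tendsto_of_tendsto_of_le_of_le tendsto_const_nhds h2 (fun s => zero_le)
    fun s => le_rpow_half_of_sq_le (sobNorm_synth_coef_sub_le mg hg s t)

theorem ae_integral_conj_mul_cube {k : ℕ} {Y : L2S} (hY : Y ∈ harm k) :
    ∀ᵐ t, ∫ x : S2, starRingEnd ℂ (Y x) * synth (coef g t) x ^ 3 ∂surf =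
      cubic (coef g t) k * inner ℂ Y (psi k) := by
  filter_upwards [ae_tsum_sconv_coef_ne_top mg hg] with t ht
  exact integral_conj_mul_cube_synth hY (tsum_coef_ne_top mg hg t) ht

theorem isSolution_synth_coef {α β : ℝ} (h0 : (0 : ℝ) ∈ Icc α β) (hs : SolvesOn (Icc α β) g) :
    IsSolution (Icc α β) (synth (coef g 0)) fun t => synth (coef g t) := by
  have ig := integrable_of_xn mg hg
  refine ⟨rfl, ?_, fun k Y hY => ?_, fun k Y hY t ht => ?_⟩
  · filter_upwards [ae_restrict_of_ae (ae_tsum_sconv_coef_ne_top mg hg)] with t ht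
    exact integrable_cube_synth (tsum_coef_ne_top mg hg t) ht
  · have hc : Continuous fun t => cubic (coef g t) k * inner ℂ Y (psi k) :=
      (continuous_cubic_coef ig k).mul continuous_const
    refine (hc.integrableOn_Icc (a := α) (b := β)).congr ?_
    filter_upwards [ae_restrict_of_ae (ae_integral_conj_mul_cube mg hg hY)] with t ht using ht.symm
  · have e : ∀ t, inner ℂ Y (synth (coef g t)) = coef g t k * inner ℂ Y (psi k) := fun t => by
      rw [inner_of_mem_harm hY (synth_mem_homSpan _), hcoef_synth_coef mg hg]
    rw [e, e, duhamel_of_solvesOn ig h0 hs ht k, freq_sq]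
    have e2 : (∫ s in (0 : ℝ)..t,
        Complex.exp (-Complex.I * (((t - s) * (k * (k + 1)) : ℝ) : ℂ)) *
          ∫ x : S2, starRingEnd ℂ (Y x) * synth (coef g s) x ^ 3 ∂surf) =
        (∫ s in (0 : ℝ)..t, Complex.exp (-Complex.I * (((t - s) * (k * (k + 1)) : ℝ) : ℂ)) *
          cubic (coef g s) k) * inner ℂ Y (psi k) := by
      rw [← intervalIntegral.integral_mul_const]
      refine intervalIntegral.integral_congr_ae ?_
      filter_upwards [ae_integral_conj_mul_cube mg hg hY] with s hs _
      rw [hs, mul_assoc]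
    rw [e2]
    ring

/-- Testing with ψₖ alone recovers the equation for the coefficients; the resulting integral
equation is then differentiated. -/
theorem coef_solvesOn_of_isSolution {α β : ℝ} (h0 : (0 : ℝ) ∈ Icc α β) {u₀ : L2S}
    {v : ℝ → L2S} (hv : ∀ t ∈ Icc α β, v t = synth (coef g t)) (hs : IsSolution (Icc α β) u₀ v) :
    SolvesOn (Icc α β) g := by
  have ig := integrable_of_xn mg hg
  refine solvesOn_of_duhamel ig (c := fun k => hcoef k u₀) fun t ht k => ?_
  have hk : (psiSq k : ℂ) ≠ 0 := by exact_mod_cast (psiSq_pos k).ne'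
  have h1 := hs.duhamel k (psi k) (psi_mem_harm k) t ht
  have e2 : (∫ s in (0 : ℝ)..t,
      Complex.exp (-Complex.I * (((t - s) * freq k ^ 2 : ℝ) : ℂ)) *
        ∫ x : S2, starRingEnd ℂ (psi k x) * v s x ^ 3 ∂surf) =
      (∫ s in (0 : ℝ)..t, Complex.exp (-Complex.I * (((t - s) * (k * (k + 1)) : ℝ) : ℂ)) *
        cubic (coef g s) k) * psiSq k := by
    rw [← intervalIntegral.integral_mul_const, freq_sq]
    refine intervalIntegral.integral_congr_ae ?_
    filter_upwards [ae_integral_conj_mul_cube mg hg (psi_mem_harm k)] with s hs hst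
    rw [hv s (uIcc_subset_Icc h0 ht (uIoc_subset_uIcc hst)), hs, inner_psi_self, mul_assoc]
  rw [e2, hv t ht, inner_psi_eq, inner_psi_eq, hcoef_synth_coef mg hg, freq_sq] at h1
  refine mul_left_cancel₀ hk ?_
  rw [h1]
  ring

omit hg in
theorem xNormT_le_of_xn (hg : xn (9 / 8) g ≠ ∞) (T : ℝ) {u : ℝ → L2S}
    (hu : ∀ t, u t = synth (coef g t)) :
    xNormT (1 / 4) (9 / 16) T u ^ 2 ≤ ENNReal.ofReal (psiSq 0) * xn (9 / 8) g := by
  obtain ⟨f, hf, hle⟩ := exists_extension_of_xn mg hg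
  refine le_trans ?_ hle
  gcongr
  refine iInf₂_le f (ae_restrict_of_ae ?_)
  filter_upwards [hf] with t ht
  rw [ht, hu]

include mh hh

theorem synth_coef_sub (t : ℝ) :
    synth (coef g t) - synth (coef h t) = synth (coef (g - h) t) := by
  rw [coef_sub (integrable_of_xn mg hg) (integrable_of_xn mh hh)]
  have h1 := summable_smul_psi (tsum_coef_ne_top mg hg t)
  have h2 := summable_smul_psi (tsum_coef_ne_top mh hh t)
  rw [synth, synth, synth, ← h1.tsum_sub h2]
  simp [sub_smul]

end

theorem continuousOn_hcoef {J : Set ℝ} {v : ℝ → L2S} (hv : ContHhom (1 / 4) J v) (k : ℕ) :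
    ContinuousOn (fun t => hcoef k (v t)) J := by
  intro t ht
  rw [ContinuousWithinAt, tendsto_iff_edist_tendsto_0]
  have h1 : Tendsto (fun s => (ENNReal.ofReal (psiSq 0 / 2))⁻¹ * sobNorm (1 / 4) (v s - v t) ^ 2)
      (𝓝[J] t) (𝓝 0) := by
    have h2 := ((ENNReal.continuous_pow 2).tendsto _).comp (hv.2 t ht)
    have h3 := ENNReal.Tendsto.const_mul (a := (ENNReal.ofReal (psiSq 0 / 2))⁻¹) h2
      (Or.inr (by simpa using psiSq_zero_pos))
    simpa using h3
  have h2 := ((ENNReal.continuous_rpow_const (y := (1 / 2 : ℝ))).tendsto _).comp h1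
  rw [ENNReal.zero_rpow_of_pos (by norm_num)] at h2
  refine tendsto_of_tendsto_of_tendsto_of_le_of_le' tendsto_const_nhds h2
    (Eventually.of_forall fun s => zero_le) ?_
  filter_upwards [self_mem_nhdsWithin] with s hs
  refine le_rpow_half_of_sq_le ?_
  rw [edist_eq_enorm_sub, ← map_sub]
  exact (ENNReal.le_tsum (f := fun k => ‖hcoef k (v s - v t)‖ₑ ^ 2) k).trans
    (tsum_hcoef_sq_le (sub_mem (hv.1 s hs).1 (hv.1 t ht).1))

theorem exists_family_of_contHhom {a T : ℝ} (hT : 0 < T) (ha : a ∈ Icc 0 T) {v : ℝ → L2S}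
    (hc : ContHhom (1 / 4) (Icc (-a) T) v) (hv : xNormT (1 / 4) (9 / 16) T v < ∞) :
    ∃ g : ℕ → ℝ → ℂ, (∀ n, Measurable (g n)) ∧ xn (9 / 8) g ≠ ∞ ∧
      ∀ t ∈ Icc (-a) T, v t = synth (coef g t) := by
  rw [xNormT, iInf_lt_iff] at hv
  obtain ⟨f, hf⟩ := hv
  rw [iInf_lt_iff] at hf
  obtain ⟨hfv, hf⟩ := hf
  obtain ⟨g, mg, hg, hae⟩ := exists_family_of_xNorm_lt_top hf
  refine ⟨g, mg, hg, fun t ht => ?_⟩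
  have hfv' := ae_restrict_of_ae_restrict_of_subset
    (Icc_subset_Icc_left (neg_le_neg ha.2) : Icc (-a) T ⊆ Icc (-T) T) hfv
  refine eq_of_hcoef_eq (hc.1 t ht).1 (synth_mem_homSpan _) fun k => ?_
  rw [hcoef_synth_coef mg hg]
  -- The extension agrees with v only almost everywhere. Continuity of the coefficients on both
  -- sides upgrades this to every time, as the interval is nondegenerate.
  refine Measure.eqOn_Icc_of_ae_eq volume (by linarith [ha.1] : -a ≠ T) ?_ (continuousOn_hcoef hc k)
    (continuous_coef (integrable_of_xn mg hg) k).continuousOn ht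
  filter_upwards [hfv', ae_restrict_of_ae hae] with s h1 h2
  rw [h2, h1]

theorem le_toNNReal_mul_of_sq_le {K a b : ℝ≥0∞} (hK : K ≠ ∞) (h : a ^ 2 ≤ K * b ^ 2) :
    a ≤ ((K ^ (1 / 2 : ℝ)).toNNReal : ℝ≥0∞) * b := by
  refine (le_rpow_half_of_sq_le h).trans_eq ?_
  rw [ENNReal.mul_rpow_of_nonneg _ _ (by norm_num : (0 : ℝ) ≤ 1 / 2), ← ENNReal.rpow_natCast,
    ← ENNReal.rpow_mul, ENNReal.coe_toNNReal (ENNReal.rpow_ne_top_of_nonneg (by norm_num) hK)]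
  norm_num

/-- A bound for the Lipschitz constant of the squared norms of solutions. -/
noncomputable def lipConst : ℝ≥0∞ :=
  ENNReal.ofReal (psiSq 0) *
    ((1 + l1Const) * (2 * duhConst * (ENNReal.ofReal (psiSq 0 / 2))⁻¹))

theorem lipConst_ne_top : lipConst ≠ ∞ := by
  have h1 := l1Const_ne_top
  have h2 := duhConst_ne_top
  have h3 : (ENNReal.ofReal (psiSq 0 / 2))⁻¹ ≠ ∞ := by simpa using psiSq_zero_pos
  unfold lipConst
  finiteness

/-- The length T depends on the data only through r, since the radius of the contraction ball does.
The factor 1 + l1Const serves both Lipschitz bounds: the restriction norm uses the 1 and the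
supremum in time uses l1Const. -/
theorem exists_solution_map (r : ℝ) :
    ∃ T : ℝ, 0 < T ∧ T ≤ 1 ∧ ∃ G : L2S → ℕ → ℝ → ℂ,
      (∀ u ∈ Hhom (1 / 4), sobNorm (1 / 4) u < ENNReal.ofReal r →
        (∀ n, Measurable (G u n)) ∧ xn (9 / 8) (G u) ≠ ∞ ∧ synth (coef (G u) 0) = u ∧
          (coef (G u) 0 = fun k => hcoef k u) ∧ SolvesOn (Icc (-T) T) (G u)) ∧
      ∀ u ∈ Hhom (1 / 4), sobNorm (1 / 4) u < ENNReal.ofReal r →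
        ∀ v ∈ Hhom (1 / 4), sobNorm (1 / 4) v < ENNReal.ofReal r →
          ENNReal.ofReal (psiSq 0) * ((1 + l1Const) * xn (9 / 8) (G u - G v)) ≤
            lipConst * sobNorm (1 / 4) (u - v) ^ 2 := by
  have hS : (ENNReal.ofReal (psiSq 0 / 2))⁻¹ ≠ ∞ := by simpa using psiSq_zero_pos
  have hD := duhConst_ne_top
  set B : ℝ≥0∞ := (ENNReal.ofReal (psiSq 0 / 2))⁻¹ * ENNReal.ofReal r ^ 2 with hB
  -- B bounds the squared ℓ² norm of the coefficients of any datum of norm below r, and M is the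
  -- radius that `exists_fixed_point` then requires.
  set M : ℝ≥0∞ := 2 * duhConst * B with hM
  have hMt : M ≠ ∞ := by rw [hM, hB]; finiteness
  obtain ⟨l, hl, hl1, hs⟩ := exists_small_length
    (A := duhConst * srcConst * (1 + (M + M) ^ 2)) (by
      have := srcConst_ne_top
      finiteness)
  have hu : ∀ u ∈ Hhom (1 / 4), sobNorm (1 / 4) u < ENNReal.ofReal r →
      ∑' k, ‖hcoef k u‖ₑ ^ 2 ≤ B := fun u hu hr => by
    refine (tsum_hcoef_sq_le hu.1).trans ?_
    rw [hB]
    gcongr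
  have ex : ∀ u : L2S, ∃ g : ℕ → ℝ → ℂ, u ∈ Hhom (1 / 4) →
      sobNorm (1 / 4) u < ENNReal.ofReal r → (∀ n, Measurable (g n)) ∧ xn (9 / 8) g ≤ M ∧
        ∀ n, g n =ᵐ[volume] duhamel 0 (fun k => hcoef k u) (source 0 l g) n := by
    intro u
    by_cases h : u ∈ Hhom (1 / 4) ∧ sobNorm (1 / 4) u < ENNReal.ofReal r
    · obtain ⟨g, hg⟩ := exists_fixed_point hMt hl hl1 hs (c := fun k => hcoef k u) (by
        rw [hM]
        gcongr
        exact hu u h.1 h.2)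
      exact ⟨g, fun _ _ => hg⟩
    · exact ⟨0, fun h1 h2 => absurd ⟨h1, h2⟩ h⟩
  choose G hG using ex
  refine ⟨l, hl, hl1, G, fun u h1 h2 => ?_, fun u h1 h2 v h3 h4 => ?_⟩
  · obtain ⟨mg, bg, eg⟩ := hG u h1 h2
    have hg := ne_top_of_le_ne_top hMt bg
    obtain ⟨e0, es⟩ := solvesOn_of_fixed_point hl hl1 mg hg eg
    refine ⟨mg, hg, ?_, e0, es⟩
    rw [e0, synth_hcoef h1.1]
    exact ne_top_of_le_ne_top (by rw [hB]; finiteness) (hu u h1 h2)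
  · obtain ⟨mg, bg, eg⟩ := hG u h1 h2
    obtain ⟨mh, bh, eh⟩ := hG v h3 h4
    have h5 := xn_sub_le_of_fixed_point hMt hl hl1 hs mg mh bg bh eg eh
    have h6 := tsum_hcoef_sq_le (sub_mem h1.1 h3.1)
    simp only [map_sub] at h6
    rw [lipConst]
    calc _ ≤ ENNReal.ofReal (psiSq 0) * ((1 + l1Const) * (2 * duhConst *
          ((ENNReal.ofReal (psiSq 0 / 2))⁻¹ * sobNorm (1 / 4) (u - v) ^ 2))) := by
          gcongr
          exact h5.trans (by gcongr)
      _ = _ := by ring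

end SphereNLS

theorem theorem1p2 (r : ℝ) (hr : 0 < r) :
    ∃ b T : ℝ, 1 / 2 < b ∧ 0 < T ∧
      ∃ (L : ℝ≥0) (S : L2S → ℝ → L2S),
        (∀ u₀ ∈ Hhom (1 / 4), sobNorm (1 / 4) u₀ < ENNReal.ofReal r →
          (ContHhom (1 / 4) (Icc (-T) T) (S u₀) ∧
            xNormT (1 / 4) b T (S u₀) < ∞ ∧
            IsSolution (Icc (-T) T) u₀ (S u₀)) ∧
          ∀ a ∈ Icc 0 T, ∀ v : ℝ → L2S,
            ContHhom (1 / 4) (Icc (-a) T) v →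
            xNormT (1 / 4) b T v < ∞ →
            IsSolution (Icc (-a) T) u₀ v →
            EqOn v (S u₀) (Icc (-a) T)) ∧
        (∀ u₀ ∈ Hhom (1 / 4), sobNorm (1 / 4) u₀ < ENNReal.ofReal r →
          ∀ v₀ ∈ Hhom (1 / 4), sobNorm (1 / 4) v₀ < ENNReal.ofReal r →
            (∀ t ∈ Icc (-T) T,
              sobNorm (1 / 4) (S u₀ t - S v₀ t) ≤ L * sobNorm (1 / 4) (u₀ - v₀)) ∧
            xNormT (1 / 4) b T (S u₀ - S v₀) ≤ L * sobNorm (1 / 4) (u₀ - v₀)) := by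
  obtain ⟨T, hT, hT1, G, hG, hLip⟩ := exists_solution_map r
  -- b is half of the exponent 9/8, since `xn` carries the weight of the squared norm.
  refine ⟨9 / 16, T, by norm_num, hT, (lipConst ^ (1 / 2 : ℝ)).toNNReal,
    fun u t => synth (coef (G u) t), fun u₀ hu hur => ?_, fun u₀ hu hur v₀ hv hvr => ?_⟩
  · obtain ⟨mg, hg, e0, ec, hs⟩ := hG u₀ hu hur
    have h0T : (0 : ℝ) ∈ Icc (-T) T := ⟨by linarith, hT.le⟩
    refine ⟨⟨contHhom_synth_coef mg hg _, ?_, ?_⟩, fun a ha v hvc hvx hvs => ?_⟩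
    · have h1 := xNormT_le_of_xn mg hg T (u := fun t => synth (coef (G u₀) t)) fun t => rfl
      have h2 := h1.trans_lt (ENNReal.mul_lt_top (by simp) hg.lt_top)
      by_contra h3
      rw [not_lt, top_le_iff] at h3
      rw [h3] at h2
      simp at h2
    · have h1 := isSolution_synth_coef mg hg h0T hs
      rwa [e0] at h1
    -- The competitor v need not lie in the contraction ball: `coef_eq_of_solvesOn` picks its own
    -- step from the norms of both families.
    · obtain ⟨h, mh, hh, hvh⟩ := exists_family_of_contHhom hT ha hvc hvx
      have h0a : (0 : ℝ) ∈ Icc (-a) T := ⟨by linarith [ha.1], hT.le⟩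
      have hsub : Icc (-a) T ⊆ Icc (-T) T := Icc_subset_Icc_left (neg_le_neg ha.2)
      have sv := coef_solvesOn_of_isSolution mh hh h0a hvh hvs
      intro t ht
      rw [hvh t ht]
      dsimp only
      rw [coef_eq_of_solvesOn mh mg hh hg (by linarith [ha.2]) hT1 h0a sv (hs.mono hsub) ?_ ht]
      rw [ec]
      funext k
      rw [← hcoef_synth_coef mh hh, ← hvh 0 h0a, hvs.initial]
  · obtain ⟨mg, hg, -⟩ := hG u₀ hu hur
    obtain ⟨mh, hh, -⟩ := hG v₀ hv hvr
    have hL := hLip u₀ hu hur v₀ hv hvr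
    have md : ∀ n, Measurable ((G u₀ - G v₀) n) := fun n => (mg n).sub (mh n)
    have hd : xn (9 / 8) (G u₀ - G v₀) ≠ ∞ := by
      have h1 := xn_add_le (9 / 8) (g := G u₀) (h := fun n ξ => -1 * G v₀ n ξ) mg
      rw [xn_const_mul] at h1
      have e : G u₀ + (fun n ξ => -1 * G v₀ n ξ) = G u₀ - G v₀ := by
        funext n ξ
        simp [sub_eq_add_neg]
      rw [e] at h1
      refine ne_top_of_le_ne_top ?_ h1
      finiteness
    refine ⟨fun t _ => le_toNNReal_mul_of_sq_le lipConst_ne_top (le_trans ?_ hL),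
      le_toNNReal_mul_of_sq_le lipConst_ne_top (le_trans ?_ hL)⟩
    · dsimp only
      rw [synth_coef_sub mg hg mh hh]
      refine (sobNorm_sq_le (synth_mem_homSpan _)).trans ?_
      simp only [hcoef_synth_coef md hd]
      gcongr
      refine (tsum_enorm_coef_sq_le md t).trans ?_
      gcongr
      exact le_add_self
    · refine (xNormT_le_of_xn md hd T fun t => ?_).trans ?_
      · exact synth_coef_sub mg hg mh hh t
      · gcongr
        nth_rewrite 1 [← one_mul (xn (9 / 8) (G u₀ - G v₀))]
        gcongr
        exact le_self_add
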